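/- Let $\tau\in\mathbb C$ with $\operatorname{Im}\tau>0$, $\Gamma=\mathbb Z+\tau\mathbb Z$, $\lambda\in\mathbb C\setminus\Gamma$, and let $\theta$ be the odd theta function: entire, $\theta(-u)=-\theta(u)$, $\theta(u+1)=-\theta(u)$, $\theta(u+\tau)=-e^{-2\pi iu-\pi i\tau}\theta(u)$, $\theta'(0)=1$. **Current algebras.** For a commutative $\mathbb C$-algebra $\mathfrak K$ of test functions with derivation $s\mapsto s'$ and invariant scalar product $\langle s,t\rangle$, let $\hat{\mathfrak g}=(\mathfrak{sl}_2\otimes\mathfrak K)\oplus\mathbb Cc\oplus\mathbb Cd$, with $\hat x[s]=x\otimes s$, $c$ central, $[d,\hat x[s]]=\hat x[s']$ and $[\hat x[s],\hat y[t]]=\widehat{[x,y]}[st]+c\,(x,y)\langle s',t\rangle$, where $[h,e]=2e$, $[h,f]=-2f$, $[e,f]=h$, $(e,f)=1$, $(h,h)=2$. It carries the invariant scalar product with $\langle\hat x[s],\hat y[t]\rangle=(x,y)\langle s,t\rangle$, $\langle c,d\rangle=1$, all other products of $c,d,\hat x[s]$ being $0$. Write $\mathfrak e_\tau(\widehat{\mathfrak{sl}}_2)=\hat{\mathfrak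 g}$ for $\mathfrak K=\mathcal K_0=\mathbb C[u^{-1}][[u]]$ with $\langle s,t\rangle=\operatorname{res}_{u=0}s(u)t(u)\,du$, and $\mathfrak u_\tau(\widehat{\mathfrak{sl}}_2)=\hat{\mathfrak g}$ for $\mathfrak K=K$, the algebra of entire functions with $s(u+1)=s(u)$ and $|s(u)|\le Ce^{p|\operatorname{Im}u|}$ for some $C,p>0$, with $\langle s,t\rangle=\int_{-1/2}^{1/2}\frac{du}{2\pi i}s(u)t(u)$. Tensor powers of $\hat{\mathfrak g}$ are completed weakly: tensors are identified with multilinear functionals by means of the scalar product, and sums, equalities and derivatives in a parameter are understood after pairing with arbitrary elements of $\hat{\mathfrak g}$. **Part 1.** In $\mathcal K_0$ put, for $n\ge0$, $\epsilon_{n;\lambda}=\epsilon_{n;0}=(-u)^n$, $\epsilon^{-n-1;\lambda}=\epsilon^{-n-1;0}=u^n$, $$\epsilon^{n;\lambda}=\tfrac1{n!}\Big(\tfrac{\theta(u+\lambda)}{\theta(u)\theta(\lambda)}\Big)^{(n)},\quad \epsilon_{-n-1;\lambda}=\tfrac{(-1)^n}{n!}\Big(\tfrac{\theta(u-\lambda)}{\theta(u)\theta(-\lambda)}\Big)^{(n)},\quad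 \epsilon^{n;0}=\tfrac1{n!}\Big(\tfrac{\theta'(u)}{\theta(u)}\Big)^{(n)},\quad \epsilon_{-n-1;0}=\tfrac{(-1)^n}{n!}\Big(\tfrac{\theta'(u)}{\theta(u)}\Big)^{(n)}$$ (Laurent expansions at $0$). Let $$r_\lambda=\tfrac12\sum_{n\ge0}\hat h[\epsilon^{n;0}]\otimes\hat h[\epsilon_{n;0}]+\sum_{n\ge0}\hat f[\epsilon^{n;\lambda}]\otimes\hat e[\epsilon_{n;\lambda}]+\sum_{n<0}\hat e[\epsilon_{n;\lambda}]\otimes\hat f[\epsilon^{n;\lambda}]+c\otimes d .$$ Then $r_\lambda$ and the series $[r_{\lambda,12},r_{\lambda,13}]$, $[r_{\lambda,12},r_{\lambda,23}]$, $[r_{\lambda,13},r_{\lambda,23}]$, $[x\otimes1+1\otimes x,r_\lambda]$ converge, $r_\lambda$ is differentiable in $\lambda$, and with $h=\hat h[\epsilon_{0;0}]$ $$[r_{\lambda,12},r_{\lambda,13}]+[r_{\lambda,12},r_{\lambda,23}]+[r_{\lambda,13},r_{\lambda,23}]=h_1\tfrac{\partial}{\partial\lambda}r_{\lambda,23}-h_2\tfrac{\partial}{\partial\lambda}r_{\lambda,13}+h_3\tfrac{\partial}{\partial\lambda}r_{\lambda,12}.$$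 **Part 2.** In $K$ put $j_n(u)=e^{2\pi inu}$, $j^n(u)=2\pi i\,e^{-2\pi inu}$, and let $$\mathfrak r_\lambda=\tfrac14\hat h[j^0]\otimes\hat h[j_0]+\tfrac12\sum_{n\ne0}\frac{\hat h[j^n]\otimes\hat h[j_n]}{1-e^{2\pi in\tau}}+\sum_{n\in\mathbb Z}\frac{\hat e[j^n]\otimes\hat f[j_n]}{1-e^{2\pi i(n\tau+\lambda)}}+\sum_{n\in\mathbb Z}\frac{\hat f[j^n]\otimes\hat e[j_n]}{1-e^{2\pi i(n\tau-\lambda)}}+c\otimes d .$$ Then the analogous series converge, $\mathfrak r_\lambda$ is differentiable in $\lambda$ and in $\tau$, and with $h=\hat h[j_0]$ $$[\mathfrak r_{\lambda,12},\mathfrak r_{\lambda,13}]+[\mathfrak r_{\lambda,12},\mathfrak r_{\lambda,23}]+[\mathfrak r_{\lambda,13},\mathfrak r_{\lambda,23}]=h_1\tfrac{\partial}{\partial\lambda}\mathfrak r_{\lambda,23}-h_2\tfrac{\partial}{\partial\lambda}\mathfrak r_{\lambda,13}+h_3\tfrac{\partial}{\partial\lambda}\mathfrak r_{\lambda,12}-c_1\tfrac{\partial}{\partial\tau}\mathfrak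 r_{\lambda,23}+c_2\tfrac{\partial}{\partial\tau}\mathfrak r_{\lambda,13}-c_3\tfrac{\partial}{\partial\tau}\mathfrak r_{\lambda,12}.$$ **Part 3.** In both cases, with $r=r_\lambda$ respectively $r=\mathfrak r_\lambda$, the scalar product of $\hat{\mathfrak g}$ is invariant and non-degenerate, and $\delta x=[x\otimes1+1\otimes x,r]$ and $\varphi=-[r_{12},r_{13}]-[r_{12},r_{23}]-[r_{13},r_{23}]$ make $\hat{\mathfrak g}$ a quasi-Lie bialgebra: $\delta$ is a one-cocycle with values in $\hat{\mathfrak g}\wedge\hat{\mathfrak g}$, $\varphi\in\hat{\mathfrak g}\wedge\hat{\mathfrak g}\wedge\hat{\mathfrak g}$, $\tfrac12\operatorname{Alt}(\delta\otimes\mathrm{id})\delta x=[x\otimes1\otimes1+1\otimes x\otimes1+1\otimes1\otimes x,\varphi]$ for all $x$, and $\operatorname{Alt}(\delta\otimes\mathrm{id}\otimes\mathrm{id})\varphi=0$, where $\operatorname{Alt}$ is the signed sum over all permutations of the tensor factors. -/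

import Mathlib

namespace EllipticCurrent

/-! ## Test function algebras -/

/-- A commutative algebra of test functions with its derivation `s ↦ s'` and the linear functional
`s ↦ ⟨s⟩` (integration over the contour), which vanishes on derivatives.
The invariant scalar product is `⟨s, t⟩ = ⟨s t⟩`. -/
class TestAlgebra (K : Type) [CommRing K] [Algebra ℂ K] where
  der : Derivation ℂ K K
  int : K →ₗ[ℂ] ℂ
  int_der : ∀ s, int (der s) = 0

/-! ### Formal Laurent series at the origin -/

/-- The algebra `K₀ = ℂ[u⁻¹][[u]]`. -/
abbrev K0 : Type := LaurentSeries ℂ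

/-- The coefficientwise `ℂ`-algebra structure of `ℂ((u))`. -/
noncomputable instance : Algebra ℂ K0 := HahnSeries.instAlgebra

theorem K0.leibniz (f g : LaurentSeries ℂ) :
    LaurentSeries.derivative ℂ (f * g) =
      f • LaurentSeries.derivative ℂ g + g • LaurentSeries.derivative ℂ f := by
  have hX : (HahnSeries.single (1 : ℤ) (1 : ℂ) : LaurentSeries ℂ) ≠ 0 :=
    HahnSeries.single_ne_zero one_ne_zero
  have hc : ∀ (f : LaurentSeries ℂ) (a : ℤ), (LaurentSeries.derivative ℂ f *
      HahnSeries.single (1 : ℤ) (1 : ℂ)).coeff a = (a : ℂ) * f.coeff a := by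
    intro f a
    rw [HahnSeries.coeff_mul_single]
    simp [LaurentSeries.derivative]
  have hs : ∀ f : LaurentSeries ℂ, (LaurentSeries.derivative ℂ f *
      HahnSeries.single (1 : ℤ) (1 : ℂ)).support ⊆ f.support := by
    intro f a ha
    rw [HahnSeries.mem_support, hc] at ha
    exact right_ne_zero_of_mul ha
  apply mul_right_cancel₀ hX
  rw [add_mul, smul_eq_mul, smul_eq_mul, mul_assoc, mul_assoc]
  ext a
  rw [hc, HahnSeries.coeff_add, mul_comm g,
    HahnSeries.coeff_mul_right' g.isPWO_support (hs g),
    HahnSeries.coeff_mul_left' f.isPWO_support (hs f), ← Finset.sum_add_distrib,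
    HahnSeries.coeff_mul, Finset.mul_sum]
  refine Finset.sum_congr rfl fun p hp => ?_
  rw [hc, hc]
  have h := (Finset.mem_antidiagonal.mp hp).2.2
  rw [← h]
  push_cast
  ring

/-- On `K₀` the derivation is `d/du` and the functional is the residue at `0`, that is
`∮ du / (2 π i)` over a small circle. -/
noncomputable instance : TestAlgebra K0 where
  der := Derivation.mk' (LaurentSeries.derivative ℂ) K0.leibniz
  int :=
    { toFun := fun s => s.coeff (-1)
      map_add' := fun s t => HahnSeries.coeff_add
      map_smul' := fun a s => HahnSeries.coeff_smul }
  int_der := fun s => by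
    change (LaurentSeries.derivative ℂ s).coeff (-1) = 0
    simp [LaurentSeries.derivative]

/-! ### Entire periodic functions -/

/-- The algebra `K = K(Cyl)` of entire functions with `s (u + 1) = s u` and
`|s u| ≤ C exp (p |Im u|)`. -/
def cylSubalgebra : Subalgebra ℂ (ℂ → ℂ) where
  carrier := {s | Differentiable ℂ s ∧ (∀ u, s (u + 1) = s u) ∧
    ∃ C p : ℝ, 0 < C ∧ 0 < p ∧ ∀ u, ‖s u‖ ≤ C * Real.exp (p * |u.im|)}
  mul_mem' := by
    rintro s t ⟨hs, hs1, C, p, hC, hp, h⟩ ⟨ht, ht1, C', p', hC', hp', h'⟩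
    refine ⟨hs.mul ht, fun u => by simp [hs1, ht1], C * C', p + p', by positivity,
      by positivity, fun u => ?_⟩
    rw [Pi.mul_apply, norm_mul, add_mul, Real.exp_add]
    calc ‖s u‖ * ‖t u‖ ≤ (C * Real.exp (p * |u.im|)) * (C' * Real.exp (p' * |u.im|)) :=
          mul_le_mul (h u) (h' u) (norm_nonneg _) (by positivity)
      _ = _ := by ring
  add_mem' := by
    rintro s t ⟨hs, hs1, C, p, hC, hp, h⟩ ⟨ht, ht1, C', p', hC', hp', h'⟩
    refine ⟨hs.add ht, fun u => by simp [hs1, ht1], C + C', p + p', by positivity,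
      by positivity, fun u => ?_⟩
    have e1 : Real.exp (p * |u.im|) ≤ Real.exp ((p + p') * |u.im|) := by
      apply Real.exp_le_exp.mpr
      exact mul_le_mul_of_nonneg_right (by linarith) (abs_nonneg _)
    have e2 : Real.exp (p' * |u.im|) ≤ Real.exp ((p + p') * |u.im|) := by
      apply Real.exp_le_exp.mpr
      exact mul_le_mul_of_nonneg_right (by linarith) (abs_nonneg _)
    calc ‖s u + t u‖ ≤ ‖s u‖ + ‖t u‖ := norm_add_le _ _
      _ ≤ C * Real.exp (p * |u.im|) + C' * Real.exp (p' * |u.im|) := add_le_add (h u) (h' u)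
      _ ≤ C * Real.exp ((p + p') * |u.im|) + C' * Real.exp ((p + p') * |u.im|) := by gcongr
      _ = _ := by ring
  algebraMap_mem' := by
    intro a
    refine ⟨differentiable_const a, fun u => rfl, ‖a‖ + 1, 1, by positivity, one_pos,
      fun u => ?_⟩
    have : (1 : ℝ) ≤ Real.exp (1 * |u.im|) := Real.one_le_exp (by positivity)
    calc ‖a‖ ≤ (‖a‖ + 1) * 1 := by linarith
      _ ≤ _ := by gcongr

/-- The algebra `K = K(Cyl)`. -/
abbrev KCyl : Type := cylSubalgebra

theorem KCyl.deriv_mem (s : KCyl) : deriv (s : ℂ → ℂ) ∈ cylSubalgebra := by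
  obtain ⟨s, hs, hs1, C, p, hC, hp, h⟩ := s
  refine ⟨?_, fun u => ?_, C * Real.exp p, p, by positivity, hp, fun u => ?_⟩
  · exact fun u => ((hs.differentiableOn (s := Set.univ)).deriv isOpen_univ u
      trivial).differentiableAt Filter.univ_mem
  · change deriv s (u + 1) = deriv s u
    rw [← deriv_comp_add_const]
    congr 1
    exact funext hs1
  · have := Complex.norm_deriv_le_of_forall_mem_sphere_norm_le (c := u) (R := 1)
      (C := C * Real.exp (p * (|u.im| + 1))) one_pos hs.diffContOnCl (fun z hz => ?_)
    · change ‖deriv s u‖ ≤ _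
      refine this.trans (le_of_eq ?_)
      rw [mul_add, mul_one, Real.exp_add]
      ring
    · refine (h z).trans ?_
      have h1 : |z.im| ≤ |u.im| + 1 := by
        have h2 : |(z - u).im| ≤ 1 := by
          have h3 := Complex.abs_im_le_norm (z - u)
          rw [mem_sphere_iff_norm] at hz
          linarith
        rw [Complex.sub_im] at h2
        have h4 : |z.im| ≤ |u.im| + |z.im - u.im| := by
          have := abs_add_le u.im (z.im - u.im)
          simpa using this
        linarith
      gcongr

theorem KCyl.differentiable (s : KCyl) : Differentiable ℂ (s : ℂ → ℂ) := s.2.1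

theorem KCyl.intervalIntegrable (s : KCyl) (a b : ℝ) :
    IntervalIntegrable (fun x : ℝ => (s : ℂ → ℂ) x) MeasureTheory.volume a b :=
  (s.differentiable.continuous.comp Complex.continuous_ofReal).intervalIntegrable a b

/-- On `K` the derivation is `d/du` and the functional is `∫_{-1/2}^{1/2} du / (2 π i)`. -/
noncomputable instance : TestAlgebra KCyl where
  der := Derivation.mk'
    { toFun := fun s => ⟨deriv (s : ℂ → ℂ), s.deriv_mem⟩
      map_add' := fun s t => Subtype.ext <| funext fun u => by
        change deriv ((s : ℂ → ℂ) + (t : ℂ → ℂ)) u = _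
        exact deriv_add (s.differentiable u) (t.differentiable u)
      map_smul' := fun a s => Subtype.ext <| funext fun u => by
        change deriv (a • (s : ℂ → ℂ)) u = _
        exact deriv_const_smul a (s.differentiable u) }
    (fun s t => Subtype.ext <| funext fun u => by
      change deriv ((s : ℂ → ℂ) * (t : ℂ → ℂ)) u =
        (s : ℂ → ℂ) u * deriv (t : ℂ → ℂ) u + (t : ℂ → ℂ) u * deriv (s : ℂ → ℂ) u
      rw [deriv_mul (s.differentiable u) (t.differentiable u)]
      ring)
  int :=
    { toFun := fun s => (2 * Real.pi * Complex.I)⁻¹ *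
        ∫ x in (-(1 / 2) : ℝ)..(1 / 2), (s : ℂ → ℂ) x
      map_add' := fun s t => by
        rw [← mul_add, ← intervalIntegral.integral_add (s.intervalIntegrable _ _)
          (t.intervalIntegrable _ _)]
        rfl
      map_smul' := fun a s => by
        change _ * ∫ x in (-(1 / 2) : ℝ)..(1 / 2), a * (s : ℂ → ℂ) x = a * _
        rw [intervalIntegral.integral_const_mul]
        ring }
  int_der := fun s => by
    change _ * ∫ x in (-(1 / 2) : ℝ)..(1 / 2), deriv (s : ℂ → ℂ) x = 0
    rw [intervalIntegral.integral_eq_sub_of_hasDerivAt (f := fun x : ℝ => (s : ℂ → ℂ) x)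
      (fun x _ => ((s.differentiable x).hasDerivAt).comp_ofReal)
      (KCyl.intervalIntegrable ⟨_, s.deriv_mem⟩ _ _)]
    have h := s.2.2.1 (-(1 / 2))
    norm_num at h ⊢
    rw [h, sub_self]

/-! ## The extended current algebra `(sl₂ ⊗ K) ⊕ ℂ c ⊕ ℂ d` -/

/-- The element `ê[e] + f̂[f] + ĥ[h] + c · c + d · d` of `(sl₂ ⊗ K) ⊕ ℂ c ⊕ ℂ d`. -/
@[ext]
structure CurrentAlgebra (K : Type) where
  e : K
  f : K
  h : K
  c : ℂ
  d : ℂ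

namespace CurrentAlgebra

variable {K : Type}

section

variable [CommRing K]

instance : Zero (CurrentAlgebra K) := ⟨⟨0, 0, 0, 0, 0⟩⟩

instance : Add (CurrentAlgebra K) :=
  ⟨fun x y => ⟨x.e + y.e, x.f + y.f, x.h + y.h, x.c + y.c, x.d + y.d⟩⟩

instance : Neg (CurrentAlgebra K) := ⟨fun x => ⟨-x.e, -x.f, -x.h, -x.c, -x.d⟩⟩

@[simp] theorem zero_e : (0 : CurrentAlgebra K).e = 0 := rfl
@[simp] theorem zero_f : (0 : CurrentAlgebra K).f = 0 := rfl
@[simp] theorem zero_h : (0 : CurrentAlgebra K).h = 0 := rfl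
@[simp] theorem zero_c : (0 : CurrentAlgebra K).c = 0 := rfl
@[simp] theorem zero_d : (0 : CurrentAlgebra K).d = 0 := rfl
@[simp] theorem add_e (x y : CurrentAlgebra K) : (x + y).e = x.e + y.e := rfl
@[simp] theorem add_f (x y : CurrentAlgebra K) : (x + y).f = x.f + y.f := rfl
@[simp] theorem add_h (x y : CurrentAlgebra K) : (x + y).h = x.h + y.h := rfl
@[simp] theorem add_c (x y : CurrentAlgebra K) : (x + y).c = x.c + y.c := rfl
@[simp] theorem add_d (x y : CurrentAlgebra K) : (x + y).d = x.d + y.d := rfl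
@[simp] theorem neg_e (x : CurrentAlgebra K) : (-x).e = -x.e := rfl
@[simp] theorem neg_f (x : CurrentAlgebra K) : (-x).f = -x.f := rfl
@[simp] theorem neg_h (x : CurrentAlgebra K) : (-x).h = -x.h := rfl
@[simp] theorem neg_c (x : CurrentAlgebra K) : (-x).c = -x.c := rfl
@[simp] theorem neg_d (x : CurrentAlgebra K) : (-x).d = -x.d := rfl
instance : AddCommGroup (CurrentAlgebra K) where
  add_assoc x y z := by ext <;> simp [add_assoc]
  zero_add x := by ext <;> simp
  add_zero x := by ext <;> simp
  add_comm x y := by ext <;> simp [add_comm]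
  neg_add_cancel x := by ext <;> simp
  nsmul := nsmulRec
  zsmul := zsmulRec

instance [Algebra ℂ K] : SMul ℂ (CurrentAlgebra K) :=
  ⟨fun a x => ⟨a • x.e, a • x.f, a • x.h, a * x.c, a * x.d⟩⟩

@[simp] theorem smul_e [Algebra ℂ K] (a : ℂ) (x : CurrentAlgebra K) : (a • x).e = a • x.e := rfl
@[simp] theorem smul_f [Algebra ℂ K] (a : ℂ) (x : CurrentAlgebra K) : (a • x).f = a • x.f := rfl
@[simp] theorem smul_h [Algebra ℂ K] (a : ℂ) (x : CurrentAlgebra K) : (a • x).h = a • x.h := rfl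
@[simp] theorem smul_c [Algebra ℂ K] (a : ℂ) (x : CurrentAlgebra K) : (a • x).c = a * x.c := rfl
@[simp] theorem smul_d [Algebra ℂ K] (a : ℂ) (x : CurrentAlgebra K) : (a • x).d = a * x.d := rfl

instance [Algebra ℂ K] : Module ℂ (CurrentAlgebra K) where
  one_smul x := by ext <;> simp
  mul_smul a b x := by ext <;> simp [mul_smul, mul_assoc]
  smul_zero a := by ext <;> simp
  smul_add a x y := by ext <;> simp [mul_add]
  add_smul a b x := by ext <;> simp [add_smul, add_mul]
  zero_smul x := by ext <;> simp

/-- `ê[s]`. -/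
def eHat (s : K) : CurrentAlgebra K := ⟨s, 0, 0, 0, 0⟩
/-- `f̂[s]`. -/
def fHat (s : K) : CurrentAlgebra K := ⟨0, s, 0, 0, 0⟩
/-- `ĥ[s]`. -/
def hHat (s : K) : CurrentAlgebra K := ⟨0, 0, s, 0, 0⟩
/-- The central element. -/
def cEl : CurrentAlgebra K := ⟨0, 0, 0, 1, 0⟩
/-- The cocentral element. -/
def dEl : CurrentAlgebra K := ⟨0, 0, 0, 0, 1⟩

end

variable [CommRing K] [Algebra ℂ K] [TestAlgebra K]

open TestAlgebra

/-- The bracket determined by `[h, e] = 2 e`, `[h, f] = -2 f`, `[e, f] = h`, by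
`[x̂[s], ŷ[t]] = [x, y]^[s t] + c (x, y) ⟨s', t⟩` with `(e, f) = 1`, `(h, h) = 2`, and by
`[d, x̂[s]] = x̂[s']`, with `c` central. -/
instance : Bracket (CurrentAlgebra K) (CurrentAlgebra K) where
  bracket x y :=
    { e := 2 * (x.h * y.e - x.e * y.h) + x.d • der y.e - y.d • der x.e
      f := -2 * (x.h * y.f - x.f * y.h) + x.d • der y.f - y.d • der x.f
      h := x.e * y.f - x.f * y.e + x.d • der y.h - y.d • der x.h
      c := int (der x.e * y.f + der x.f * y.e + 2 * (der x.h * y.h))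
      d := 0 }

theorem bracket_e (x y : CurrentAlgebra K) :
    ⁅x, y⁆.e = 2 * (x.h * y.e - x.e * y.h) + x.d • der y.e - y.d • der x.e := rfl
theorem bracket_f (x y : CurrentAlgebra K) :
    ⁅x, y⁆.f = -2 * (x.h * y.f - x.f * y.h) + x.d • der y.f - y.d • der x.f := rfl
theorem bracket_h (x y : CurrentAlgebra K) :
    ⁅x, y⁆.h = x.e * y.f - x.f * y.e + x.d • der y.h - y.d • der x.h := rfl
theorem bracket_c (x y : CurrentAlgebra K) :
    ⁅x, y⁆.c = int (der x.e * y.f + der x.f * y.e + 2 * (der x.h * y.h)) := rfl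
@[simp] theorem bracket_d (x y : CurrentAlgebra K) : ⁅x, y⁆.d = 0 := rfl

instance : LieRing (CurrentAlgebra K) where
  add_lie x y z := by
    ext
    · simp only [bracket_e, add_e, add_h, add_d, map_add, add_smul, smul_add]; ring
    · simp only [bracket_f, add_f, add_h, add_d, map_add, add_smul, smul_add]; ring
    · simp only [bracket_h, add_e, add_f, add_h, add_d, map_add, add_smul, smul_add]; ring
    · rw [add_c, bracket_c, bracket_c, bracket_c, ← map_add int]
      congr 1
      simp only [add_e, add_f, add_h, map_add]
      ring
    · simp
  lie_add x y z := by
    ext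
    · simp only [bracket_e, add_e, add_h, add_d, map_add, add_smul, smul_add]; ring
    · simp only [bracket_f, add_f, add_h, add_d, map_add, add_smul, smul_add]; ring
    · simp only [bracket_h, add_e, add_f, add_h, add_d, map_add, add_smul, smul_add]; ring
    · rw [add_c, bracket_c, bracket_c, bracket_c, ← map_add int]
      congr 1
      simp only [add_e, add_f, add_h]
      ring
    · simp
  lie_self x := by
    ext
    · simp only [bracket_e, zero_e]; ring
    · simp only [bracket_f, zero_f]; ring
    · simp only [bracket_h, zero_h]; ring
    · rw [bracket_c, zero_c, ← int_der (x.e * x.f + x.h * x.h)]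
      congr 1
      simp only [map_add, Derivation.leibniz, smul_eq_mul]
      ring
    · simp
  leibniz_lie x y z := by
    have hA : ∀ a : ℂ, der (algebraMap ℂ K a) = 0 := fun a => Derivation.map_algebraMap _ _
    have h2 : der (2 : K) = 0 := by
      have := hA 2
      rwa [map_ofNat] at this
    ext
    · simp only [bracket_e, bracket_h, bracket_d, add_e, map_add, map_sub,
        Derivation.leibniz, smul_eq_mul, Algebra.smul_def, map_zero, hA, h2]
      ring
    · simp only [bracket_f, bracket_h, bracket_d, add_f, map_add, map_sub, map_neg,
        Derivation.leibniz, smul_eq_mul, Algebra.smul_def, map_zero, hA, h2]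
      ring
    · simp only [bracket_e, bracket_f, bracket_h, bracket_d, add_h, map_add, map_sub,
        Derivation.leibniz, smul_eq_mul, Algebra.smul_def, map_zero, hA]
      ring
    · rw [add_c, bracket_c, bracket_c, bracket_c, ← map_add int, ← sub_eq_zero, ← map_sub int,
        ← int_der (y.d • (der x.e * z.f + der x.f * z.e + 2 * (der x.h * z.h)) -
          x.d • (der y.e * z.f + der y.f * z.e + 2 * (der y.h * z.h)))]
      congr 1
      simp only [bracket_e, bracket_f, bracket_h, map_add, map_sub, map_neg,
        Derivation.leibniz, smul_eq_mul, Algebra.smul_def, hA, h2]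
      ring
    · simp

instance : LieAlgebra ℂ (CurrentAlgebra K) where
  lie_smul a x y := by
    have hA : der (algebraMap ℂ K a) = 0 := Derivation.map_algebraMap _ _
    ext
    · simp only [bracket_e, smul_e, smul_h, smul_d, Derivation.leibniz, smul_eq_mul,
        Algebra.smul_def, map_mul, hA]
      ring
    · simp only [bracket_f, smul_f, smul_h, smul_d, Derivation.leibniz, smul_eq_mul,
        Algebra.smul_def, map_mul, hA]
      ring
    · simp only [bracket_h, smul_e, smul_f, smul_h, smul_d, Derivation.leibniz, smul_eq_mul,
        Algebra.smul_def, map_mul, hA]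
      ring
    · rw [smul_c, bracket_c, bracket_c]
      change _ = a • int _
      rw [← map_smul int]
      congr 1
      simp only [smul_e, smul_f, smul_h, Algebra.smul_def]; ring
    · simp

variable (K) in
/-- The invariant scalar product: `⟨x̂[s], ŷ[t]⟩ = (x, y) ⟨s, t⟩`, `⟨c, d⟩ = 1`, and all other
products of `c`, `d`, `x̂[s]` vanish. -/
def form : LinearMap.BilinForm ℂ (CurrentAlgebra K) :=
  LinearMap.mk₂ ℂ
    (fun x y => int (x.e * y.f + x.f * y.e + 2 * (x.h * y.h)) + x.c * y.d + x.d * y.c)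
    (fun x x' y => by
      have : (x + x').e * y.f + (x + x').f * y.e + 2 * ((x + x').h * y.h) =
          (x.e * y.f + x.f * y.e + 2 * (x.h * y.h)) +
            (x'.e * y.f + x'.f * y.e + 2 * (x'.h * y.h)) := by
        simp only [add_e, add_f, add_h]; ring
      rw [this, map_add, add_c, add_d]; ring)
    (fun a x y => by
      have : (a • x).e * y.f + (a • x).f * y.e + 2 * ((a • x).h * y.h) =
          a • (x.e * y.f + x.f * y.e + 2 * (x.h * y.h)) := by
        simp only [smul_e, smul_f, smul_h, Algebra.smul_def]; ring
      rw [this, map_smul, smul_c, smul_d]; simp only [smul_eq_mul]; ring)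
    (fun x y y' => by
      have : x.e * (y + y').f + x.f * (y + y').e + 2 * (x.h * (y + y').h) =
          (x.e * y.f + x.f * y.e + 2 * (x.h * y.h)) +
            (x.e * y'.f + x.f * y'.e + 2 * (x.h * y'.h)) := by
        simp only [add_e, add_f, add_h]; ring
      rw [this, map_add, add_c, add_d]; ring)
    (fun a x y => by
      have : x.e * (a • y).f + x.f * (a • y).e + 2 * (x.h * (a • y).h) =
          a • (x.e * y.f + x.f * y.e + 2 * (x.h * y.h)) := by
        simp only [smul_e, smul_f, smul_h, Algebra.smul_def]; ring
      rw [this, map_smul, smul_c, smul_d]; simp only [smul_eq_mul]; ring)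

end CurrentAlgebra

/-! ## Completed tensor products

Let `L` be a Lie algebra with an invariant scalar product `κ`. The tensor powers of `L` are
completed in the weak topology: `a ⊗ b` is identified with the functional
`x ⊗ y ↦ κ a x * κ b y` on `L ⊗ L`, convergence is convergence of all these values, and
elements of the completed tensor powers are the multilinear functionals. -/

section Tensors

variable {L : Type} [LieRing L] [LieAlgebra ℂ L] (κ : LinearMap.BilinForm ℂ L)

/-- `a ⊗ b` as an element of the completion of `L ⊗ L`. -/
def tensor₂ (a b : L) : L → L → ℂ := fun x y => κ a x * κ b y

/-- `a ⊗ b ⊗ c` as an element of the completion of `L ⊗ L ⊗ L`. -/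
def tensor₃ (a b c : L) : L → L → L → ℂ := fun x y z => κ a x * κ b y * κ c z

variable {ι : Type} (r : ι → L × L)

/-- The terms of `[r₁₂, r₁₃]` for `r = ∑ aᵢ ⊗ bᵢ`, `r i = (aᵢ, bᵢ)`:
`[aᵢ ⊗ bᵢ ⊗ 1, aⱼ ⊗ 1 ⊗ bⱼ] = [aᵢ, aⱼ] ⊗ bᵢ ⊗ bⱼ`. -/
def term₁₂₁₃ (p : ι × ι) : L → L → L → ℂ :=
  tensor₃ κ ⁅(r p.1).1, (r p.2).1⁆ (r p.1).2 (r p.2).2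

/-- The terms `[aᵢ ⊗ bᵢ ⊗ 1, 1 ⊗ aⱼ ⊗ bⱼ] = aᵢ ⊗ [bᵢ, aⱼ] ⊗ bⱼ` of `[r₁₂, r₂₃]`. -/
def term₁₂₂₃ (p : ι × ι) : L → L → L → ℂ :=
  tensor₃ κ (r p.1).1 ⁅(r p.1).2, (r p.2).1⁆ (r p.2).2

/-- The terms `[aᵢ ⊗ 1 ⊗ bᵢ, 1 ⊗ aⱼ ⊗ bⱼ] = aᵢ ⊗ aⱼ ⊗ [bᵢ, bⱼ]` of `[r₁₃, r₂₃]`. -/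
def term₁₃₂₃ (p : ι × ι) : L → L → L → ℂ :=
  tensor₃ κ (r p.1).1 (r p.2).1 ⁅(r p.1).2, (r p.2).2⁆

/-- The terms `[x, aᵢ] ⊗ bᵢ + aᵢ ⊗ [x, bᵢ]` of `[x ⊗ 1 + 1 ⊗ x, r]`. -/
def termCobracket (x : L) (i : ι) : L → L → ℂ :=
  tensor₂ κ ⁅x, (r i).1⁆ (r i).2 + tensor₂ κ (r i).1 ⁅x, (r i).2⁆

/-- Convergence of the series `r = ∑ aᵢ ⊗ bᵢ`, of the double series `[r₁₂, r₁₃]`, `[r₁₂, r₂₃]`,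
`[r₁₃, r₂₃]`, and of `[x ⊗ 1 + 1 ⊗ x, r]` in the completed tensor powers of `L`. -/
structure Converges : Prop where
  tensor : Summable fun i => tensor₂ κ (r i).1 (r i).2
  summable₁₂₁₃ : Summable (term₁₂₁₃ κ r)
  summable₁₂₂₃ : Summable (term₁₂₂₃ κ r)
  summable₁₃₂₃ : Summable (term₁₃₂₃ κ r)
  cobracket : ∀ x, Summable (termCobracket κ r x)

/-- The element `r = ∑ aᵢ ⊗ bᵢ` of the completion of `L ⊗ L`. -/
noncomputable def tensorSum : L → L → ℂ := ∑' i, tensor₂ κ (r i).1 (r i).2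

/-- `[r₁₂, r₁₃] + [r₁₂, r₂₃] + [r₁₃, r₂₃]`. -/
noncomputable def yangBaxter : L → L → L → ℂ :=
  ∑' p, term₁₂₁₃ κ r p + ∑' p, term₁₂₂₃ κ r p + ∑' p, term₁₃₂₃ κ r p

/-- The cobracket `δ x = [x ⊗ 1 + 1 ⊗ x, r]`. -/
noncomputable def cobracket (x : L) : L → L → ℂ := ∑' i, termCobracket κ r x i

/-- `a₁ t₂₃ - a₂ t₁₃ + a₃ t₁₂`. -/
def insertCyc (a : L) (t : L → L → ℂ) : L → L → L → ℂ :=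
  fun x y z => κ a x * t y z - κ a y * t x z + κ a z * t x y

/-- `∑ sign(σ) T^σ` over the permutations of the three tensor factors. -/
def alt₃ (T : L → L → L → ℂ) (v : Fin 3 → L) : ℂ :=
  ∑ σ : Equiv.Perm (Fin 3), ((Equiv.Perm.sign σ : ℤ) : ℂ) * T (v (σ 0)) (v (σ 1)) (v (σ 2))

/-- `∑ sign(σ) T^σ` over the permutations of the four tensor factors. -/
def alt₄ (T : L → L → L → L → ℂ) (v : Fin 4 → L) : ℂ :=
  ∑ σ : Equiv.Perm (Fin 4), ((Equiv.Perm.sign σ : ℤ) : ℂ) *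
    T (v (σ 0)) (v (σ 1)) (v (σ 2)) (v (σ 3))

/-- `[x ⊗ 1 + 1 ⊗ x, t]`, in terms of functionals (`κ` is invariant). -/
def act₂ (x : L) (t : L → L → ℂ) : L → L → ℂ :=
  fun y z => -t ⁅x, y⁆ z - t y ⁅x, z⁆

/-- `[x ⊗ 1 ⊗ 1 + 1 ⊗ x ⊗ 1 + 1 ⊗ 1 ⊗ x, t]`, in terms of functionals (`κ` is invariant). -/
def act₃ (x : L) (t : L → L → L → ℂ) : L → L → L → ℂ :=
  fun y z w => -t ⁅x, y⁆ z w - t y ⁅x, z⁆ w - t y z ⁅x, w⁆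

/-- A quasi-Lie bialgebra `(L, δ, φ)`: `δ : L → L ∧ L` is a one-cocycle, `φ ∈ L ∧ L ∧ L`,
`½ Alt (δ ⊗ id) δ x = [x ⊗ 1 ⊗ 1 + 1 ⊗ x ⊗ 1 + 1 ⊗ 1 ⊗ x, φ]` and `Alt (δ ⊗ id ⊗ id) φ = 0`,
all in the completed tensor powers of `L`. The map `m` is the transpose of `δ`, so that
`((δ ⊗ id) t) (y, z, w) = t (m y z, w)` extends `a ⊗ b ↦ δ a ⊗ b` by weak continuity,
and similarly for `δ ⊗ id ⊗ id`. -/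
structure IsQuasiLieBialgebra (δ : L → L → L → ℂ) (φ : L → L → L → ℂ) : Prop where
  invariant : ∀ x y z, κ ⁅x, y⁆ z = κ x ⁅y, z⁆
  nondegenerate : κ.Nondegenerate
  linear : ∃ D : L →ₗ[ℂ] L →ₗ[ℂ] L →ₗ[ℂ] ℂ, ∀ x y z, D x y z = δ x y z
  trilinear : ∃ P : L →ₗ[ℂ] L →ₗ[ℂ] L →ₗ[ℂ] ℂ, ∀ x y z, P x y z = φ x y z
  skew : ∀ x y z, δ x z y = -δ x y z
  skew₁₂ : ∀ x y z, φ y x z = -φ x y z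
  skew₂₃ : ∀ x y z, φ x z y = -φ x y z
  cocycle : ∀ x y, δ ⁅x, y⁆ = act₂ x (δ y) - act₂ y (δ x)
  quasiCoJacobi : ∃ m : L →ₗ[ℂ] L →ₗ[ℂ] L, (∀ x y z, κ x (m y z) = δ x y z) ∧
    (∀ x (v : Fin 3 → L), (1 / 2 : ℂ) * alt₃ (fun y z w => δ x (m y z) w) v =
      act₃ x φ (v 0) (v 1) (v 2)) ∧
    ∀ v : Fin 4 → L, alt₄ (fun y z w t => φ (m y z) w t) v = 0

end Tensors

/-! ## The odd theta function and the elliptic bases of `K₀` -/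

/-- The period lattice `Γ = ℤ + τ ℤ`. -/
def periodLattice (τ : ℂ) : Set ℂ := {z | ∃ m n : ℤ, z = m + n * τ}

/-- The odd theta function with `θ'(0) = 1`, by its product formula. -/
noncomputable def theta (τ u : ℂ) : ℂ :=
  Complex.sin (Real.pi * u) / Real.pi *
    ∏' n : ℕ, (1 - Complex.exp (2 * Real.pi * Complex.I * ((n + 1) * τ + u))) *
      (1 - Complex.exp (2 * Real.pi * Complex.I * ((n + 1) * τ - u))) /
        (1 - Complex.exp (2 * Real.pi * Complex.I * ((n + 1) * τ))) ^ 2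

/-- The characteristic properties of the odd theta function. -/
structure IsOddTheta (τ : ℂ) (θ : ℂ → ℂ) : Prop where
  holomorphic : Differentiable ℂ θ
  odd : ∀ u, θ (-u) = -θ u
  add_one : ∀ u, θ (u + 1) = -θ u
  add_tau : ∀ u, θ (u + τ) =
    -Complex.exp (-2 * Real.pi * Complex.I * u - Real.pi * Complex.I * τ) * θ u
  deriv_zero : deriv θ 0 = 1

/-- The Taylor expansion of `u ↦ g (a + u)` at `u = 0`, as an element of `K₀`. -/
noncomputable def taylor (g : ℂ → ℂ) (a : ℂ) : K0 :=
  HahnSeries.ofPowerSeries ℤ ℂ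
    (PowerSeries.mk fun n => iteratedDeriv n g a / (n.factorial : ℂ))

/-- The Laurent expansion of `θ(u + λ) / (θ(u) θ(λ))` at `u = 0`. -/
noncomputable def sigma (τ lam : ℂ) : K0 :=
  (theta τ lam)⁻¹ • (taylor (theta τ) lam / taylor (theta τ) 0)

/-- The Laurent expansion of `θ'(u) / θ(u)` at `u = 0`. -/
noncomputable def rho (τ : ℂ) : K0 :=
  taylor (deriv (theta τ)) 0 / taylor (theta τ) 0

/-- The coordinate `u`, as an element of `K₀`. -/
noncomputable def uCoord : K0 := HahnSeries.single 1 1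

/-- `s⁽ⁿ⁾ / n!`. -/
noncomputable def divDer (n : ℕ) (s : K0) : K0 :=
  (n.factorial : ℂ)⁻¹ • (TestAlgebra.der (K := K0))^[n] s

/-- `ε^{n;λ}` for `λ ∉ Γ`; here `Int.negSucc n` is `-n - 1`. -/
noncomputable def epsUp (τ lam : ℂ) : ℤ → K0
  | Int.ofNat n => divDer n (sigma τ lam)
  | Int.negSucc n => uCoord ^ n

/-- `ε_{n;λ}` for `λ ∉ Γ`. -/
noncomputable def epsDown (τ lam : ℂ) : ℤ → K0
  | Int.ofNat n => (-uCoord) ^ n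
  | Int.negSucc n => (-1) ^ n * divDer n (sigma τ (-lam))

/-- `ε^{n;0}`. -/
noncomputable def epsUp0 (τ : ℂ) : ℤ → K0
  | Int.ofNat n => divDer n (rho τ)
  | Int.negSucc n => uCoord ^ n

/-- `ε_{n;0}`. -/
noncomputable def epsDown0 (τ : ℂ) : ℤ → K0
  | Int.ofNat n => (-uCoord) ^ n
  | Int.negSucc n => (-1) ^ n * divDer n (rho τ)

/-! ## The universal r-matrix of `e_τ(sl₂^)` -/

/-- The Lie algebra `e_τ(sl₂^)`. -/
abbrev ETau : Type := CurrentAlgebra K0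

/-- The index set of the series defining the universal r-matrix of `e_τ(sl₂^)`. -/
inductive EIndex : Type
  | hh (n : ℕ)
  | fe (n : ℕ)
  | ef (n : ℕ)
  | cd

open CurrentAlgebra

/-- The terms `½ ĥ[ε^{n;0}] ⊗ ĥ[ε_{n;0}]` and `f̂[ε^{n;λ}] ⊗ ê[ε_{n;λ}]` for `n ≥ 0`,
`ê[ε_{k;λ}] ⊗ f̂[ε^{k;λ}]` for `k = -n - 1 < 0`, and `c ⊗ d`. -/
noncomputable def rE (τ lam : ℂ) : EIndex → ETau × ETau
  | .hh n => ((1 / 2 : ℂ) • hHat (epsUp0 τ (Int.ofNat n)), hHat (epsDown0 τ (Int.ofNat n)))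
  | .fe n => (fHat (epsUp τ lam (Int.ofNat n)), eHat (epsDown τ lam (Int.ofNat n)))
  | .ef n => (eHat (epsDown τ lam (Int.negSucc n)), fHat (epsUp τ lam (Int.negSucc n)))
  | .cd => (cEl, dEl)

/-! ## The universal r-matrix of `u_τ(sl₂^)` -/

/-- The Lie algebra `u_τ(sl₂^)`. -/
abbrev UTau : Type := CurrentAlgebra KCyl

/-- `j_n(u) = e^{2 π i n u}`. -/
noncomputable def jDown (n : ℤ) : KCyl :=
  ⟨fun u => Complex.exp (2 * Real.pi * Complex.I * n * u), by
    refine ⟨by fun_prop, fun u => ?_, 1, 2 * Real.pi * |(n : ℝ)| + 1, one_pos, by positivity,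
      fun u => ?_⟩
    · change Complex.exp _ = Complex.exp _
      rw [show 2 * Real.pi * Complex.I * n * (u + 1) =
        2 * Real.pi * Complex.I * n * u + n * (2 * Real.pi * Complex.I) by ring,
        Complex.exp_add, Complex.exp_int_mul_two_pi_mul_I, mul_one]
    · rw [one_mul, Complex.norm_exp]
      apply Real.exp_le_exp.mpr
      have h1 : (2 * Real.pi * Complex.I * n * u : ℂ).re = -(2 * Real.pi * (n * u.im)) := by
        simp [Complex.mul_re, Complex.mul_im]
        ring
      rw [h1]
      have h2 : -((n : ℝ) * u.im) ≤ |(n : ℝ)| * |u.im| := by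
        rw [← abs_mul]
        exact neg_le_abs _
      nlinarith [Real.pi_pos, abs_nonneg u.im]⟩

/-- `j^n(u) = 2 π i e^{-2 π i n u}`. -/
noncomputable def jUp (n : ℤ) : KCyl := (2 * Real.pi * Complex.I) • jDown (-n)

/-- The index set of the series defining the universal r-matrix of `u_τ(sl₂^)`. -/
inductive UIndex : Type
  | hh (n : ℤ)
  | ef (n : ℤ)
  | fe (n : ℤ)
  | cd

/-- `1 / (1 - e^{2 π i z})`. -/
noncomputable def greenCoeff (z : ℂ) : ℂ := 1 / (1 - Complex.exp (2 * Real.pi * Complex.I * z))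

/-- The terms `¼ ĥ[j^0] ⊗ ĥ[j_0]`, `½ ĥ[j^n] ⊗ ĥ[j_n] / (1 - e^{2 π i n τ})` for `n ≠ 0`,
`ê[j^n] ⊗ f̂[j_n] / (1 - e^{2 π i (n τ + λ)})`, `f̂[j^n] ⊗ ê[j_n] / (1 - e^{2 π i (n τ - λ)})`,
and `c ⊗ d`. -/
noncomputable def rU (τ lam : ℂ) : UIndex → UTau × UTau
  | .hh n => ((if n = 0 then (1 / 4 : ℂ) else 1 / 2 * greenCoeff (n * τ)) • hHat (jUp n),
      hHat (jDown n))
  | .ef n => (greenCoeff (n * τ + lam) • eHat (jUp n), fHat (jDown n))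
  | .fe n => (greenCoeff (n * τ - lam) • fHat (jUp n), eHat (jDown n))
  | .cd => (cEl, dEl)

end EllipticCurrent

open EllipticCurrent CurrentAlgebra

namespace EllipticCurrent

/-! ## Coboundary quasi-Lie bialgebras from classical r-matrices -/

/-! The invariant scalar product κ turns r = ∑ aᵢ ⊗ bᵢ into an operator ρ with r(x, y) = κ(x, ρ y),
and r + r₂₁ = t, with t the tensor of κ, says that the adjoint of ρ is 1 − ρ. Write x₊ = ρ x and x₋
= x − ρ x. Then the left side of the Yang-Baxter equation is κ(x₊, [y₊, z₊]) + κ(x₋, [y₋, z₋]), and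
the transpose of δ is m(y, z) = [y₋, z₋] − [y₊, z₊]. All axioms of a quasi-Lie bialgebra now follow
from the Jacobi identity and the invariance of κ, without any knowledge of φ
(`IsRMatrix.isQuasiLieBialgebra`).

On a current algebra ρ acts on the e, f, h, c, d components by A, B, H, 1, 0. Expanding the
invariant three-form reduces the dynamical equation to one scalar identity, ⟨Hw · Aa · Bb⟩ + ⟨(w −
Hw)(a − Aa)(b − Bb)⟩ = ⟨w⟩ Q(a, b), plus a central term built from the cocycle ⟨(y₋)', z₋⟩
(`yangBaxter_compOp`). It remains to prove this identity and to recognise Q as ∂r/∂λ and the cocycle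
as −∂r/∂τ.

On the cylinder the growth condition leaves only trigonometric polynomials. The operators are
diagonal, with eigenvalues values of G(z) = 1/(1 − e^{2πiz}), apart from the value 1/2 on the
constant mode of h. The identity is G(x)G(y)G(z) + (1 − G(x))(1 − G(y))(1 − G(z)) = 0 for x + y + z
= 0, and both derivatives come from G' = −2πi G(1 − G).

On Laurent series the operators are projections along the regular series, which replace s by the
combination of derivatives of a kernel with simple pole that has the principal part of s. The
products with three regular factors have no residue. For the others, the addition theorem rests on
two facts: a function with the multipliers of θ(u + λ)/θ(u), λ ∉ Γ, and poles only on Γ is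
determined by its principal part at 0 (Liouville), and the images for the kernels with parameters λ
and −λ are orthogonal (reflection u ↦ −u). The cocycle term vanishes because it pairs two regular
series. -/

/-- Only finitely many columns are nonzero, so the double series is a finite sum of single series
and no uniformity between columns is needed. -/
theorem hasSum_prod_of_finset {ι α : Type} [AddCommMonoid α] [TopologicalSpace α]
    [ContinuousAdd α] (f : ι × ι → α) (F : Finset ι) (g : ι → α)
    (hF : ∀ i, ∀ j ∉ F, f (i, j) = 0) (hg : ∀ j ∈ F, HasSum (fun i => f (i, j)) (g j)) :
    HasSum f (∑ j ∈ F, g j) := by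
  classical
  have h1 : f = fun p => ∑ j ∈ F, if p.2 = j then f p else 0 := by
    funext p
    rw [Finset.sum_ite_eq]
    split_ifs with h
    · rfl
    · exact hF p.1 p.2 h
  rw [h1]
  refine hasSum_sum fun j hj => ?_
  have hinj : Function.Injective fun i : ι => (i, j) := fun a b h => (Prod.mk.inj h).1
  refine (hinj.hasSum_iff ?_).1 ?_
  · rintro ⟨a, b⟩ hab
    rw [if_neg]
    rintro rfl
    exact hab ⟨a, rfl⟩
  · simpa [Function.comp_def] using hg j hj

/-! ### Signed sums over permutations of three and four factors -/

theorem alt₃_eq {L : Type} (T : L → L → L → ℂ) (v : Fin 3 → L) :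
    alt₃ T v = T (v 0) (v 1) (v 2) - T (v 0) (v 2) (v 1) - T (v 1) (v 0) (v 2)
      + T (v 1) (v 2) (v 0) + T (v 2) (v 0) (v 1) - T (v 2) (v 1) (v 0) := by
  have h : (Finset.univ : Finset (Equiv.Perm (Fin 3))) =
      {1, Equiv.swap 1 2, Equiv.swap 0 1, Equiv.swap 0 1 * Equiv.swap 1 2,
        Equiv.swap 0 2 * Equiv.swap 1 2, Equiv.swap 0 2} := by decide
  rw [alt₃, h]
  repeat rw [Finset.sum_insert (by decide)]
  rw [Finset.sum_singleton]
  simp [Equiv.swap_apply_def]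
  ring

/-- A permutation of four letters amounts to the image p of 0 and a permutation of the other three
letters; the transposition of 0 and p contributes the sign. -/
theorem alt₄_eq_sum {L : Type} (T : L → L → L → L → ℂ) (v : Fin 4 → L) :
    alt₄ T v = ∑ p : Fin 4, (if p = 0 then 1 else -1) *
      alt₃ (T (v p)) (fun i => v (Equiv.swap 0 p i.succ)) := by
  rw [alt₄, ← Equiv.sum_comp Equiv.Perm.decomposeFin.symm, Fintype.sum_prod_type]
  refine Finset.sum_congr rfl fun p _ => ?_
  rw [alt₃, Finset.mul_sum]
  refine Finset.sum_congr rfl fun e _ => ?_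
  rw [Equiv.Perm.decomposeFin.symm_sign, Equiv.Perm.decomposeFin_symm_apply_zero,
    show (1 : Fin 4) = Fin.succ 0 from rfl, show (2 : Fin 4) = Fin.succ 1 from rfl,
    show (3 : Fin 4) = Fin.succ 2 from rfl]
  simp only [Equiv.Perm.decomposeFin_symm_apply_succ]
  split_ifs <;> simp

/-- Skewness inside both pairs makes the 24 terms fall into six classes of four equal terms, one
class for each choice of the letters in the first pair. -/
theorem alt₄_eq {L : Type} (T : L → L → L → L → ℂ) (v : Fin 4 → L)
    (h₁ : ∀ a b c d, T b a c d = -T a b c d) (h₂ : ∀ a b c d, T a b d c = -T a b c d) :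
    alt₄ T v = 4 * (T (v 0) (v 1) (v 2) (v 3) + T (v 2) (v 3) (v 0) (v 1)
      - (T (v 0) (v 2) (v 1) (v 3) + T (v 1) (v 3) (v 0) (v 2))
      + (T (v 0) (v 3) (v 1) (v 2) + T (v 1) (v 2) (v 0) (v 3))) := by
  have e1 : Equiv.swap (0 : Fin 4) 1 2 = 2 ∧ Equiv.swap (0 : Fin 4) 1 3 = 3 ∧
      Equiv.swap (0 : Fin 4) 2 1 = 1 ∧ Equiv.swap (0 : Fin 4) 2 3 = 3 ∧
      Equiv.swap (0 : Fin 4) 3 1 = 1 ∧ Equiv.swap (0 : Fin 4) 3 2 = 2 := by decide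
  obtain ⟨e1, e2, e3, e4, e5, e6⟩ := e1
  rw [alt₄_eq_sum]
  simp only [Fin.sum_univ_four, alt₃_eq, show Fin.succ (0 : Fin 3) = 1 from rfl,
    show Fin.succ (1 : Fin 3) = 2 from rfl, show Fin.succ (2 : Fin 3) = 3 from rfl,
    Equiv.swap_self, Equiv.refl_apply, Equiv.swap_apply_right, e1, e2, e3, e4, e5, e6]
  rw [if_pos trivial, if_neg (by decide), if_neg (by decide), if_neg (by decide)]
  -- The twelve uses of `h₁` sort the first pair, each pattern occurring with two orders of the last
  -- pair; the six uses of `h₂` then sort the last pair.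
  rw [h₁ (v 0) (v 1), h₁ (v 0) (v 1), h₁ (v 0) (v 2), h₁ (v 0) (v 2), h₁ (v 0) (v 3),
    h₁ (v 0) (v 3), h₁ (v 1) (v 2), h₁ (v 1) (v 2), h₁ (v 1) (v 3), h₁ (v 1) (v 3),
    h₁ (v 2) (v 3), h₁ (v 2) (v 3), h₂ _ _ (v 2) (v 3), h₂ _ _ (v 1) (v 3), h₂ _ _ (v 1) (v 2),
    h₂ _ _ (v 0) (v 3), h₂ _ _ (v 0) (v 2), h₂ _ _ (v 0) (v 1)]
  ring

/-! ### Tensors as operators, and the quasi-Lie bialgebra of an r-matrix -/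

section RMatrix

variable {L : Type} [LieRing L] [LieAlgebra ℂ L] (κ : LinearMap.BilinForm ℂ L)
  {ι : Type} (r : ι → L × L) (ρ : L →ₗ[ℂ] L)

/-- The series `r = ∑ aᵢ ⊗ bᵢ` converges to the functional `κ(x, ρ y)` and satisfies
`r + r₂₁ = t`, where `t` is the tensor of the invariant scalar product `κ`. -/
structure IsRMatrix : Prop where
  symm : ∀ x y, κ x y = κ y x
  invariant : ∀ x y z, κ ⁅x, y⁆ z = κ x ⁅y, z⁆
  separating : ∀ x, (∀ y, κ x y = 0) → x = 0
  finite : ∀ y, (Function.support fun i => κ (r i).2 y).Finite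
  hasSum : ∀ x y, HasSum (fun i => κ (r i).1 x * κ (r i).2 y) (κ x (ρ y))
  unitary : ∀ x y, κ x (ρ y) + κ (ρ x) y = κ x y
  -- The series ∑ κ(aⱼ, y) bⱼ formally equals y − ρ y, but it may be infinite. What [r₁₃, r₂₃] needs
  -- is only that a finite part of it can replace y − ρ y once it is bracketed with z and hit by ρ.
  exists_finset : ∀ y z, ∃ F : Finset ι,
    (∀ i, ∀ j ∉ F, κ (r j).1 y * κ (r i).2 ⁅(r j).2, z⁆ = 0) ∧
      ρ ⁅∑ j ∈ F, κ (r j).1 y • (r j).2, z⁆ = ρ ⁅y - ρ y, z⁆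

/-- The transpose `[y₋, z₋] - [y₊, z₊]` of the cobracket, where `y₊ = ρ y`, `y₋ = y - ρ y`. -/
def dualBracket : L →ₗ[ℂ] L →ₗ[ℂ] L :=
  LinearMap.mk₂ ℂ (fun y z => ⁅y - ρ y, z - ρ z⁆ - ⁅ρ y, ρ z⁆)
    (fun a b c => by simp only [map_add, add_lie, sub_lie, lie_sub]; abel)
    (fun a b c => by
      simp only [map_smul, smul_lie, sub_lie, lie_sub, smul_sub])
    (fun a b c => by simp only [map_add, lie_add, sub_lie, lie_sub]; abel)
    (fun a b c => by
      simp only [map_smul, lie_smul, sub_lie, lie_sub, smul_sub])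

theorem dualBracket_apply (y z : L) :
    dualBracket ρ y z = ⁅y - ρ y, z - ρ z⁆ - ⁅ρ y, ρ z⁆ := rfl

theorem dualBracket_skew (y z : L) : dualBracket ρ z y = -dualBracket ρ y z := by
  rw [dualBracket_apply, dualBracket_apply, ← lie_skew, ← lie_skew (ρ z)]
  abel

theorem dualBracket_apply' (y z : L) :
    dualBracket ρ y z = ⁅y, z⁆ - ⁅ρ y, z⁆ - ⁅y, ρ z⁆ := by
  rw [dualBracket_apply]
  simp only [sub_lie, lie_sub]
  abel

/-- The failure of the Jacobi identity for m is measured by [ρ z, ρ w] + ρ m(z, w), the vector that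
represents the Yang-Baxter tensor. Only linearity of ρ enters: the identity is a signed sum of
Jacobi identities for the seven triples obtained from (y, z, w) by applying ρ to at most two
entries. -/
theorem dualBracket_cyclic (y z w : L) :
    dualBracket ρ (dualBracket ρ y z) w + dualBracket ρ (dualBracket ρ z w) y +
        dualBracket ρ (dualBracket ρ w y) z =
      ⁅y, ⁅ρ z, ρ w⁆ + ρ (dualBracket ρ z w)⁆ + ⁅z, ⁅ρ w, ρ y⁆ + ρ (dualBracket ρ w y)⁆ +
        ⁅w, ⁅ρ y, ρ z⁆ + ρ (dualBracket ρ y z)⁆ := by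
  have J : ∀ a b c : L, ⁅⁅a, b⁆, c⁆ + ⁅⁅b, c⁆, a⁆ + ⁅⁅c, a⁆, b⁆ = 0 := fun a b c => by
    rw [← lie_skew ⁅a, b⁆, ← lie_skew ⁅b, c⁆, ← lie_skew ⁅c, a⁆, ← neg_add, ← neg_add,
      neg_eq_zero, ← lie_jacobi a b c]
    abel
  -- Everything is brought to left-nested brackets, so that the remaining identity holds in the free
  -- abelian group on them.
  have h₁ : ∀ a b c : L, ⁅a, b + c⁆ = -⁅b, a⁆ - ⁅c, a⁆ := fun a b c => by
    rw [lie_skew, lie_add, sub_eq_add_neg, lie_skew]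
  have h₂ : ∀ a b c : L, dualBracket ρ (dualBracket ρ a b) c =
      ⁅⁅a, b⁆, c⁆ - ⁅⁅ρ a, b⁆, c⁆ - ⁅⁅a, ρ b⁆, c⁆ - ⁅ρ (dualBracket ρ a b), c⁆ -
      (⁅⁅a, b⁆, ρ c⁆ - ⁅⁅ρ a, b⁆, ρ c⁆ - ⁅⁅a, ρ b⁆, ρ c⁆) := fun a b c => by
    rw [dualBracket_apply' ρ (dualBracket ρ a b)]
    simp only [dualBracket_apply' ρ a b, sub_lie]
  rw [h₁, h₁, h₁, h₂, h₂, h₂]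
  linear_combination (norm := abel) J y z w - J (ρ y) z w - J y (ρ z) w - J y z (ρ w)
    + J (ρ y) (ρ z) w + J (ρ y) z (ρ w) + J y (ρ z) (ρ w)

variable {κ r ρ}

namespace IsRMatrix

variable (H : IsRMatrix κ r ρ)
include H

theorem ext {a b : L} (h : ∀ x, κ x a = κ x b) : a = b := by
  rw [← sub_eq_zero]
  refine H.separating _ fun y => ?_
  rw [H.symm, map_sub, h, sub_self]

/-- Finiteness in the second factor upgrades the weak description of ρ to an honest finite sum,
which may be put inside brackets. -/
theorem sum_smul (y : L) (F : Finset ι) (hF : ∀ i ∉ F, κ (r i).2 y = 0) :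
    ∑ i ∈ F, κ (r i).2 y • (r i).1 = ρ y := by
  refine H.ext fun x => ?_
  have h := H.hasSum x y
  rw [← h.tsum_eq, tsum_eq_sum (s := F) (fun i hi => by rw [hF i hi, mul_zero]), map_sum]
  refine Finset.sum_congr rfl fun i _ => ?_
  rw [map_smul, smul_eq_mul, H.symm x, mul_comm]

theorem lie_left (a b c : L) : κ ⁅a, b⁆ c = κ b ⁅c, a⁆ := by
  rw [← lie_skew, map_neg, LinearMap.neg_apply, H.invariant, ← lie_skew, map_neg, neg_neg]

/-- Invariance moves aⱼ onto x; summing over i produces ρ y, and the finite sum over j reassembles ρ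
z. -/
theorem hasSum₁₂₁₃ (x y z : L) :
    HasSum (fun p => term₁₂₁₃ κ r p x y z) (κ x ⁅ρ y, ρ z⁆) := by
  have h : κ x ⁅ρ y, ρ z⁆ =
      ∑ j ∈ (H.finite z).toFinset, κ ⁅(r j).1, x⁆ (ρ y) * κ (r j).2 z := by
    have h1 := H.sum_smul z (H.finite z).toFinset (fun i hi => by simpa using hi)
    rw [← H.lie_left, H.symm, ← H.invariant, H.symm, ← H.lie_left, ← h1, sum_lie, map_sum,
      LinearMap.sum_apply]
    refine Finset.sum_congr rfl fun j _ => ?_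
    rw [smul_lie, map_smul, LinearMap.smul_apply, smul_eq_mul, mul_comm]
  rw [h]
  refine hasSum_prod_of_finset _ _ _ (fun i j hj => ?_) fun j _ => ?_
  · have : κ (r j).2 z = 0 := by simpa using hj
    simp [term₁₂₁₃, tensor₃, this]
  · refine ((H.hasSum ⁅(r j).1, x⁆ y).mul_right (κ (r j).2 z)).congr_fun ?_
    intro i
    simp only [term₁₂₁₃, tensor₃, H.invariant]

theorem hasSum₁₂₂₃ (x y z : L) :
    HasSum (fun p => term₁₂₂₃ κ r p x y z) (κ x (ρ ⁅ρ z, y⁆)) := by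
  have h : κ x (ρ ⁅ρ z, y⁆) =
      ∑ j ∈ (H.finite z).toFinset, κ x (ρ ⁅(r j).1, y⁆) * κ (r j).2 z := by
    rw [← H.sum_smul z (H.finite z).toFinset (fun i hi => by simpa using hi), sum_lie, map_sum,
      map_sum]
    refine Finset.sum_congr rfl fun j _ => ?_
    rw [smul_lie, map_smul, map_smul, smul_eq_mul, mul_comm]
  rw [h]
  refine hasSum_prod_of_finset _ _ _ (fun i j hj => ?_) fun j _ => ?_
  · have : κ (r j).2 z = 0 := by simpa using hj
    simp [term₁₂₂₃, tensor₃, this]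
  · refine ((H.hasSum x ⁅(r j).1, y⁆).mul_right (κ (r j).2 z)).congr_fun ?_
    intro i
    simp only [term₁₂₂₃, tensor₃, H.invariant]

/-- The finite sums in the second factor are of no help here, because the outer sum runs over the
pairings κ(aⱼ, y); the finite set comes from `exists_finset` instead. -/
theorem hasSum₁₃₂₃ (x y z : L) :
    HasSum (fun p => term₁₃₂₃ κ r p x y z) (κ x (ρ ⁅y - ρ y, z⁆)) := by
  obtain ⟨F, hF, hF'⟩ := H.exists_finset y z
  have h : κ x (ρ ⁅y - ρ y, z⁆) = ∑ j ∈ F, κ (r j).1 y * κ x (ρ ⁅(r j).2, z⁆) := by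
    rw [← hF', sum_lie, map_sum, map_sum]
    refine Finset.sum_congr rfl fun j _ => ?_
    rw [smul_lie, map_smul, map_smul, smul_eq_mul]
  rw [h]
  refine hasSum_prod_of_finset _ _ _ (fun i j hj => ?_) fun j _ => ?_
  · have := hF i j hj
    simp only [term₁₃₂₃, tensor₃, H.invariant]
    rw [mul_assoc, this, mul_zero]
  · refine ((H.hasSum x ⁅(r j).2, z⁆).mul_left (κ (r j).1 y)).congr_fun ?_
    intro i
    simp only [term₁₃₂₃, tensor₃, H.invariant]
    ring

/-- The right side is [x ⊗ 1 + 1 ⊗ x, r] evaluated on y ⊗ z after moving x by invariance; unitarity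
takes ρ off ⁅z, x⁆ in the second term. -/
theorem dualBracket_eq_add (x y z : L) :
    κ x (dualBracket ρ y z) = κ ⁅y, x⁆ (ρ z) + κ y (ρ ⁅z, x⁆) := by
  have h2 : κ y (ρ ⁅z, x⁆) = κ x ⁅y - ρ y, z⁆ := by
    have := H.unitary ⁅z, x⁆ y
    rw [← H.lie_left, map_sub, H.symm]
    linear_combination this
  have h1 : κ ⁅y, x⁆ (ρ z) = -κ x ⁅y, ρ z⁆ := by
    rw [H.lie_left, ← lie_skew, map_neg]
  rw [h1, h2, dualBracket_apply, ← map_neg, ← map_add]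
  congr 1
  simp only [sub_lie, lie_sub]
  abel

theorem hasSum_cobracket (x y z : L) :
    HasSum (fun i => termCobracket κ r x i y z) (κ x (dualBracket ρ y z)) := by
  rw [H.dualBracket_eq_add]
  refine ((H.hasSum ⁅y, x⁆ z).add (H.hasSum y ⁅z, x⁆)).congr_fun fun i => ?_
  change κ ⁅x, (r i).1⁆ y * κ (r i).2 z + κ (r i).1 y * κ ⁅x, (r i).2⁆ z = _
  rw [H.lie_left, H.lie_left]

theorem converges : Converges κ r where
  tensor := Pi.summable.2 fun x => Pi.summable.2 fun y => (H.hasSum x y).summable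
  summable₁₂₁₃ := Pi.summable.2 fun x => Pi.summable.2 fun y => Pi.summable.2 fun z =>
    (H.hasSum₁₂₁₃ x y z).summable
  summable₁₂₂₃ := Pi.summable.2 fun x => Pi.summable.2 fun y => Pi.summable.2 fun z =>
    (H.hasSum₁₂₂₃ x y z).summable
  summable₁₃₂₃ := Pi.summable.2 fun x => Pi.summable.2 fun y => Pi.summable.2 fun z =>
    (H.hasSum₁₃₂₃ x y z).summable
  cobracket := fun x => Pi.summable.2 fun y => Pi.summable.2 fun z =>
    (H.hasSum_cobracket x y z).summable

theorem cobracket_eq (x y z : L) : cobracket κ r x y z = κ x (dualBracket ρ y z) := by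
  have : HasSum (termCobracket κ r x) fun y z => κ x (dualBracket ρ y z) :=
    Pi.hasSum.2 fun y => Pi.hasSum.2 fun z => H.hasSum_cobracket x y z
  rw [cobracket, this.tsum_eq]

theorem yangBaxter_eq_add (x y z : L) :
    yangBaxter κ r x y z = κ x (⁅ρ y, ρ z⁆ + ρ (dualBracket ρ y z)) := by
  have h1 : HasSum (term₁₂₁₃ κ r) _ := Pi.hasSum.2 fun x => Pi.hasSum.2 fun y =>
    Pi.hasSum.2 fun z => H.hasSum₁₂₁₃ x y z
  have h2 : HasSum (term₁₂₂₃ κ r) _ := Pi.hasSum.2 fun x => Pi.hasSum.2 fun y =>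
    Pi.hasSum.2 fun z => H.hasSum₁₂₂₃ x y z
  have h3 : HasSum (term₁₃₂₃ κ r) _ := Pi.hasSum.2 fun x => Pi.hasSum.2 fun y =>
    Pi.hasSum.2 fun z => H.hasSum₁₃₂₃ x y z
  rw [yangBaxter, h1.tsum_eq, h2.tsum_eq, h3.tsum_eq]
  change κ x ⁅ρ y, ρ z⁆ + κ x (ρ ⁅ρ z, y⁆) + κ x (ρ ⁅y - ρ y, z⁆) = _
  rw [← map_add, ← map_add, add_assoc, ← map_add]
  congr 3
  rw [dualBracket_apply, ← lie_skew]
  simp only [sub_lie, lie_sub]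
  abel

/-- Unitarity moves ρ from m(y, z) to x. In this form total skewness is visible, since κ(x, [y, z])
is alternating. -/
theorem yangBaxter_eq (x y z : L) :
    yangBaxter κ r x y z = κ (ρ x) ⁅ρ y, ρ z⁆ + κ (x - ρ x) ⁅y - ρ y, z - ρ z⁆ := by
  have h := H.unitary x (dualBracket ρ y z)
  rw [H.yangBaxter_eq_add, map_add]
  rw [dualBracket_apply] at h ⊢
  simp only [map_sub, LinearMap.sub_apply] at h ⊢
  linear_combination h

theorem lie_skew₁₂ (x y z : L) : κ y ⁅x, z⁆ = - κ x ⁅y, z⁆ := by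
  rw [← H.invariant, ← H.invariant, ← lie_skew, map_neg, LinearMap.neg_apply]

theorem yangBaxter_skew₁₂ (x y z : L) : yangBaxter κ r y x z = -yangBaxter κ r x y z := by
  rw [H.yangBaxter_eq, H.yangBaxter_eq, H.lie_skew₁₂ (ρ x), H.lie_skew₁₂ (x - ρ x)]
  ring

theorem yangBaxter_skew₂₃ (x y z : L) : yangBaxter κ r x z y = -yangBaxter κ r x y z := by
  rw [H.yangBaxter_eq, H.yangBaxter_eq, ← lie_skew, ← lie_skew (z - ρ z), map_neg, map_neg]
  ring

/-- By invariance this is κ(a, ·) applied to a Jacobi identity. It is the only input for the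
vanishing of Alt (δ ⊗ id ⊗ id) φ besides unitarity. -/
theorem jacobi_four (a b c d : L) :
    κ ⁅a, b⁆ ⁅c, d⁆ - κ ⁅a, c⁆ ⁅b, d⁆ + κ ⁅a, d⁆ ⁅b, c⁆ = 0 := by
  rw [H.invariant, H.invariant, H.invariant, ← map_sub, ← map_add]
  convert map_zero (κ a)
  rw [← lie_lie, ← lie_skew d]
  abel

theorem isQuasiLieBialgebra : IsQuasiLieBialgebra κ (cobracket κ r) (-yangBaxter κ r) where
  invariant := H.invariant
  nondegenerate := ⟨H.separating, fun y hy => H.separating y fun x => by rw [H.symm, hy]⟩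
  linear := ⟨LinearMap.mk₂ ℂ (fun x y => κ x ∘ₗ dualBracket ρ y)
    (fun _ _ _ => by ext; simp) (fun _ _ _ => by ext; simp)
    (fun _ _ _ => by ext; simp) (fun _ _ _ => by ext; simp), fun x y z => by
      rw [H.cobracket_eq]; rfl⟩
  trilinear := ⟨LinearMap.mk₂ ℂ (fun x y => -(κ x ∘ₗ ((LieAlgebra.ad ℂ L (ρ y) : L →ₗ[ℂ] L) ∘ₗ ρ
      + ρ ∘ₗ dualBracket ρ y)))
    (fun _ _ _ => by ext; simp; ring) (fun _ _ _ => by ext; simp; try ring)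
    (fun _ _ _ => by ext; simp; ring) (fun _ _ _ => by ext; simp; try ring), fun x y z => by
      change _ = - yangBaxter κ r x y z
      rw [H.yangBaxter_eq_add]; rfl⟩
  skew := fun x y z => by rw [H.cobracket_eq, H.cobracket_eq, dualBracket_skew, map_neg]
  skew₁₂ := fun x y z => congrArg Neg.neg (H.yangBaxter_skew₁₂ x y z)
  skew₂₃ := fun x y z => congrArg Neg.neg (H.yangBaxter_skew₂₃ x y z)
  cocycle := fun x y => by
    funext z w
    change _ = (- cobracket κ r y ⁅x, z⁆ w - cobracket κ r y z ⁅x, w⁆) -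
      (- cobracket κ r x ⁅y, z⁆ w - cobracket κ r x z ⁅y, w⁆)
    -- The cobracket is the action of x on a fixed tensor, so the cocycle condition is the Jacobi
    -- identity in each of the two slots.
    have e1 : ⁅⁅x, z⁆, y⁆ - ⁅⁅y, z⁆, x⁆ = - ⁅z, ⁅x, y⁆⁆ := by
      rw [← lie_skew ⁅x, z⁆, ← lie_skew ⁅y, z⁆, ← lie_skew z, lie_lie]; abel
    have e2 : ⁅⁅x, w⁆, y⁆ - ⁅⁅y, w⁆, x⁆ = - ⁅w, ⁅x, y⁆⁆ := by
      rw [← lie_skew ⁅x, w⁆, ← lie_skew ⁅y, w⁆, ← lie_skew w, lie_lie]; abel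
    have f1 := congrArg (fun a => κ a (ρ w)) e1
    have f2 := congrArg (fun a => κ z (ρ a)) e2
    simp only [map_sub, map_neg, LinearMap.sub_apply, LinearMap.neg_apply] at f1 f2
    have g1 : κ ⁅x, z⁆ (ρ ⁅w, y⁆) = - κ ⁅z, x⁆ (ρ ⁅w, y⁆) := by
      rw [← lie_skew, map_neg, LinearMap.neg_apply]
    have g2 : κ ⁅y, z⁆ (ρ ⁅w, x⁆) = - κ ⁅z, y⁆ (ρ ⁅w, x⁆) := by
      rw [← lie_skew, map_neg, LinearMap.neg_apply]
    have g3 : κ ⁅z, x⁆ (ρ ⁅y, w⁆) = -κ ⁅z, x⁆ (ρ ⁅w, y⁆) := by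
      rw [← lie_skew y, map_neg, map_neg]
    have g4 : κ ⁅z, y⁆ (ρ ⁅x, w⁆) = -κ ⁅z, y⁆ (ρ ⁅w, x⁆) := by
      rw [← lie_skew x, map_neg, map_neg]
    simp only [H.cobracket_eq, H.dualBracket_eq_add]
    linear_combination f1 + f2 + g1 - g2 - g3 + g4
  quasiCoJacobi := by
    refine ⟨dualBracket ρ, fun x y z => (H.cobracket_eq x y z).symm, fun x v => ?_, fun v => ?_⟩
    -- Skewness of m turns half the signed sum into a cyclic sum. On the other side skewness of φ
    -- brings each ⁅x, ·⁆ into the first slot, where invariance strips off x and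
    -- `dualBracket_cyclic` applies.
    · rw [alt₃_eq]
      change _ = - - yangBaxter κ r ⁅x, v 0⁆ (v 1) (v 2) - - yangBaxter κ r (v 0) ⁅x, v 1⁆ (v 2)
        - - yangBaxter κ r (v 0) (v 1) ⁅x, v 2⁆
      rw [H.yangBaxter_skew₁₂ ⁅x, v 1⁆, H.yangBaxter_skew₂₃ _ ⁅x, v 2⁆,
        H.yangBaxter_skew₁₂ ⁅x, v 2⁆]
      simp only [H.cobracket_eq, H.yangBaxter_eq_add, H.invariant]
      rw [dualBracket_skew ρ (v 0) (v 2), dualBracket_skew ρ (v 0) (v 1),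
        dualBracket_skew ρ (v 1) (v 2), dualBracket_skew ρ (v 2) (v 0)]
      have h := congrArg (κ x) (dualBracket_cyclic ρ (v 0) (v 1) (v 2))
      rw [← lie_skew (ρ (v 0)) (ρ (v 2))]
      simp only [map_neg, map_add, LinearMap.neg_apply, lie_add, lie_neg] at h ⊢
      linear_combination h
    · have hT : ∀ a b c d, (-yangBaxter κ r) (dualBracket ρ a b) c d =
          -(κ (dualBracket ρ a b) ⁅ρ c, ρ d⁆ +
            κ (dualBracket ρ a b) (ρ (dualBracket ρ c d))) := fun a b c d => by
        rw [← map_add, ← H.yangBaxter_eq_add]; rfl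
      rw [alt₄_eq]
      · simp only [hT]
        -- With P = [a₋, b₋], Q = [a₊, b₊] and P', Q' likewise for c, d, unitarity replaces the two
        -- ρ-terms by κ(P − Q, P' − Q'); the mixed terms then cancel and κ(P, P') − κ(Q, Q')
        -- remains. Each of these two is killed by alternation.
        have hu : ∀ a b c d, κ (dualBracket ρ a b) ⁅ρ c, ρ d⁆ +
            κ (dualBracket ρ a b) (ρ (dualBracket ρ c d)) +
            (κ (dualBracket ρ c d) ⁅ρ a, ρ b⁆ +
            κ (dualBracket ρ c d) (ρ (dualBracket ρ a b))) =
            κ ⁅a - ρ a, b - ρ b⁆ ⁅c - ρ c, d - ρ d⁆ - κ ⁅ρ a, ρ b⁆ ⁅ρ c, ρ d⁆ := by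
          intro a b c d
          have h := H.unitary (dualBracket ρ a b) (dualBracket ρ c d)
          rw [H.symm (ρ _)] at h
          have h1 := H.symm (dualBracket ρ c d) ⁅ρ a, ρ b⁆
          have h2 := H.symm ⁅c - ρ c, d - ρ d⁆ ⁅ρ a, ρ b⁆
          rw [h1]
          rw [dualBracket_apply ρ c d] at h ⊢
          rw [dualBracket_apply ρ a b] at h ⊢
          simp only [map_sub, LinearMap.sub_apply] at h ⊢
          linear_combination h
        have h1 := hu (v 0) (v 1) (v 2) (v 3)
        have h2 := hu (v 0) (v 2) (v 1) (v 3)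
        have h3 := hu (v 0) (v 3) (v 1) (v 2)
        have j1 := H.jacobi_four (v 0 - ρ (v 0)) (v 1 - ρ (v 1)) (v 2 - ρ (v 2)) (v 3 - ρ (v 3))
        have j2 := H.jacobi_four (ρ (v 0)) (ρ (v 1)) (ρ (v 2)) (ρ (v 3))
        linear_combination -4 * (h1 - h2 + h3) - 4 * j1 + 4 * j2
      · intro a b c d
        rw [hT, hT, dualBracket_skew ρ a b, map_neg, LinearMap.neg_apply, LinearMap.neg_apply]
        ring
      · intro a b c d
        simp only [hT, dualBracket_skew ρ c d, ← lie_skew (ρ d) (ρ c), map_neg]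
        ring

end IsRMatrix

/-- If all matrix elements of `r` are finite sums in the first factor as well, then the summation
condition on `[r₁₃, r₂₃]` is automatic. -/
theorem IsRMatrix.of_finite (symm : ∀ x y, κ x y = κ y x)
    (invariant : ∀ x y z, κ ⁅x, y⁆ z = κ x ⁅y, z⁆)
    (separating : ∀ x, (∀ y, κ x y = 0) → x = 0)
    (finite : ∀ y, (Function.support fun i => κ (r i).2 y).Finite)
    (hasSum : ∀ x y, HasSum (fun i => κ (r i).1 x * κ (r i).2 y) (κ x (ρ y)))
    (unitary : ∀ x y, κ x (ρ y) + κ (ρ x) y = κ x y)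
    (finite' : ∀ y, (Function.support fun i => κ (r i).1 y).Finite) : IsRMatrix κ r ρ := by
  refine ⟨symm, invariant, separating, finite, hasSum, unitary, fun y z =>
    ⟨(finite' y).toFinset, fun i j hj => ?_, ?_⟩⟩
  · have : κ (r j).1 y = 0 := by simpa using hj
    rw [this, zero_mul]
  -- Here the finite sum is y − ρ y itself, because 1 − ρ is the adjoint of ρ.
  · congr 2
    rw [← sub_eq_zero]
    refine separating _ fun w => ?_
    have h := (hasSum y w).tsum_eq
    rw [tsum_eq_sum (s := (finite' y).toFinset) (fun j hj => by
      have : κ (r j).1 y = 0 := by simpa using hj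
      rw [this, zero_mul])] at h
    simp only [map_sub, map_sum, map_smul, LinearMap.sub_apply, LinearMap.sum_apply,
      LinearMap.smul_apply, smul_eq_mul]
    linear_combination h + unitary y w

/-- If `ρ` is a projection and the second factors of `r` lie in its kernel, then the summation
condition on `[r₁₃, r₂₃]` only concerns the brackets of these second factors. -/
theorem IsRMatrix.of_projection (symm : ∀ x y, κ x y = κ y x)
    (invariant : ∀ x y z, κ ⁅x, y⁆ z = κ x ⁅y, z⁆)
    (separating : ∀ x, (∀ y, κ x y = 0) → x = 0)
    (finite : ∀ y, (Function.support fun i => κ (r i).2 y).Finite)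
    (hasSum : ∀ x y, HasSum (fun i => κ (r i).1 x * κ (r i).2 y) (κ x (ρ y)))
    (unitary : ∀ x y, κ x (ρ y) + κ (ρ x) y = κ x y)
    (projection : ∀ x, ρ (ρ x) = ρ x) (ker : ∀ i, ρ (r i).2 = 0)
    (finite' : ∀ z, {i | ρ ⁅(r i).2, z⁆ ≠ 0}.Finite) : IsRMatrix κ r ρ := by
  -- Unitarity makes the kernel of ρ isotropic. This annihilates the pairing of a second factor with
  -- any bracket that ρ kills.
  have isotropic : ∀ x y, ρ x = 0 → ρ y = 0 → κ x y = 0 := fun x y hx hy => by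
    rw [← unitary, hx, hy, map_zero, map_zero, LinearMap.zero_apply, add_zero]
  refine ⟨symm, invariant, separating, finite, hasSum, unitary, fun y z =>
    ⟨(finite' z).toFinset, fun i j hj => ?_, ?_⟩⟩
  · have : ρ ⁅(r j).2, z⁆ = 0 := by simpa using hj
    rw [isotropic _ _ (ker i) this, mul_zero]
  · rw [← sub_eq_zero]
    refine separating _ fun x => ?_
    have hx : ρ (x - ρ x) = 0 := by rw [map_sub, projection, sub_self]
    -- As 1 − ρ is the adjoint of ρ, only the kernel component x − ρ x of the test vector matters,
    -- and against it the terms outside the finite set vanish by isotropy.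
    have key : ∀ w, κ (ρ ⁅w, z⁆) x = κ w ⁅z, x - ρ x⁆ := fun w => by
      rw [← invariant, map_sub, ← unitary ⁅w, z⁆ x]
      ring
    have h := (hasSum y ⁅z, x - ρ x⁆).tsum_eq
    rw [tsum_eq_sum (s := (finite' z).toFinset) (fun j hj => by
      have : ρ ⁅(r j).2, z⁆ = 0 := by simpa using hj
      rw [← invariant, isotropic _ _ this hx, mul_zero])] at h
    rw [map_sub, LinearMap.sub_apply, key, key]
    simp only [map_sub, map_sum, map_smul, LinearMap.sub_apply, LinearMap.sum_apply,
      LinearMap.smul_apply, smul_eq_mul] at h ⊢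
    have hu := unitary y ⁅z, x⁆
    have hv := unitary y ⁅z, ρ x⁆
    simp only [lie_sub, map_sub] at h ⊢
    linear_combination h + hu - hv

end RMatrix

end EllipticCurrent

namespace EllipticCurrent

/-! ## Componentwise operators on the current algebra -/

namespace CurrentAlgebra

open TestAlgebra

section

variable {K : Type} [CommRing K] (x y : CurrentAlgebra K)

@[simp] theorem sub_e : (x - y).e = x.e - y.e := by
  simp [sub_eq_add_neg]
@[simp] theorem sub_f : (x - y).f = x.f - y.f := by
  simp [sub_eq_add_neg]
@[simp] theorem sub_h : (x - y).h = x.h - y.h := by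
  simp [sub_eq_add_neg]
@[simp] theorem sub_d : (x - y).d = x.d - y.d := by
  simp [sub_eq_add_neg]

end

section

variable {K : Type} [CommRing K] [Algebra ℂ K] [TestAlgebra K]

theorem form_apply (x y : CurrentAlgebra K) :
    form K x y = int (x.e * y.f + x.f * y.e + 2 * (x.h * y.h)) + x.c * y.d + x.d * y.c := rfl

theorem int_two_mul (s : K) : int (2 * s) = 2 * int s := by
  rw [show 2 * s = (2 : ℂ) • s by rw [Algebra.smul_def, map_ofNat], map_smul, smul_eq_mul]

theorem form_apply' (x y : CurrentAlgebra K) :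
    form K x y = int (x.e * y.f) + int (x.f * y.e) + 2 * int (x.h * y.h) + x.c * y.d
      + x.d * y.c := by
  rw [form_apply, map_add, map_add, int_two_mul]

theorem form_symm (x y : CurrentAlgebra K) : form K x y = form K y x := by
  rw [form_apply', form_apply', mul_comm x.e, mul_comm x.f, mul_comm x.h]
  ring

theorem form_eHat (s : K)
    (x : CurrentAlgebra K) : form K (eHat s) x = int (s * x.f) := by simp [form_apply', eHat]

theorem form_fHat (s : K)
    (x : CurrentAlgebra K) : form K (fHat s) x = int (s * x.e) := by simp [form_apply', fHat]

theorem form_hHat (s : K)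
    (x : CurrentAlgebra K) : form K (hHat s) x = 2 * int (s * x.h) := by simp [form_apply', hHat]

theorem form_cEl (x : CurrentAlgebra K) : form K cEl x = x.d := by simp [form_apply', cEl]

theorem form_dEl (x : CurrentAlgebra K) : form K dEl x = x.c := by simp [form_apply', dEl]

/-- The invariant cocycle `⟨x', y⟩`. -/
def derForm (x y : CurrentAlgebra K) : ℂ :=
  int (der x.e * y.f) + int (der x.f * y.e) + 2 * int (der x.h * y.h)

theorem int_der_mul (s t : K) : int (der s * t) = -int (s * der t) := by
  have h := int_der (s * t)
  rw [Derivation.leibniz, map_add, smul_eq_mul, smul_eq_mul, mul_comm t] at h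
  linear_combination h

theorem derForm_skew (x y : CurrentAlgebra K) : derForm y x = -derForm x y := by
  rw [derForm, derForm, int_der_mul y.e, int_der_mul y.f, int_der_mul y.h,
    mul_comm y.e, mul_comm y.f, mul_comm y.h]
  ring

/-- The expansion is visibly alternating: a determinant in the e, f, h components, plus the d
components times the cocycle. Invariance of the form is read off from it, and the Yang-Baxter tensor
is later computed from it. -/
theorem form_lie (x y z : CurrentAlgebra K) :
    form K x ⁅y, z⁆ = 2 * (int (x.h * y.e * z.f) - int (x.h * z.e * y.f)
      - (int (y.h * x.e * z.f) - int (y.h * z.e * x.f))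
      + (int (z.h * x.e * y.f) - int (z.h * y.e * x.f)))
      + x.d * derForm y z - y.d * derForm x z + z.d * derForm x y := by
  have e1 : x.e * ⁅y, z⁆.f = (2 : ℂ) • (z.h * x.e * y.f) - (2 : ℂ) • (y.h * x.e * z.f)
      + y.d • (der z.f * x.e) - z.d • (der y.f * x.e) := by
    rw [bracket_f]
    simp only [Algebra.smul_def, map_ofNat]
    ring
  have e2 : x.f * ⁅y, z⁆.e = (2 : ℂ) • (y.h * z.e * x.f) - (2 : ℂ) • (z.h * y.e * x.f)
      + y.d • (der z.e * x.f) - z.d • (der y.e * x.f) := by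
    rw [bracket_e]
    simp only [Algebra.smul_def, map_ofNat]
    ring
  have e3 : x.h * ⁅y, z⁆.h = x.h * y.e * z.f - x.h * z.e * y.f
      + y.d • (der z.h * x.h) - z.d • (der y.h * x.h) := by
    rw [bracket_h]
    simp only [Algebra.smul_def]
    ring
  rw [derForm_skew z x, derForm_skew y x, form_apply', e1, e2, e3, bracket_c, bracket_d]
  simp only [map_add, map_sub, map_smul, smul_eq_mul, int_two_mul, derForm]
  ring

theorem form_lie_skew (x y z : CurrentAlgebra K) : form K y ⁅x, z⁆ = -form K x ⁅y, z⁆ := by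
  rw [form_lie, form_lie, derForm_skew x y]
  ring

theorem form_invariant (x y z : CurrentAlgebra K) : form K ⁅x, y⁆ z = form K x ⁅y, z⁆ := by
  rw [form_symm, form_lie_skew, ← lie_skew, map_neg, neg_neg]

theorem form_separating (hK : ∀ s : K, (∀ t, int (s * t) = 0) → s = 0) (x : CurrentAlgebra K)
    (hx : ∀ y, form K x y = 0) : x = 0 := by
  ext
  · exact hK _ fun t => by simpa [form_apply', fHat] using hx (fHat t)
  · exact hK _ fun t => by simpa [form_apply', eHat] using hx (eHat t)
  · exact hK _ fun t => by simpa [form_apply', hHat] using hx (hHat t)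
  · simpa [form_apply', dEl] using hx dEl
  · simpa [form_apply', cEl] using hx cEl

end

section

variable {K : Type} [CommRing K] [Algebra ℂ K]

/-- The operator acting on the `e`, `f`, `h`, `c` and `d` components by `A`, `B`, `H`, `1`
and `0`. -/
def compOp (A B H : K →ₗ[ℂ] K) : CurrentAlgebra K →ₗ[ℂ] CurrentAlgebra K where
  toFun x := ⟨A x.e, B x.f, H x.h, x.c, 0⟩
  map_add' x y := by ext <;> simp
  map_smul' a x := by ext <;> simp

variable (A B H : K →ₗ[ℂ] K) (x : CurrentAlgebra K)

@[simp] theorem compOp_e : (compOp A B H x).e = A x.e := rfl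
@[simp] theorem compOp_f : (compOp A B H x).f = B x.f := rfl
@[simp] theorem compOp_h : (compOp A B H x).h = H x.h := rfl
@[simp] theorem compOp_c : (compOp A B H x).c = x.c := rfl
@[simp] theorem compOp_d : (compOp A B H x).d = 0 := rfl

end

variable {K : Type} [CommRing K] [Algebra ℂ K] [TestAlgebra K] {A B H : K →ₗ[ℂ] K}

/-- The scalar product pairs e with f, so A and B have to be adjoint up to 1 − ·; it pairs c with d,
whose eigenvalues 1 and 0 add up to 1. -/
theorem compOp_unitary (hAB : ∀ a b, int (a * B b) + int (A a * b) = int (a * b))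
    (hH : ∀ a b, int (a * H b) + int (H a * b) = int (a * b)) (x y : CurrentAlgebra K) :
    form K x (compOp A B H y) + form K (compOp A B H x) y = form K x y := by
  simp only [form_apply', compOp_e, compOp_f, compOp_h, compOp_c, compOp_d]
  have h1 := hAB y.e x.f
  rw [mul_comm y.e x.f, mul_comm (A y.e), mul_comm y.e] at h1
  linear_combination hAB x.e y.f + h1 + 2 * hH x.h y.h

/-- Since ρ x has no d component, the three-form of the plus parts has no cocycle terms, while that
of the minus parts retains them with the full coefficient x.d. The six terms in e, f, h pair up by
the hypothesis on Q, and 2⟨w⟩ is the pairing of the h component with `hHat 1`. -/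
theorem yangBaxter_compOp {ι : Type} {r : ι → CurrentAlgebra K × CurrentAlgebra K}
    (hr : IsRMatrix (form K) r (compOp A B H)) (Q : K → K → ℂ)
    (hQ : ∀ w a b, int (H w * A a * B b) + int ((w - H w) * (a - A a) * (b - B b)) =
      int w * Q a b) :
    yangBaxter (form K) r = insertCyc (form K) (hHat 1)
        (fun x y => Q x.e y.f - Q y.e x.f) +
      insertCyc (form K) cEl
        (fun x y => derForm (x - compOp A B H x) (y - compOp A B H y)) := by
  funext x y z
  rw [hr.yangBaxter_eq, form_lie, form_lie]
  simp only [compOp_e, compOp_f, compOp_h, compOp_d, sub_e, sub_f, sub_h, sub_d, sub_zero,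
    zero_mul, add_zero, Pi.add_apply, insertCyc]
  simp only [form_hHat, form_cEl, one_mul]
  linear_combination 2 * (hQ x.h y.e z.f - hQ x.h z.e y.f - (hQ y.h x.e z.f - hQ y.h z.e x.f)
    + (hQ z.h x.e y.f - hQ z.h y.e x.f))

end CurrentAlgebra

end EllipticCurrent

namespace EllipticCurrent

/-! ## Trigonometric polynomials -/

open TestAlgebra

theorem jDown_apply (n : ℤ) (u : ℂ) :
    (jDown n : ℂ → ℂ) u = Complex.exp (2 * Real.pi * Complex.I * n * u) := rfl

theorem jDown_mul (m n : ℤ) : jDown m * jDown n = jDown (m + n) := by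
  refine Subtype.ext <| funext fun u => ?_
  change (jDown m : ℂ → ℂ) u * (jDown n : ℂ → ℂ) u = _
  rw [jDown_apply, jDown_apply, jDown_apply, ← Complex.exp_add]
  push_cast
  ring_nf

theorem jDown_zero : jDown 0 = 1 := by
  refine Subtype.ext <| funext fun u => ?_
  rw [jDown_apply]
  simp

theorem der_jDown (n : ℤ) : der (jDown n) = (2 * Real.pi * Complex.I * n) • jDown n := by
  refine Subtype.ext <| funext fun u => ?_
  change deriv (jDown n : ℂ → ℂ) u = (2 * Real.pi * Complex.I * n) * (jDown n : ℂ → ℂ) u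
  have : (jDown n : ℂ → ℂ) = fun u => Complex.exp (2 * Real.pi * Complex.I * n * u) := rfl
  rw [this]
  have h : HasDerivAt (fun u => Complex.exp (2 * Real.pi * Complex.I * n * u))
      (Complex.exp (2 * Real.pi * Complex.I * n * u) * (2 * Real.pi * Complex.I * n * 1)) u :=
    ((hasDerivAt_id u).const_mul (2 * Real.pi * Complex.I * n)).cexp
  rw [h.deriv, mul_one, mul_comm]

theorem KCyl.int_def (s : KCyl) : int s = (2 * Real.pi * Complex.I)⁻¹ *
    ∫ x in (-(1 / 2) : ℝ)..(1 / 2), (s : ℂ → ℂ) x := rfl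

theorem int_jDown (n : ℤ) :
    int (jDown n) = if n = 0 then (2 * Real.pi * Complex.I)⁻¹ else 0 := by
  split_ifs with h
  · subst h
    rw [KCyl.int_def]
    simp only [jDown_apply]
    norm_num
  · have h1 := int_der (jDown n)
    rw [der_jDown, map_smul, smul_eq_mul] at h1
    refine (mul_eq_zero.1 h1).resolve_left ?_
    exact mul_ne_zero Complex.two_pi_I_ne_zero (by exact_mod_cast h)

/-- The contour of integration can be shifted along the cylinder. -/
theorem KCyl.integral_shift (s : KCyl) (y : ℝ) :
    ∫ x in (-(1 / 2) : ℝ)..(1 / 2), (s : ℂ → ℂ) (x + y * Complex.I) =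
      ∫ x in (-(1 / 2) : ℝ)..(1 / 2), (s : ℂ → ℂ) x := by
  have h := Complex.integral_boundary_rect_eq_zero_of_differentiableOn (s : ℂ → ℂ)
    ⟨-(1 / 2), 0⟩ ⟨1 / 2, y⟩ s.differentiable.differentiableOn
  -- By periodicity the two vertical sides of the rectangle cancel in Cauchy's theorem.
  have h1 : ∀ t : ℝ, (s : ℂ → ℂ) ((1 / 2 : ℝ) + t * Complex.I) =
      (s : ℂ → ℂ) ((-(1 / 2) : ℝ) + t * Complex.I) := fun t => by
    have h2 := s.2.2.1 ((-(1 / 2) : ℝ) + t * Complex.I)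
    rw [← h2, show ((-(1 / 2) : ℝ) : ℂ) + t * Complex.I + 1 = (1 / 2 : ℝ) + t * Complex.I by
      push_cast; ring]
  simp only [h1, add_sub_cancel_right, Complex.ofReal_zero, zero_mul, add_zero] at h
  exact (sub_eq_zero.1 h).symm

/-- An element of `K(Cyl)` with vanishing Fourier coefficients is zero. -/
theorem KCyl.separating (s : KCyl) (h : ∀ n, int (s * jDown n) = 0) : s = 0 := by
  have hper : Function.Periodic (fun x : ℝ => (s : ℂ → ℂ) x) 1 := fun x => by
    simpa using s.2.2.1 x
  have hcont : Continuous (fun x : ℝ => (s : ℂ → ℂ) x) :=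
    s.differentiable.continuous.comp Complex.continuous_ofReal
  let F : C(AddCircle (1 : ℝ), ℂ) := ⟨hper.lift, continuous_coinduced_dom.mpr hcont⟩
  have hFx : ∀ x : ℝ, F (x : AddCircle (1 : ℝ)) = (s : ℂ → ℂ) x := fun x => rfl
  clear_value F
  have hF : ∀ n, fourierCoeff F n = 0 := fun n => by
    rw [fourierCoeff_eq_intervalIntegral _ n (-(1 / 2))]
    have h1 := h (-n)
    rw [KCyl.int_def] at h1
    have h2 := (mul_eq_zero.1 h1).resolve_left (inv_ne_zero Complex.two_pi_I_ne_zero)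
    rw [show -(1 / 2) + (1 : ℝ) = 1 / 2 by norm_num]
    convert smul_zero _
    rw [← h2]
    refine intervalIntegral.integral_congr fun x _ => ?_
    change fourier (-n) (x : AddCircle (1 : ℝ)) * F x = (s : ℂ → ℂ) x * (jDown (-n) : ℂ → ℂ) x
    rw [hFx, fourier_coe_apply, jDown_apply, Complex.ofReal_one, div_one, mul_comm]
  -- Coefficients that all vanish are summable, so the Fourier series converges to F and F = 0.
  have hF' : Summable (fourierCoeff F) := by
    rw [funext hF]
    exact summable_zero
  have hs := hasSum_fourier_series_of_summable hF'
  have hF0 : F = 0 := by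
    refine hs.unique (hasSum_zero.congr_fun fun n => ?_)
    rw [hF]
    exact zero_smul ℂ (fourier n : C(AddCircle (1 : ℝ), ℂ))
  have hreal : ∀ x : ℝ, (s : ℂ → ℂ) x = 0 := fun x => by
    rw [← hFx, hF0]
    rfl
  have han : AnalyticOnNhd ℂ (s : ℂ → ℂ) Set.univ :=
    s.differentiable.differentiableOn.analyticOnNhd isOpen_univ
  -- The function vanishes on the real axis, whose points accumulate at 0; the identity theorem does
  -- the rest.
  have hfreq : ∃ᶠ z in nhdsWithin (0 : ℂ) {0}ᶜ, (s : ℂ → ℂ) z = 0 := by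
    have ht : Filter.Tendsto (fun x : ℝ => (x : ℂ)) (nhdsWithin 0 {0}ᶜ)
        (nhdsWithin (0 : ℂ) {0}ᶜ) := by
      refine tendsto_nhdsWithin_iff.2 ⟨?_, ?_⟩
      · exact (Complex.continuous_ofReal.tendsto 0).mono_left nhdsWithin_le_nhds
      · filter_upwards [self_mem_nhdsWithin] with x hx
        simpa using hx
    exact ht.frequently (Filter.Eventually.of_forall hreal).frequently
  have h0 := han.eqOn_zero_of_preconnected_of_frequently_eq_zero isPreconnected_univ
    (Set.mem_univ 0) hfreq
  exact Subtype.ext <| funext fun u => h0 (Set.mem_univ u)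

/-- The Fourier coefficients of an element of `K(Cyl)` vanish outside of a finite set. -/
theorem KCyl.finite_support (s : KCyl) :
    (Function.support fun n => int (s * jDown n)).Finite := by
  obtain ⟨C, p, hC, hp, hs⟩ := s.2.2.2
  refine (Set.finite_Icc (-⌈p⌉) ⌈p⌉).subset fun n hn => ?_
  by_contra hn'
  refine hn ?_
  have hlt : p < |(n : ℝ)| := by
    rw [Set.mem_Icc, not_and_or, not_le, not_le] at hn'
    have hc : p ≤ (⌈p⌉ : ℝ) := Int.le_ceil p
    rcases hn' with h | h
    · have : (n : ℝ) < -(⌈p⌉ : ℝ) := by exact_mod_cast h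
      exact lt_of_lt_of_le (by linarith) (neg_le_abs _)
    · have : (⌈p⌉ : ℝ) < n := by exact_mod_cast h
      exact lt_of_lt_of_le (by linarith) (le_abs_self _)
  have hq : 0 < 2 * Real.pi * |(n : ℝ)| - p := by
    have := Real.pi_gt_three
    nlinarith [abs_nonneg (n : ℝ)]
  -- The contour is moved to height ±Y, with the sign for which |j_n| = e^{−2π|n|Y}. For |n| > p
  -- this beats the growth e^{pY}, and Y → ∞ kills the coefficient.
  have hbound : ∀ Y : ℝ, 0 ≤ Y → ‖∫ x in (-(1 / 2) : ℝ)..(1 / 2),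
      ((s * jDown n : KCyl) : ℂ → ℂ) x‖ ≤ C * Real.exp (-((2 * Real.pi * |(n : ℝ)| - p) * Y)) := by
    intro Y hY
    obtain ⟨y, hy1, hy2⟩ : ∃ y : ℝ, |y| = Y ∧ (n : ℝ) * y = |(n : ℝ)| * Y := by
      rcases abs_cases (n : ℝ) with ⟨h, _⟩ | ⟨h, _⟩
      · exact ⟨Y, abs_of_nonneg hY, by rw [h]⟩
      · exact ⟨-Y, by rw [abs_neg, abs_of_nonneg hY], by rw [h]; ring⟩
    rw [← KCyl.integral_shift _ y]
    have := intervalIntegral.norm_integral_le_of_norm_le_const (a := -(1 / 2)) (b := 1 / 2)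
      (C := C * Real.exp (-((2 * Real.pi * |(n : ℝ)| - p) * Y)))
      (f := fun x : ℝ => ((s * jDown n : KCyl) : ℂ → ℂ) (x + y * Complex.I)) (fun x _ => ?_)
    · norm_num at this ⊢
      exact this
    · change ‖(s : ℂ → ℂ) (x + y * Complex.I) * (jDown n : ℂ → ℂ) (x + y * Complex.I)‖ ≤ _
      rw [norm_mul, jDown_apply, Complex.norm_exp]
      have h1 := hs (x + y * Complex.I)
      have h2 : ((x : ℂ) + y * Complex.I).im = y := by simp
      have h3 : (2 * Real.pi * Complex.I * n * (x + y * Complex.I) : ℂ).re =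
          -(2 * Real.pi * (n * y)) := by
        simp [Complex.mul_re, Complex.mul_im]
        ring
      rw [h2, hy1] at h1
      rw [h3, hy2]
      refine (mul_le_mul_of_nonneg_right h1 (Real.exp_nonneg _)).trans (le_of_eq ?_)
      rw [mul_assoc, ← Real.exp_add]
      ring_nf
  have hlim : Filter.Tendsto (fun Y : ℝ => C * Real.exp (-((2 * Real.pi * |(n : ℝ)| - p) * Y)))
      Filter.atTop (nhds (C * 0)) :=
    (Real.tendsto_exp_neg_atTop_nhds_zero.comp
      (Filter.tendsto_id.const_mul_atTop hq)).const_mul C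
  rw [mul_zero] at hlim
  have h0 := ge_of_tendsto hlim ((Filter.eventually_ge_atTop 0).mono hbound)
  rw [norm_le_zero_iff] at h0
  change int _ = 0
  rw [KCyl.int_def, h0, mul_zero]

theorem int_jDown_mul (m n : ℤ) :
    int (jDown m * jDown n) = if m + n = 0 then (2 * Real.pi * Complex.I)⁻¹ else 0 := by
  rw [jDown_mul, int_jDown]

/-- All but finitely many Fourier coefficients vanish, and s minus its finite Fourier sum has none
left. The factor 2πi normalises ⟨j_{−n} j_n⟩ = 1/(2πi). -/
theorem KCyl.span_jDown : ⊤ ≤ Submodule.span ℂ (Set.range jDown) := by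
  intro s _
  have h : s = ∑ n ∈ s.finite_support.toFinset,
      (2 * Real.pi * Complex.I * int (s * jDown n)) • jDown (-n) := by
    rw [← sub_eq_zero]
    refine KCyl.separating _ fun m => ?_
    rw [sub_mul, map_sub, Finset.sum_mul, map_sum]
    have : ∀ n ∈ s.finite_support.toFinset,
        int ((2 * Real.pi * Complex.I * int (s * jDown n)) • jDown (-n) * jDown m) =
        if n = m then int (s * jDown m) else 0 := fun n _ => by
      rw [smul_mul_assoc, map_smul, int_jDown_mul, smul_eq_mul]
      by_cases hnm : n = m
      · rw [if_pos (by omega), if_pos hnm, hnm]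
        field_simp [Complex.two_pi_I_ne_zero]
      · rw [if_neg (by omega), if_neg hnm, mul_zero]
    rw [Finset.sum_congr rfl this, Finset.sum_ite_eq', sub_eq_zero]
    split_ifs with h
    · rfl
    · simpa using h
  rw [h]
  exact Submodule.sum_mem _ fun n _ => Submodule.smul_mem _ _ (Submodule.subset_span ⟨-n, rfl⟩)

theorem linearIndependent_jDown : LinearIndependent ℂ jDown := by
  rw [linearIndependent_iff']
  intro F a h n hn
  have h1 := congrArg (fun s => int (s * jDown (-n))) h
  simp only [Finset.sum_mul, map_sum, zero_mul, map_zero, smul_mul_assoc, map_smul,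
    int_jDown_mul, smul_eq_mul, mul_ite, mul_zero] at h1
  rw [Finset.sum_eq_single n (fun m _ hm => if_neg (by omega)) (fun h => absurd hn h),
    if_pos (by omega)] at h1
  exact (mul_eq_zero.1 h1).resolve_right (inv_ne_zero Complex.two_pi_I_ne_zero)

/-- The basis of `K(Cyl)` formed by the exponentials `j_n`. -/
noncomputable def jBasis : Module.Basis ℤ ℂ KCyl :=
  Module.Basis.mk linearIndependent_jDown KCyl.span_jDown

theorem KCyl.induction {p : KCyl → Prop} (s : KCyl) (jDown : ∀ n, p (jDown n))
    (add : ∀ s t, p s → p t → p (s + t)) (smul : ∀ (a : ℂ) s, p s → p (a • s)) : p s := by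
  refine Submodule.span_induction (p := fun s _ => p s) ?_ ?_ (fun s t _ _ => add s t)
    (fun a s _ => smul a s) (KCyl.span_jDown (Submodule.mem_top (x := s)))
  · rintro _ ⟨n, rfl⟩
    exact jDown n
  · simpa using smul 0 _ (jDown 0)

/-- The operator with eigenvectors `j_n` and eigenvalues `G n`. -/
noncomputable def diagOp (G : ℤ → ℂ) : KCyl →ₗ[ℂ] KCyl :=
  jBasis.constr ℂ fun n => G n • jDown n

@[simp] theorem diagOp_jDown (G : ℤ → ℂ) (n : ℤ) : diagOp G (jDown n) = G n • jDown n := by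
  have h : jBasis n = jDown n := Module.Basis.mk_apply _ _ n
  rw [diagOp, ← h, Module.Basis.constr_basis, h]

/-- The functional pairs j_m only with j_{−m}, so passing to the adjoint reverses the index. -/
theorem int_diagOp_mul (F : ℤ → ℂ) (a b : KCyl) :
    int (diagOp F a * b) = int (a * diagOp (fun n => F (-n)) b) := by
  induction a using KCyl.induction with
  | jDown m =>
    induction b using KCyl.induction with
    | jDown n =>
      simp only [diagOp_jDown, mul_smul_comm, smul_mul_assoc, map_smul, smul_eq_mul, int_jDown_mul]
      split_ifs with h
      · rw [eq_neg_of_add_eq_zero_left h]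
      · ring
    | add s t hs ht => simp only [map_add, mul_add, hs, ht]
    | smul c s hs => simp only [map_smul, mul_smul_comm, hs]
  | add s t hs ht => simp only [map_add, add_mul, hs, ht]
  | smul c s hs => simp only [map_smul, smul_mul_assoc, hs]

theorem hasDerivAt_int_diagOp {G : ℂ → ℤ → ℂ} {G' : ℤ → ℂ} {l : ℂ}
    (h : ∀ n, HasDerivAt (fun l => G l n) (G' n) l) (a b : KCyl) :
    HasDerivAt (fun l => int (a * diagOp (G l) b)) (int (a * diagOp G' b)) l := by
  induction b using KCyl.induction with
  | jDown n =>
    simpa only [diagOp_jDown, mul_smul_comm, map_smul, smul_eq_mul] using (h n).mul_const _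
  | add s t hs ht => simpa only [map_add, mul_add] using hs.fun_add ht
  | smul c s hs => simpa only [mul_smul_comm, map_smul, smul_eq_mul] using hs.const_mul c

/-- On b = j_m only the term n = −m survives. Hence the eigenvalue is the coefficient at −m, which
accounts for the −n in `cartanCoeff` and `rootCoeff`. -/
theorem hasSum_diagOp (G : ℤ → ℂ) (a b : KCyl) :
    HasSum (fun n => G n * int (jUp n * a) * int (jDown n * b))
      (int (a * diagOp (fun n => G (-n)) b)) := by
  induction b using KCyl.induction with
  | jDown m =>
    have := hasSum_single (f := fun n => G n * int (jUp n * a) * int (jDown n * jDown m)) (-m)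
      (fun n hn => by rw [int_jDown_mul, if_neg (by omega), mul_zero])
    convert this using 1
    rw [int_jDown_mul, if_pos (by omega), diagOp_jDown, mul_smul_comm, map_smul, jUp,
      smul_mul_assoc, map_smul, neg_neg, smul_eq_mul, smul_eq_mul, mul_comm a]
    field_simp [Complex.two_pi_I_ne_zero]
  | add s t hs ht => simpa only [map_add, mul_add] using hs.add ht
  | smul c s hs =>
    simp only [mul_smul_comm, map_smul, smul_eq_mul]
    refine (hs.mul_left c).congr_fun fun n => ?_
    ring

end EllipticCurrent

namespace EllipticCurrent

/-! ## The trigonometric r-matrix -/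

open TestAlgebra

theorem exp_ne_one_of_forall_ne {z : ℂ} (hz : ∀ k : ℤ, z ≠ k) :
    Complex.exp (2 * Real.pi * Complex.I * z) ≠ 1 := by
  rw [Ne, Complex.exp_eq_one_iff]
  rintro ⟨k, hk⟩
  refine hz k (mul_left_cancel₀ Complex.two_pi_I_ne_zero ?_)
  rw [hk, mul_comm]

theorem greenCoeff_neg {z : ℂ} (hz : ∀ k : ℤ, z ≠ k) :
    greenCoeff (-z) = 1 - greenCoeff z := by
  have h := exp_ne_one_of_forall_ne hz
  have h0 := Complex.exp_ne_zero (2 * Real.pi * Complex.I * z)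
  rw [greenCoeff, greenCoeff, mul_neg, Complex.exp_neg]
  have h1 : 1 - Complex.exp (2 * Real.pi * Complex.I * z) ≠ 0 := sub_ne_zero.2 h.symm
  have h2 : 1 - (Complex.exp (2 * Real.pi * Complex.I * z))⁻¹ ≠ 0 :=
    sub_ne_zero.2 fun h' => h (inv_eq_one.1 h'.symm)
  have h3 : Complex.exp (2 * Real.pi * Complex.I * z) - 1 ≠ 0 := sub_ne_zero.2 h
  field_simp
  ring

/-- The derivative is again a polynomial in the function, and 1 − G is the eigenvalue of 1 − ρ. This
is what lets derivatives of r in λ and τ be expressed by ρ. -/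
theorem hasDerivAt_greenCoeff {z : ℂ} (hz : ∀ k : ℤ, z ≠ k) :
    HasDerivAt greenCoeff (-(2 * Real.pi * Complex.I) * (greenCoeff z * (1 - greenCoeff z))) z := by
  have h1 : 1 - Complex.exp (2 * Real.pi * Complex.I * z) ≠ 0 :=
    sub_ne_zero.2 (exp_ne_one_of_forall_ne hz).symm
  have h2 : HasDerivAt (fun z => Complex.exp (2 * Real.pi * Complex.I * z))
      (Complex.exp (2 * Real.pi * Complex.I * z) * (2 * Real.pi * Complex.I * 1)) z :=
    ((hasDerivAt_id z).const_mul (2 * Real.pi * Complex.I)).cexp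
  have h3 := (h2.const_sub 1).fun_inv h1
  have h4 : greenCoeff = fun z => (1 - Complex.exp (2 * Real.pi * Complex.I * z))⁻¹ :=
    funext fun z => by rw [greenCoeff, one_div]
  rw [h4]
  refine h3.congr_deriv ?_
  field_simp
  ring

/-- With X = e^{2πix} one has 1 − G(x) = −X/(1 − X), so the second product is −XYZ times the first,
and XYZ = 1. -/
theorem greenCoeff_mul_add_mul {x y z : ℂ} (hx : ∀ k : ℤ, x ≠ k) (hy : ∀ k : ℤ, y ≠ k)
    (hz : ∀ k : ℤ, z ≠ k) (h : x + y + z = 0) :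
    greenCoeff x * greenCoeff y * greenCoeff z +
      (1 - greenCoeff x) * (1 - greenCoeff y) * (1 - greenCoeff z) = 0 := by
  have h1 : 1 - Complex.exp (2 * Real.pi * Complex.I * x) ≠ 0 :=
    sub_ne_zero.2 (exp_ne_one_of_forall_ne hx).symm
  have h2 : 1 - Complex.exp (2 * Real.pi * Complex.I * y) ≠ 0 :=
    sub_ne_zero.2 (exp_ne_one_of_forall_ne hy).symm
  have h3 : 1 - Complex.exp (2 * Real.pi * Complex.I * z) ≠ 0 :=
    sub_ne_zero.2 (exp_ne_one_of_forall_ne hz).symm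
  have h4 : Complex.exp (2 * Real.pi * Complex.I * x) * Complex.exp (2 * Real.pi * Complex.I * y) *
      Complex.exp (2 * Real.pi * Complex.I * z) = 1 := by
    rw [← Complex.exp_add, ← Complex.exp_add, ← mul_add, ← mul_add, h, mul_zero, Complex.exp_zero]
  rw [greenCoeff, greenCoeff, greenCoeff]
  generalize Complex.exp (2 * Real.pi * Complex.I * x) = X at *
  generalize Complex.exp (2 * Real.pi * Complex.I * y) = Y at *
  generalize Complex.exp (2 * Real.pi * Complex.I * z) = Z at *
  field_simp
  linear_combination -h4

theorem hasSum_UIndex {f : UIndex → ℂ} {a b c : ℂ} (ha : HasSum (fun n => f (.hh n)) a)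
    (hb : HasSum (fun n => f (.ef n)) b) (hc : HasSum (fun n => f (.fe n)) c) :
    HasSum f (a + b + c + f .cd) := by
  have e1 : Function.Injective UIndex.hh := fun _ _ h => UIndex.hh.inj h
  have e2 : Function.Injective UIndex.ef := fun _ _ h => UIndex.ef.inj h
  have e3 : Function.Injective UIndex.fe := fun _ _ h => UIndex.fe.inj h
  have h1 : HasSum (fun i : UIndex => match i with | .hh n => f (.hh n) | _ => 0) a :=
    (e1.hasSum_iff fun i hi => by cases i <;> simp_all).1 ha
  have h2 : HasSum (fun i : UIndex => match i with | .ef n => f (.ef n) | _ => 0) b :=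
    (e2.hasSum_iff fun i hi => by cases i <;> simp_all).1 hb
  have h3 : HasSum (fun i : UIndex => match i with | .fe n => f (.fe n) | _ => 0) c :=
    (e3.hasSum_iff fun i hi => by cases i <;> simp_all).1 hc
  have h4 : HasSum (fun i : UIndex => match i with | .cd => f .cd | _ => 0) (f .cd) :=
    hasSum_single UIndex.cd fun i hi => by cases i <;> simp_all
  refine (((h1.add h2).add h3).add h4).congr_fun fun i => ?_
  cases i <;> simp

theorem finite_UIndex {s : Set UIndex} (h1 : {n | UIndex.hh n ∈ s}.Finite)
    (h2 : {n | UIndex.ef n ∈ s}.Finite) (h3 : {n | UIndex.fe n ∈ s}.Finite) : s.Finite := by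
  refine ((((h1.image UIndex.hh).union (h2.image UIndex.ef)).union (h3.image UIndex.fe)).union
    (Set.finite_singleton UIndex.cd)).subset ?_
  rintro (n | n | n | _) hn
  · exact Or.inl (Or.inl (Or.inl ⟨n, hn, rfl⟩))
  · exact Or.inl (Or.inl (Or.inr ⟨n, hn, rfl⟩))
  · exact Or.inl (Or.inr ⟨n, hn, rfl⟩)
  · exact Or.inr rfl

/-- The eigenvalues of the r-matrix on `h ⊗ K`. -/
noncomputable def cartanCoeff (τ : ℂ) (n : ℤ) : ℂ :=
  if n = 0 then 1 / 2 else greenCoeff (-n * τ)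

/-- The eigenvalues of the r-matrix on the root spaces `e ⊗ K` (for `lam`) and `f ⊗ K`
(for `-lam`). -/
noncomputable def rootCoeff (τ lam : ℂ) (n : ℤ) : ℂ := greenCoeff (-n * τ + lam)

/-- The operator on `u_τ(sl₂^)` defined by the r-matrix. -/
noncomputable def opU (τ lam : ℂ) : UTau →ₗ[ℂ] UTau :=
  compOp (diagOp (rootCoeff τ lam)) (diagOp (rootCoeff τ (-lam))) (diagOp (cartanCoeff τ))

theorem hasSum_rU (τ lam : ℂ) (x y : UTau) :
    HasSum (fun i => form KCyl (rU τ lam i).1 x * form KCyl (rU τ lam i).2 y)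
      (form KCyl x (opU τ lam y)) := by
  have h : form KCyl x (opU τ lam y) = 2 * int (x.h * diagOp (cartanCoeff τ) y.h) +
      int (x.f * diagOp (rootCoeff τ lam) y.e) + int (x.e * diagOp (rootCoeff τ (-lam)) y.f) +
      form KCyl (rU τ lam .cd).1 x * form KCyl (rU τ lam .cd).2 y := by
    rw [form_apply', rU, form_cEl, form_dEl]
    simp only [opU, compOp_e, compOp_f, compOp_h, compOp_c, compOp_d]
    ring
  rw [h]
  refine hasSum_UIndex ?_ ?_ ?_
  -- The value (h, h) = 2 enters once in each tensor factor. The resulting 4, times 1/4 for n = 0 or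
  -- half the Green coefficient otherwise, is twice the eigenvalue.
  · have h1 := (hasSum_diagOp (fun n => cartanCoeff τ (-n)) x.h y.h).mul_left 2
    simp only [neg_neg] at h1
    refine h1.congr_fun fun n => ?_
    simp only [rU, map_smul, LinearMap.smul_apply, form_hHat, smul_eq_mul, cartanCoeff, neg_eq_zero]
    split_ifs
    · ring_nf
    · push_cast
      ring_nf
  · have h1 := hasSum_diagOp (fun n => rootCoeff τ lam (-n)) x.f y.e
    simp only [neg_neg] at h1
    refine h1.congr_fun fun n => ?_
    simp only [rU, map_smul, LinearMap.smul_apply, form_eHat, form_fHat, smul_eq_mul, rootCoeff]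
    push_cast
    ring_nf
  · have h1 := hasSum_diagOp (fun n => rootCoeff τ (-lam) (-n)) x.e y.f
    simp only [neg_neg] at h1
    refine h1.congr_fun fun n => ?_
    simp only [rU, map_smul, LinearMap.smul_apply, form_eHat, form_fHat, smul_eq_mul, rootCoeff]
    push_cast
    ring_nf

theorem tensorSum_rU (τ lam : ℂ) (x y : UTau) :
    tensorSum (form KCyl) (rU τ lam) x y = form KCyl x (opU τ lam y) := by
  have : HasSum (fun i => tensor₂ (form KCyl) (rU τ lam i).1 (rU τ lam i).2)
      (fun x y => form KCyl x (opU τ lam y)) :=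
    Pi.hasSum.2 fun x => Pi.hasSum.2 fun y => hasSum_rU τ lam x y
  rw [tensorSum, this.tsum_eq]

theorem finite_rU_fst (τ lam : ℂ) (y : UTau) :
    (Function.support fun i => form KCyl (rU τ lam i).1 y).Finite := by
  have h : ∀ s : KCyl, {n | int (jUp n * s) ≠ 0}.Finite := fun s => by
    refine (s.finite_support.preimage (f := fun n => -n) neg_injective.injOn).subset fun n hn => ?_
    intro h0
    refine hn ?_
    beta_reduce at h0
    rw [jUp, smul_mul_assoc, map_smul, mul_comm (jDown _), h0, smul_zero]
  refine finite_UIndex ((h y.h).subset fun n hn h0 => hn ?_)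
    ((h y.f).subset fun n hn h0 => hn ?_) ((h y.e).subset fun n hn h0 => hn ?_)
  all_goals simp only [rU, map_smul, LinearMap.smul_apply, form_eHat, form_fHat, form_hHat, h0,
    mul_zero, smul_zero]

theorem finite_rU_snd (τ lam : ℂ) (y : UTau) :
    (Function.support fun i => form KCyl (rU τ lam i).2 y).Finite := by
  have h : ∀ s : KCyl, {n | int (jDown n * s) ≠ 0}.Finite := fun s => by
    simp only [mul_comm _ s]
    exact s.finite_support
  refine finite_UIndex ((h y.h).subset fun n hn h0 => hn ?_)
    ((h y.e).subset fun n hn h0 => hn ?_) ((h y.f).subset fun n hn h0 => hn ?_)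
  all_goals simp only [rU, form_eHat, form_fHat, form_hHat, h0, mul_zero]

/-! ### Calculus of diagonal operators -/

theorem diagOp_add (F G : ℤ → ℂ) (s : KCyl) :
    diagOp F s + diagOp G s = diagOp (fun n => F n + G n) s := by
  induction s using KCyl.induction with
  | jDown n => simp only [diagOp_jDown, add_smul]
  | add s t hs ht => simp only [map_add, ← hs, ← ht]; abel
  | smul c s hs => simp only [map_smul, ← hs, smul_add]

theorem diagOp_diagOp (F G : ℤ → ℂ) (s : KCyl) :
    diagOp F (diagOp G s) = diagOp (fun n => G n * F n) s := by
  induction s using KCyl.induction with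
  | jDown n => simp only [diagOp_jDown, map_smul, smul_smul]
  | add s t hs ht => simp only [map_add, hs, ht]
  | smul c s hs => simp only [map_smul, hs]

theorem diagOp_one (s : KCyl) : diagOp (fun _ => 1) s = s := by
  induction s using KCyl.induction with
  | jDown n => simp only [diagOp_jDown, one_smul]
  | add s t hs ht => simp only [map_add, hs, ht]
  | smul c s hs => simp only [map_smul, hs]

theorem sub_diagOp (G : ℤ → ℂ) (s : KCyl) :
    s - diagOp G s = diagOp (fun n => 1 - G n) s := by
  rw [sub_eq_iff_eq_add, diagOp_add]
  simp only [sub_add_cancel, diagOp_one]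

theorem der_eq_diagOp (s : KCyl) :
    der s = diagOp (fun n => 2 * Real.pi * Complex.I * n) s := by
  induction s using KCyl.induction with
  | jDown n => simp only [diagOp_jDown, der_jDown]
  | add s t hs ht => simp only [map_add, hs, ht]
  | smul c s hs => rw [Derivation.map_smul, map_smul, hs]

theorem int_mul_diagOp_eq_neg {F G : ℤ → ℂ} (h : ∀ n, F n = -G n) (a b : KCyl) :
    int (a * diagOp F b) = -int (a * diagOp G b) := by
  induction b using KCyl.induction with
  | jDown n => rw [diagOp_jDown, diagOp_jDown, mul_smul_comm, mul_smul_comm, map_smul, map_smul, h,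
      neg_smul]
  | add s t hs ht => simp only [map_add, mul_add, hs, ht, neg_add]
  | smul c s hs => simp only [map_smul, mul_smul_comm, hs, smul_neg]

theorem int_mul_diagOp_add (F G : ℤ → ℂ) (a b : KCyl) :
    int (a * diagOp F b) + int (diagOp G a * b) =
      int (a * diagOp (fun n => F n + G (-n)) b) := by
  rw [int_diagOp_mul, ← map_add, ← mul_add, diagOp_add]

/-! ### Reflection, derivatives and the Yang-Baxter equation on the cylinder -/

section

variable {τ lam : ℂ} (hτ : 0 < τ.im) (hlam : lam ∉ periodLattice τ)

include hlam in
theorem add_ne_int (n k : ℤ) : n * τ + lam ≠ k := fun h =>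
  hlam ⟨k, -n, by push_cast; linear_combination h⟩

theorem neg_notMem_periodLattice (h : lam ∉ periodLattice τ) : -lam ∉ periodLattice τ := by
  rintro ⟨m, n, hmn⟩
  exact h ⟨-m, -n, by push_cast; linear_combination -hmn⟩

include hτ in
theorem mul_ne_int {n : ℤ} (hn : n ≠ 0) (k : ℤ) : (n : ℂ) * τ ≠ k := fun h => by
  have h1 := congrArg Complex.im h
  simp only [Complex.mul_im, Complex.intCast_re, Complex.intCast_im, zero_mul, add_zero] at h1
  rcases mul_eq_zero.1 h1 with h2 | h2
  · exact hn (by exact_mod_cast h2)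
  · exact hτ.ne' h2

include hlam in
theorem rootCoeff_neg (n : ℤ) : rootCoeff τ (-lam) (-n) = 1 - rootCoeff τ lam n := by
  rw [rootCoeff, rootCoeff, ← greenCoeff_neg]
  · push_cast
    ring_nf
  · intro k
    exact_mod_cast add_ne_int hlam (-n) k

include hτ in
theorem cartanCoeff_neg (n : ℤ) : cartanCoeff τ (-n) = 1 - cartanCoeff τ n := by
  rw [cartanCoeff, cartanCoeff]
  by_cases hn : n = 0
  · rw [if_pos hn, if_pos (by simpa)]
    norm_num
  · rw [if_neg hn, if_neg (by simpa), ← greenCoeff_neg]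
    · push_cast
      ring_nf
    · intro k
      exact_mod_cast mul_ne_int hτ (neg_ne_zero.2 hn) k

include hlam in
theorem hasDerivAt_rootCoeff (n : ℤ) :
    HasDerivAt (fun l => rootCoeff τ l n)
      (-(2 * Real.pi * Complex.I) * (rootCoeff τ lam n * (1 - rootCoeff τ lam n))) lam := by
  have h := hasDerivAt_greenCoeff (z := -n * τ + lam)
    (fun k => by exact_mod_cast add_ne_int hlam (-n) k)
  exact h.comp_const_add (-n * τ) lam

include hlam in
theorem hasDerivAt_rootCoeff_tau (n : ℤ) :
    HasDerivAt (fun t => rootCoeff t lam n)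
      (2 * Real.pi * Complex.I * n * (rootCoeff τ lam n * (1 - rootCoeff τ lam n))) τ := by
  have h := hasDerivAt_greenCoeff (z := -n * τ + lam)
    (fun k => by exact_mod_cast add_ne_int hlam (-n) k)
  have h2 : HasDerivAt (fun t : ℂ => -n * t + lam) (-n * 1) τ :=
    ((hasDerivAt_id τ).const_mul (-n : ℂ)).add_const lam
  refine (h.comp τ h2).congr_deriv ?_
  rw [rootCoeff]
  ring

include hτ in
theorem hasDerivAt_cartanCoeff (n : ℤ) :
    HasDerivAt (fun t => cartanCoeff t n)
      (2 * Real.pi * Complex.I * n * (cartanCoeff τ n * (1 - cartanCoeff τ n))) τ := by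
  simp only [cartanCoeff]
  by_cases hn : n = 0
  · simp only [hn, if_true, Int.cast_zero, mul_zero, zero_mul]
    exact hasDerivAt_const _ _
  · simp only [hn, if_false]
    have h := hasDerivAt_greenCoeff (z := -n * τ)
      (fun k => by exact_mod_cast mul_ne_int hτ (neg_ne_zero.2 hn) k)
    have h2 : HasDerivAt (fun t : ℂ => -n * t) (-n * 1) τ :=
      ((hasDerivAt_id τ).const_mul (-n : ℂ))
    refine (h.comp τ h2).congr_deriv ?_
    ring

theorem KCyl.int_separating (s : KCyl) (h : ∀ t, int (s * t) = 0) : s = 0 :=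
  KCyl.separating s fun n => h (jDown n)

include hτ hlam in
theorem isRMatrix_rU : IsRMatrix (form KCyl) (rU τ lam) (opU τ lam) := by
  refine IsRMatrix.of_finite form_symm form_invariant (form_separating KCyl.int_separating)
    (finite_rU_snd τ lam) (hasSum_rU τ lam) (compOp_unitary (fun a b => ?_) fun a b => ?_)
    (finite_rU_fst τ lam)
  · have h : ∀ n, rootCoeff τ lam (-n) = 1 - rootCoeff τ (-lam) n := fun n => by
      rw [← rootCoeff_neg (neg_notMem_periodLattice hlam), neg_neg]
    simp only [int_mul_diagOp_add, h, add_sub_cancel, diagOp_one]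
  · simp only [int_mul_diagOp_add, cartanCoeff_neg hτ, add_sub_cancel, diagOp_one]

include hτ hlam in
/-- The addition theorem behind the dynamical Yang-Baxter equation. -/
theorem int_rootCoeff_mul (w a b : KCyl) :
    int (diagOp (cartanCoeff τ) w * diagOp (rootCoeff τ lam) a * diagOp (rootCoeff τ (-lam)) b) +
      int ((w - diagOp (cartanCoeff τ) w) * (a - diagOp (rootCoeff τ lam) a) *
        (b - diagOp (rootCoeff τ (-lam)) b)) =
      int w * int (a * diagOp (fun n => 2 * Real.pi * Complex.I * (rootCoeff τ (-lam) n *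
        (1 - rootCoeff τ (-lam) n))) b) := by
  simp only [sub_diagOp]
  induction w using KCyl.induction with
  | jDown l =>
    induction a using KCyl.induction with
    | jDown m =>
      induction b using KCyl.induction with
      | jDown n =>
        simp only [diagOp_jDown, smul_mul_assoc, mul_smul_comm, map_smul, smul_eq_mul,
          jDown_mul, int_jDown]
        by_cases h : l + m + n = 0
        · rw [if_pos h]
          by_cases hl : l = 0
          -- For the constant mode both products contribute ½ b(1 − b), with b the eigenvalue on f
          -- at n, because the eigenvalue on e at −n is 1 − b. Their sum is the derivative term.
          · have hm : m = -n := by omega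
            subst hl hm
            have h1 := rootCoeff_neg (neg_notMem_periodLattice hlam) n
            rw [neg_neg] at h1
            rw [if_pos rfl, if_pos (by omega), h1, cartanCoeff, if_pos rfl]
            field_simp
            ring
          · rw [if_neg hl, cartanCoeff, if_neg hl, zero_mul]
            -- For l ≠ 0 the right side vanishes, and the three arguments of the Green coefficients
            -- sum to −(l + m + n)τ = 0.
            have := greenCoeff_mul_add_mul (x := -l * τ) (y := -m * τ + lam) (z := -n * τ + -lam)
              (fun k => by exact_mod_cast mul_ne_int hτ (neg_ne_zero.2 hl) k)
              (fun k => by exact_mod_cast add_ne_int hlam (-m) k)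
              (fun k => by exact_mod_cast add_ne_int (neg_notMem_periodLattice hlam) (-n) k)
              (by
                have : (l + m + n : ℂ) = 0 := by exact_mod_cast h
                linear_combination -τ * this)
            rw [rootCoeff, rootCoeff]
            linear_combination (2 * Real.pi * Complex.I)⁻¹ * this
        · rw [if_neg h]
          by_cases hl : l = 0
          · rw [if_neg (by omega : ¬ m + n = 0)]
            ring
          · rw [if_neg hl]
            ring
      | add s t hs ht => simp only [map_add, mul_add] at *; linear_combination hs + ht
      | smul c s hs =>
        simp only [map_smul, mul_smul_comm, smul_eq_mul] at *
        linear_combination c * hs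
    | add s t hs ht => simp only [map_add, mul_add, add_mul] at *; linear_combination hs + ht
    | smul c s hs =>
      simp only [map_smul, mul_smul_comm, smul_mul_assoc, smul_eq_mul] at *
      linear_combination c * hs
  | add s t hs ht => simp only [map_add, add_mul] at *; linear_combination hs + ht
  | smul c s hs =>
    simp only [map_smul, smul_mul_assoc, smul_eq_mul] at *
    linear_combination c * hs

include hlam in
-- The two root parts depend on λ and −λ. Reflecting the index in one of them exchanges G and 1 − G,
-- leaving G(1 − G) unchanged, while the sign stays; hence the antisymmetric shape required by
-- `yangBaxter_compOp`.
theorem hasDerivAt_tensorSum_rU (x y : UTau) :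
    HasDerivAt (fun l => tensorSum (form KCyl) (rU τ l) x y)
      (int (x.e * diagOp (fun n => 2 * Real.pi * Complex.I * (rootCoeff τ (-lam) n *
        (1 - rootCoeff τ (-lam) n))) y.f) -
      int (y.e * diagOp (fun n => 2 * Real.pi * Complex.I * (rootCoeff τ (-lam) n *
        (1 - rootCoeff τ (-lam) n))) x.f)) lam := by
  simp only [tensorSum_rU, form_apply', opU, compOp_e, compOp_f, compOp_h, compOp_c, compOp_d]
  have h1 := hasDerivAt_int_diagOp (hasDerivAt_rootCoeff hlam) x.f y.e
  have h2 := hasDerivAt_int_diagOp (G := fun l => rootCoeff τ (-l)) (l := lam) (fun n =>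
    (hasDerivAt_rootCoeff (neg_notMem_periodLattice hlam) n).comp lam (hasDerivAt_neg lam)) x.e y.f
  refine ((((h2.fun_add h1).add_const (2 * int (x.h * diagOp (cartanCoeff τ) y.h))).add_const
    (x.c * 0)).add_const (x.d * y.c)).congr_deriv ?_
  have h3 : ∀ n, rootCoeff τ (-lam) (-n) = 1 - rootCoeff τ lam n := rootCoeff_neg hlam
  rw [mul_comm y.e, int_diagOp_mul, sub_eq_add_neg]
  refine congrArg₂ (· + ·) ?_ (int_mul_diagOp_eq_neg (fun n => ?_) _ _)
  · congr 3
    ext n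
    ring_nf
  · rw [h3]
    ring

include hτ hlam in
-- Differentiating G(−nτ ± λ) in τ gives 2πi n G(1 − G). The factor 2πi n is d/du, and the adjoint
-- of 1 − ρ is ρ, so the cocycle of x₋ and y₋ has the same eigenvalues with opposite sign, also on
-- the h component.
theorem hasDerivAt_tensorSum_rU_tau (x y : UTau) :
    HasDerivAt (fun t => tensorSum (form KCyl) (rU t lam) x y)
      (-derForm (x - opU τ lam x) (y - opU τ lam y)) τ := by
  simp only [tensorSum_rU, form_apply', opU, compOp_e, compOp_f, compOp_h, compOp_c, compOp_d]
  have h1 := hasDerivAt_int_diagOp (hasDerivAt_rootCoeff_tau hlam) x.f y.e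
  have h2 :=
    hasDerivAt_int_diagOp (hasDerivAt_rootCoeff_tau (neg_notMem_periodLattice hlam)) x.e y.f
  have h3 := hasDerivAt_int_diagOp (hasDerivAt_cartanCoeff hτ) x.h y.h
  refine ((((h2.fun_add h1).fun_add (h3.const_mul 2)).add_const
    (x.c * 0)).add_const (x.d * y.c)).congr_deriv ?_
  have e1 : ∀ n, rootCoeff τ (-lam) (-n) = 1 - rootCoeff τ lam n := rootCoeff_neg hlam
  have e2 : ∀ n, rootCoeff τ lam (-n) = 1 - rootCoeff τ (-lam) n := fun n => by
    rw [← rootCoeff_neg (neg_notMem_periodLattice hlam), neg_neg]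
  have e3 := cartanCoeff_neg hτ
  simp only [derForm, sub_e, sub_f, sub_h, compOp_e, compOp_f, compOp_h, sub_diagOp,
    der_eq_diagOp, diagOp_diagOp, int_diagOp_mul, e1, e2, e3]
  rw [neg_add, neg_add, ← mul_neg]
  refine congrArg₂ (· + ·) (congrArg₂ (· + ·) (int_mul_diagOp_eq_neg (fun n => ?_) _ _)
    (int_mul_diagOp_eq_neg (fun n => ?_) _ _))
    (congrArg (2 * ·) (int_mul_diagOp_eq_neg (fun n => ?_) _ _))
  all_goals
    push_cast
    ring

include hτ hlam in
theorem yangBaxter_rU : yangBaxter (form KCyl) (rU τ lam) =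
    insertCyc (form KCyl) (hHat (jDown 0))
      (fun x y => deriv (fun l => tensorSum (form KCyl) (rU τ l) x y) lam) -
    insertCyc (form KCyl) cEl
      (fun x y => deriv (fun t => tensorSum (form KCyl) (rU t lam) x y) τ) := by
  simp only [(hasDerivAt_tensorSum_rU hlam _ _).deriv,
    (hasDerivAt_tensorSum_rU_tau hτ hlam _ _).deriv]
  rw [yangBaxter_compOp (isRMatrix_rU hτ hlam) _ (int_rootCoeff_mul hτ hlam), jDown_zero]
  funext x y z
  simp only [Pi.add_apply, Pi.sub_apply, insertCyc, opU]
  ring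

end

end EllipticCurrent

namespace EllipticCurrent

/-! ## The odd theta function -/

/-- The product `∏ (1 - q^(n+1) w)`. -/
noncomputable def qProd (q w : ℂ) : ℂ := ∏' n : ℕ, (1 + -(q ^ (n + 1) * w))

/-! ### Infinite products in the nome -/

section

variable {q : ℂ} (hq : ‖q‖ < 1)
include hq

theorem summable_norm_pow_mul (w : ℂ) : Summable fun n : ℕ => ‖-(q ^ (n + 1) * w)‖ := by
  simp only [norm_neg, norm_mul, norm_pow]
  exact ((summable_nat_add_iff 1).2
    (summable_geometric_of_lt_one (norm_nonneg _) hq)).mul_right _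

theorem hasProd_qProd (w : ℂ) : HasProd (fun n : ℕ => 1 + -(q ^ (n + 1) * w)) (qProd q w) :=
  (multipliable_one_add_of_summable (summable_norm_pow_mul hq w)).hasProd

theorem qProd_ne_zero {w : ℂ} (h : ∀ n : ℕ, q ^ (n + 1) * w ≠ 1) : qProd q w ≠ 0 :=
  tprod_one_add_ne_zero_of_summable (fun n => by
    rw [← sub_eq_add_neg]
    exact sub_ne_zero.2 (h n).symm) (summable_norm_pow_mul hq w)

/-- Splitting off the first factor shifts the exponents by one. This is the source of the
quasi-periodicity of θ in τ. -/
theorem qProd_eq_mul (w : ℂ) : qProd q w = (1 - q * w) * qProd q (q * w) := by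
  have h : HasProd (fun n : ℕ => 1 + -(q ^ (n + 1 + 1) * w)) (qProd q (q * w)) := by
    refine (hasProd_qProd hq (q * w)).congr_fun fun n => ?_
    ring
  have h2 := HasProd.zero_mul (f := fun n : ℕ => 1 + -(q ^ (n + 1) * w)) h
  rw [(hasProd_qProd hq w).unique h2]
  ring

theorem differentiable_qProd : Differentiable ℂ (qProd q) := by
  intro w
  have h : HasProdLocallyUniformlyOn (fun (n : ℕ) w => 1 + -(q ^ (n + 1) * w)) (qProd q)
      (Metric.ball 0 (‖w‖ + 1)) := by
    refine Summable.hasProdLocallyUniformlyOn_nat_one_add Metric.isOpen_ball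
      (summable_norm_pow_mul hq ((‖w‖ + 1 : ℝ) : ℂ)) (.of_forall fun n x hx => ?_)
      (fun n => by fun_prop)
    rw [mem_ball_zero_iff] at hx
    simp only [norm_neg, norm_mul, Complex.norm_real]
    gcongr
    exact hx.le.trans (le_abs_self _)
  have hd : DifferentiableOn ℂ (qProd q) (Metric.ball 0 (‖w‖ + 1)) := by
    refine h.differentiableOn (.of_forall fun s => ?_) Metric.isOpen_ball
    simpa [Finset.prod_fn] using DifferentiableOn.finsetProd (fun _ _ => by fun_prop)
  exact (hd w (by simp)).differentiableAt (Metric.isOpen_ball.mem_nhds (by simp))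

end

/-! ### Properties of the product formula for θ -/

section

variable {τ : ℂ} (hτ : 0 < τ.im)
include hτ

theorem norm_exp_two_pi_lt_one : ‖Complex.exp (2 * Real.pi * Complex.I * τ)‖ < 1 := by
  rw [Complex.norm_exp, Real.exp_lt_one_iff]
  have : (2 * Real.pi * Complex.I * τ).re = -(2 * Real.pi * τ.im) := by
    simp [Complex.mul_re, Complex.mul_im]
  rw [this]
  have := Real.pi_pos
  nlinarith [mul_pos this hτ]

omit hτ in
theorem exp_ne_one_of_add_notMem {u : ℂ} (n : ℕ) (hu : u ∉ periodLattice τ) :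
    Complex.exp (2 * Real.pi * Complex.I * τ) ^ (n + 1) *
      Complex.exp (2 * Real.pi * Complex.I * u) ≠ 1 := by
  rw [← Complex.exp_nat_mul, ← Complex.exp_add]
  have := exp_ne_one_of_forall_ne (fun k => by exact_mod_cast add_ne_int hu ((n : ℤ) + 1) k)
  convert this using 2
  push_cast
  ring

theorem qProd_one_ne_zero : qProd (Complex.exp (2 * Real.pi * Complex.I * τ)) 1 ≠ 0 := by
  refine qProd_ne_zero (norm_exp_two_pi_lt_one hτ) fun n => ?_
  rw [mul_one, ← Complex.exp_nat_mul]
  have := exp_ne_one_of_forall_ne (fun k => by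
    exact_mod_cast mul_ne_int hτ (n := (n : ℤ) + 1) (by omega) k)
  convert this using 2
  push_cast
  ring

theorem theta_eq (u : ℂ) : theta τ u = Complex.sin (Real.pi * u) / Real.pi *
    (qProd (Complex.exp (2 * Real.pi * Complex.I * τ)) (Complex.exp (2 * Real.pi * Complex.I * u)) *
      qProd (Complex.exp (2 * Real.pi * Complex.I * τ))
        (Complex.exp (2 * Real.pi * Complex.I * -u)) /
      qProd (Complex.exp (2 * Real.pi * Complex.I * τ)) 1 ^ 2) := by
  have hq := norm_exp_two_pi_lt_one hτ
  have h1 := hasProd_qProd hq (Complex.exp (2 * Real.pi * Complex.I * u))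
  have h2 := hasProd_qProd hq (Complex.exp (2 * Real.pi * Complex.I * -u))
  have h3 := hasProd_qProd hq 1
  have h4 : HasProd
      (fun n : ℕ => (1 + -(Complex.exp (2 * Real.pi * Complex.I * τ) ^ (n + 1) * 1))⁻¹)
      (qProd (Complex.exp (2 * Real.pi * Complex.I * τ)) 1)⁻¹ := h3.inv₀ (qProd_one_ne_zero hτ)
  have h5 := (h1.mul h2).mul (h4.mul h4)
  have e : ∀ (n : ℕ) (v : ℂ), Complex.exp (2 * Real.pi * Complex.I * ((n + 1) * τ + v)) =
      Complex.exp (2 * Real.pi * Complex.I * τ) ^ (n + 1) *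
        Complex.exp (2 * Real.pi * Complex.I * v) := fun n v => by
    rw [← Complex.exp_nat_mul, ← Complex.exp_add]
    congr 1
    push_cast
    ring
  have e0 : ∀ (n : ℕ), Complex.exp (2 * Real.pi * Complex.I * ((n + 1) * τ)) =
      Complex.exp (2 * Real.pi * Complex.I * τ) ^ (n + 1) * 1 := fun n => by
    rw [← add_zero ((n + 1) * τ), e, mul_zero, Complex.exp_zero]
  rw [theta]
  congr 1
  rw [div_eq_mul_inv, sq, mul_inv, ← h5.tprod_eq]
  refine tprod_congr fun n => ?_
  rw [e, sub_eq_add_neg _ u, e, e0]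
  simp only [sub_eq_add_neg, div_eq_mul_inv, sq, mul_inv]

theorem differentiable_thetaQuotient : Differentiable ℂ fun u =>
    qProd (Complex.exp (2 * Real.pi * Complex.I * τ)) (Complex.exp (2 * Real.pi * Complex.I * u)) *
      qProd (Complex.exp (2 * Real.pi * Complex.I * τ))
        (Complex.exp (2 * Real.pi * Complex.I * -u)) /
      qProd (Complex.exp (2 * Real.pi * Complex.I * τ)) 1 ^ 2 := by
  have h := differentiable_qProd (norm_exp_two_pi_lt_one hτ)
  have h1 : Differentiable ℂ fun u => qProd (Complex.exp (2 * Real.pi * Complex.I * τ))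
    (Complex.exp (2 * Real.pi * Complex.I * u)) := h.comp (by fun_prop)
  have h2 : Differentiable ℂ fun u => qProd (Complex.exp (2 * Real.pi * Complex.I * τ))
    (Complex.exp (2 * Real.pi * Complex.I * -u)) := h.comp (by fun_prop)
  exact (h1.mul h2).div_const _

theorem isOddTheta_theta : IsOddTheta τ (theta τ) where
  holomorphic := by
    rw [funext (theta_eq hτ)]
    have := differentiable_thetaQuotient hτ
    fun_prop
  odd u := by
    rw [theta_eq hτ, theta_eq hτ, mul_neg, Complex.sin_neg, neg_neg]
    ring
  add_one u := by
    have h1 : Complex.exp (2 * Real.pi * Complex.I * (u + 1)) =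
        Complex.exp (2 * Real.pi * Complex.I * u) := by
      rw [mul_add, mul_one, Complex.exp_add, Complex.exp_two_pi_mul_I, mul_one]
    have h2 : Complex.exp (2 * Real.pi * Complex.I * -(u + 1)) =
        Complex.exp (2 * Real.pi * Complex.I * -u) := by
      rw [mul_neg, mul_neg, Complex.exp_neg, h1, Complex.exp_neg]
    rw [theta_eq hτ, theta_eq hτ, h1, h2, mul_add, mul_one, Complex.sin_add_pi]
    ring
  add_tau u := by
    have hq := norm_exp_two_pi_lt_one hτ
    have hz := qProd_eq_mul hq (Complex.exp (2 * Real.pi * Complex.I * u))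
    have hw := qProd_eq_mul hq (Complex.exp (2 * Real.pi * Complex.I * -(u + τ)))
    rw [← Complex.exp_add, ← mul_add, add_comm τ u] at hz
    rw [← Complex.exp_add, ← mul_add, neg_add, add_comm τ, neg_add_cancel_right] at hw
    -- Under u ↦ u + τ one product loses the factor 1 − e^{2πi(u+τ)} and the other gains 1 −
    -- e^{−2πiu}. Comparing these with the change of the sine gives the automorphy factor.
    have key : Complex.sin (Real.pi * (u + τ)) * (1 - Complex.exp (2 * Real.pi * Complex.I * -u)) =
        -Complex.exp (-2 * Real.pi * Complex.I * u - Real.pi * Complex.I * τ) *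
          (Complex.sin (Real.pi * u) * (1 - Complex.exp (2 * Real.pi * Complex.I * (u + τ)))) := by
      have ha := Complex.exp_ne_zero (Real.pi * Complex.I * u)
      have hb := Complex.exp_ne_zero (Real.pi * Complex.I * τ)
      rw [Complex.sin, Complex.sin,
        show -(Real.pi * (u + τ)) * Complex.I =
          -(Real.pi * Complex.I * u) + -(Real.pi * Complex.I * τ) by ring,
        show (Real.pi * (u + τ)) * Complex.I =
          Real.pi * Complex.I * u + Real.pi * Complex.I * τ by ring,
        show 2 * Real.pi * Complex.I * -u =
          -(Real.pi * Complex.I * u) + -(Real.pi * Complex.I * u) by ring,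
        show -2 * Real.pi * Complex.I * u - Real.pi * Complex.I * τ = -(Real.pi * Complex.I * u) +
          -(Real.pi * Complex.I * u) + -(Real.pi * Complex.I * τ) by ring,
        show -(Real.pi * u) * Complex.I = -(Real.pi * Complex.I * u) by ring,
        show Real.pi * u * Complex.I = Real.pi * Complex.I * u by ring,
        show 2 * Real.pi * Complex.I * (u + τ) = Real.pi * Complex.I * u + Real.pi * Complex.I * u +
          (Real.pi * Complex.I * τ + Real.pi * Complex.I * τ) by ring]
      simp only [Complex.exp_add, Complex.exp_neg]
      field_simp
      ring
    rw [theta_eq hτ, theta_eq hτ, hz, neg_add, hw]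
    linear_combination (qProd (Complex.exp (2 * Real.pi * Complex.I * τ))
      (Complex.exp (2 * Real.pi * Complex.I * (u + τ))) *
      qProd (Complex.exp (2 * Real.pi * Complex.I * τ))
        (Complex.exp (2 * Real.pi * Complex.I * -u)) /
      qProd (Complex.exp (2 * Real.pi * Complex.I * τ)) 1 ^ 2 / Real.pi) * key
  deriv_zero := by
    have h0 : (Real.pi : ℂ) ≠ 0 := by exact_mod_cast Real.pi_ne_zero
    have h1 : HasDerivAt (fun u : ℂ => Complex.sin (Real.pi * u) / Real.pi)
        (Complex.cos (Real.pi * 0) * (Real.pi * 1) / Real.pi) 0 :=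
      (((hasDerivAt_id (0 : ℂ)).const_mul (Real.pi : ℂ)).csin).div_const _
    have h2 := h1.fun_mul (differentiable_thetaQuotient hτ 0).hasDerivAt
    rw [funext (theta_eq hτ), h2.deriv]
    have := qProd_one_ne_zero hτ
    simp only [mul_zero, neg_zero, Complex.exp_zero, Complex.sin_zero, Complex.cos_zero]
    rw [zero_div, zero_mul, add_zero, one_mul, mul_one, div_self h0, one_mul, sq,
      div_self (mul_ne_zero this this)]

theorem theta_ne_zero {u : ℂ} (hu : u ∉ periodLattice τ) : theta τ u ≠ 0 := by
  have hq := norm_exp_two_pi_lt_one hτ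
  rw [theta_eq hτ]
  refine mul_ne_zero (div_ne_zero ?_ (by exact_mod_cast Real.pi_ne_zero))
    (div_ne_zero (mul_ne_zero ?_ ?_) (pow_ne_zero _ (qProd_one_ne_zero hτ)))
  · rw [Complex.sin_ne_zero_iff]
    intro k hk
    refine hu ⟨k, 0, ?_⟩
    have : (Real.pi : ℂ) ≠ 0 := by exact_mod_cast Real.pi_ne_zero
    refine mul_left_cancel₀ this ?_
    rw [hk]
    push_cast
    ring
  · exact qProd_ne_zero hq fun n => exp_ne_one_of_add_notMem n hu
  · exact qProd_ne_zero hq fun n => exp_ne_one_of_add_notMem n (neg_notMem_periodLattice hu)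

end

end EllipticCurrent

namespace EllipticCurrent

/-! ## Theta functions of higher order -/

/-- The factor of automorphy of theta functions of order `N` and character `mu`. -/
noncomputable def multiplier (τ mu : ℂ) (N : ℕ) (u : ℂ) : ℂ :=
  (-1) ^ N * Complex.exp (-(2 * Real.pi * Complex.I) * (N * u + N * τ / 2 + mu))

theorem multiplier_ne_zero (τ mu : ℂ) (N : ℕ) (u : ℂ) : multiplier τ mu N u ≠ 0 :=
  mul_ne_zero (pow_ne_zero _ (by norm_num)) (Complex.exp_ne_zero _)

theorem multiplier_mul (τ mu nu : ℂ) (M N : ℕ) (u : ℂ) :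
    multiplier τ mu M u * multiplier τ nu N u = multiplier τ (mu + nu) (M + N) u := by
  rw [multiplier, multiplier, multiplier, mul_mul_mul_comm, ← pow_add, ← Complex.exp_add]
  push_cast
  ring_nf

theorem hasDerivAt_multiplier (τ mu : ℂ) (N : ℕ) (u : ℂ) :
    HasDerivAt (multiplier τ mu N)
      (-(2 * Real.pi * Complex.I) * N * multiplier τ mu N u) u := by
  have h := ((((((hasDerivAt_id u).const_mul (N : ℂ)).add_const (N * τ / 2)).add_const mu).const_mul
    (-(2 * Real.pi * Complex.I))).cexp).const_mul ((-1 : ℂ) ^ N)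
  refine h.congr_deriv ?_
  rw [multiplier]
  simp only [id]
  ring

/-- Entire functions `g` with `g (u + 1) = (-1)^N g(u)` and
`g (u + τ) = (-1)^N exp (-2πi (N u + N τ / 2 + mu)) g(u)`. -/
structure IsThetaFunction (τ mu : ℂ) (N : ℕ) (g : ℂ → ℂ) : Prop where
  holomorphic : Differentiable ℂ g
  add_one : ∀ u, g (u + 1) = (-1) ^ N * g u
  add_tau : ∀ u, g (u + τ) = multiplier τ mu N u * g u

theorem differentiable_deriv {g : ℂ → ℂ} (hg : Differentiable ℂ g) : Differentiable ℂ (deriv g) :=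
  fun u => ((hg.differentiableOn (s := Set.univ)).deriv isOpen_univ u
    trivial).differentiableAt Filter.univ_mem

namespace IsThetaFunction

variable {τ mu nu : ℂ} {M N : ℕ} {g h : ℂ → ℂ}

theorem mul (hg : IsThetaFunction τ mu M g) (hh : IsThetaFunction τ nu N h) :
    IsThetaFunction τ (mu + nu) (M + N) (fun u => g u * h u) where
  holomorphic := hg.holomorphic.mul hh.holomorphic
  add_one u := by rw [hg.add_one, hh.add_one]; ring
  add_tau u := by rw [hg.add_tau, hh.add_tau, ← multiplier_mul]; ring

theorem add (hg : IsThetaFunction τ mu N g) (hh : IsThetaFunction τ mu N h) :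
    IsThetaFunction τ mu N (fun u => g u + h u) where
  holomorphic := hg.holomorphic.add hh.holomorphic
  add_one u := by rw [hg.add_one, hh.add_one]; ring
  add_tau u := by rw [hg.add_tau, hh.add_tau]; ring

theorem const_mul (c : ℂ) (hg : IsThetaFunction τ mu N g) :
    IsThetaFunction τ mu N (fun u => c * g u) where
  holomorphic := hg.holomorphic.const_mul c
  add_one u := by rw [hg.add_one]; ring
  add_tau u := by rw [hg.add_tau]; ring

theorem deriv_add_one (hg : IsThetaFunction τ mu N g) (u : ℂ) :
    deriv g (u + 1) = (-1) ^ N * deriv g u := by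
  rw [← deriv_comp_add_const, funext hg.add_one, deriv_const_mul _ (hg.holomorphic u)]

theorem deriv_add_tau (hg : IsThetaFunction τ mu N g) (u : ℂ) :
    deriv g (u + τ) = multiplier τ mu N u * (deriv g u - 2 * Real.pi * Complex.I * N * g u) := by
  rw [← deriv_comp_add_const, funext hg.add_tau,
    ((hasDerivAt_multiplier τ mu N u).fun_mul (hg.holomorphic u).hasDerivAt).deriv]
  ring

/-- The numerator of the derivative of `g / h ^ N`. -/
theorem wronskian (hg : IsThetaFunction τ mu N g) (hh : IsThetaFunction τ nu 1 h) :
    IsThetaFunction τ (mu + nu) (N + 1) (fun u => deriv g u * h u - N * g u * deriv h u) where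
  holomorphic := ((differentiable_deriv hg.holomorphic).mul hh.holomorphic).sub
    ((hg.holomorphic.const_mul _).mul (differentiable_deriv hh.holomorphic))
  add_one u := by
    rw [hg.deriv_add_one, hh.deriv_add_one, hg.add_one, hh.add_one]; ring
  add_tau u := by
    rw [hg.deriv_add_tau, hh.deriv_add_tau, hg.add_tau, hh.add_tau, ← multiplier_mul]
    push_cast
    ring

end IsThetaFunction

section

variable {τ : ℂ} (hτ : 0 < τ.im)

theorem periodLattice_induction {p : ℂ → Prop} (h0 : p 0) (h1 : ∀ u, p (u + 1) ↔ p u)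
    (hτ : ∀ u, p (u + τ) ↔ p u) {u : ℂ} (hu : u ∈ periodLattice τ) : p u := by
  obtain ⟨m, n, rfl⟩ := hu
  have key : ∀ (a v : ℂ), (∀ u, p (u + a) ↔ p u) → ∀ k : ℤ, p (v + k * a) ↔ p v := by
    intro a v ha k
    induction k using Int.induction_on with
    | zero => simp
    | succ k ih => rw [← ih, ← ha (v + ((k : ℤ) : ℂ) * a)]; push_cast; ring_nf
    | pred k ih => rw [← ih, ← ha (v + ((-(k : ℤ) - 1 : ℤ) : ℂ) * a)]; push_cast; ring_nf
  rw [key τ m hτ n, ← zero_add (m : ℂ), ← mul_one (m : ℂ), key 1 0 h1 m]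
  exact h0

/-- A holomorphic function with constant multipliers on an elliptic curve vanishes, unless the
multipliers are those of a point of the lattice. -/
theorem IsThetaFunction.eq_zero_of_order_zero {mu : ℂ} {g : ℂ → ℂ} (hτ : 0 < τ.im)
    (hmu : mu ∉ periodLattice τ) (hg : IsThetaFunction τ mu 0 g) : g = 0 := by
  -- The twist e^{−ibu} with b real keeps the modulus under u ↦ u + 1; along τ it contributes e^{b
  -- Im τ}, which is to cancel the modulus e^{2π Im mu} of the multiplier.
  set b : ℝ := -(2 * Real.pi * mu.im) / τ.im with hb
  let H : ℂ → ℂ := fun u => Complex.exp (-(b * Complex.I) * u) * g u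
  have hH : Differentiable ℂ H := by
    have := hg.holomorphic
    fun_prop
  have h1 : ∀ u, ‖H (u + 1)‖ = ‖H u‖ := fun u => by
    change ‖Complex.exp (-(b * Complex.I) * (u + 1)) * g (u + 1)‖ =
      ‖Complex.exp (-(b * Complex.I) * u) * g u‖
    rw [hg.add_one, pow_zero, one_mul, norm_mul, norm_mul, Complex.norm_exp, Complex.norm_exp]
    congr 2
    simp
  have h2 : ∀ u, ‖H (u + τ)‖ = ‖H u‖ := fun u => by
    change ‖Complex.exp (-(b * Complex.I) * (u + τ)) * g (u + τ)‖ =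
      ‖Complex.exp (-(b * Complex.I) * u) * g u‖
    rw [hg.add_tau, multiplier, pow_zero, one_mul, norm_mul, norm_mul, norm_mul, ← mul_assoc,
      Complex.norm_exp, Complex.norm_exp, Complex.norm_exp, ← Real.exp_add]
    congr 2
    have hb' : b * τ.im = -(2 * Real.pi * mu.im) := by
      rw [hb]
      field_simp
    simp
    linear_combination hb'
  -- The modulus of H is doubly periodic, hence bounded by its maximum over a period parallelogram.
  have hbdd : Bornology.IsBounded (Set.range H) := by
    obtain ⟨C, hC⟩ := ((isCompact_Icc (a := (0 : ℝ)) (b := 1)).prod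
      (isCompact_Icc (a := (0 : ℝ)) (b := 1))).exists_bound_of_continuousOn
      (f := fun p : ℝ × ℝ => H (p.1 + p.2 * τ)) (by
        have := hH.continuous
        fun_prop)
    rw [isBounded_iff_forall_norm_le]
    refine ⟨C, ?_⟩
    rintro _ ⟨u, rfl⟩
    set t := u.im / τ.im
    set s := u.re - t * τ.re
    have hu : u = s + t * τ := by
      apply Complex.ext
      · simp [s]
      · simp [t, hτ.ne']
    have hper1 : Function.Periodic (fun u => ‖H u‖) 1 := h1
    have hper2 : Function.Periodic (fun u => ‖H u‖) τ := h2
    have e1 := hper1.sub_int_mul_eq (x := u) ⌊s⌋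
    have e2 := hper2.sub_int_mul_eq (x := u - ⌊s⌋ * 1) ⌊t⌋
    have h3 := hC (Int.fract s, Int.fract t) ⟨⟨Int.fract_nonneg s, (Int.fract_lt_one s).le⟩,
      ⟨Int.fract_nonneg t, (Int.fract_lt_one t).le⟩⟩
    beta_reduce at e1 e2
    rw [← e1, ← e2]
    rw [show u - ⌊s⌋ * 1 - ⌊t⌋ * τ = (Int.fract s : ℝ) + (Int.fract t : ℝ) * τ by
      rw [← Int.self_sub_floor, ← Int.self_sub_floor]
      push_cast
      linear_combination hu]
    exact h3
  have hconst := fun u => hH.apply_eq_apply_of_bounded hbdd u 0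
  by_contra hne
  have hg0 : g 0 ≠ 0 := by
    intro h0
    refine hne (funext fun u => ?_)
    have := hconst u
    simp only [H, h0, mul_zero] at this
    exact (mul_eq_zero.1 this).resolve_left (Complex.exp_ne_zero _)
  -- By Liouville H is constant, and nonzero, so both of its multipliers equal 1. Their logarithms
  -- exhibit mu as a lattice point.
  have e1 : Complex.exp (-(b * Complex.I)) = 1 := by
    have := hconst (0 + 1)
    simp only [H] at this
    rw [hg.add_one] at this
    simpa [hg0] using this
  have e2 : Complex.exp (-(b * Complex.I) * τ + -(2 * Real.pi * Complex.I) * mu) = 1 := by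
    have := hconst (0 + τ)
    simp only [H] at this
    rw [hg.add_tau, multiplier, ← mul_assoc] at this
    have := mul_right_cancel₀ hg0 this
    rw [Complex.exp_add]
    simpa using this
  obtain ⟨k, hk⟩ := Complex.exp_eq_one_iff.1 e1
  obtain ⟨l, hl⟩ := Complex.exp_eq_one_iff.1 e2
  refine hmu ⟨-l, k, mul_left_cancel₀ Complex.two_pi_I_ne_zero ?_⟩
  push_cast
  linear_combination -hl + τ * hk

/-- Quotients of entire functions by entire functions with simple zeros. -/
theorem exists_entire_quotient {f g : ℂ → ℂ} (hf : Differentiable ℂ f) (hg : Differentiable ℂ g)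
    (h : ∀ u, f u = 0 → deriv f u ≠ 0 ∧ g u = 0) :
    ∃ k : ℂ → ℂ, Differentiable ℂ k ∧ ∀ u, g u = k u * f u := by
  classical
  refine ⟨fun u => if f u = 0 then deriv g u / deriv f u else g u / f u, fun a => ?_, fun u => ?_⟩
  · by_cases ha : f a = 0
    · obtain ⟨hda, hga⟩ := h a ha
      have hdf : DifferentiableAt ℂ (dslope f a) a :=
        ((Complex.differentiableOn_dslope Filter.univ_mem).2 hf.differentiableOn).differentiableAt
          Filter.univ_mem
      have hdg : DifferentiableAt ℂ (dslope g a) a :=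
        ((Complex.differentiableOn_dslope Filter.univ_mem).2 hg.differentiableOn).differentiableAt
          Filter.univ_mem
      have hne : dslope f a a ≠ 0 := by rwa [dslope_same]
      -- Near a zero a of f both functions are u − a times their divided differences, so the
      -- quotient of the latter is the holomorphic extension.
      refine (hdg.div hdf hne).congr_of_eventuallyEq ?_
      filter_upwards [hdf.continuousAt.eventually_ne hne] with u hu
      by_cases hua : u = a
      · subst hua
        simp [ha]
      · have e1 : f u = (u - a) * dslope f a u := by
          have := sub_smul_dslope f a u
          rw [ha, sub_zero] at this
          exact this.symm
        have e2 : g u = (u - a) * dslope g a u := by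
          have := sub_smul_dslope g a u
          rw [hga, sub_zero] at this
          exact this.symm
        have hua' := sub_ne_zero.2 hua
        rw [if_neg (by rw [e1]; exact mul_ne_zero hua' hu), e1, e2, mul_div_mul_left _ _ hua']
        rfl
    · refine ((hg a).div (hf a) ha).congr_of_eventuallyEq ?_
      filter_upwards [(hf a).continuousAt.eventually_ne ha] with u hu
      rw [if_neg hu]
      rfl
  · beta_reduce
    split_ifs with hu
    · rw [(h u hu).2, hu, mul_zero]
    · rw [div_mul_cancel₀ _ hu]

theorem entire_mul_right_cancel {f g h : ℂ → ℂ} (hf : Differentiable ℂ f)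
    (hg : Differentiable ℂ g) (hh : Differentiable ℂ h) {a : ℂ} (ha : h a ≠ 0)
    (H : ∀ u, f u * h u = g u * h u) : f = g := by
  refine AnalyticOnNhd.eq_of_eventuallyEq (z₀ := a)
    (hf.differentiableOn.analyticOnNhd isOpen_univ)
    (hg.differentiableOn.analyticOnNhd isOpen_univ) ?_
  filter_upwards [(hh a).continuousAt.eventually_ne ha] with u hu
  exact mul_right_cancel₀ hu (H u)

include hτ

theorem isThetaFunction_theta_shift (mu : ℂ) :
    IsThetaFunction τ mu 1 (fun u => theta τ (u + mu)) where
  holomorphic := by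
    have := (isOddTheta_theta hτ).holomorphic
    fun_prop
  add_one u := by
    rw [add_right_comm, (isOddTheta_theta hτ).add_one]; ring
  add_tau u := by
    rw [add_right_comm, (isOddTheta_theta hτ).add_tau, multiplier]
    push_cast
    ring_nf

theorem isThetaFunction_theta : IsThetaFunction τ 0 1 (theta τ) := by
  simpa using isThetaFunction_theta_shift hτ 0

theorem theta_zero : theta τ 0 = 0 := by
  have := (isOddTheta_theta hτ).odd 0
  rw [neg_zero] at this
  exact self_eq_neg.1 this

/-- A theta function of positive order which vanishes at the origin is divisible by the odd theta
function. -/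
theorem IsThetaFunction.exists_quotient {mu : ℂ} {N : ℕ} {g : ℂ → ℂ}
    (hg : IsThetaFunction τ mu (N + 1) g) (h0 : g 0 = 0) :
    ∃ k, IsThetaFunction τ mu N k ∧ ∀ u, g u = k u * theta τ u := by
  have hθ := isThetaFunction_theta hτ
  -- The zeros at 0 and the simplicity of that of θ spread over the lattice by quasi-periodicity.
  -- The extra term in the derivative at u + τ is a multiple of θ(u) and drops out at a zero.
  have hzero : ∀ u, u ∈ periodLattice τ → (theta τ u = 0 ∧ deriv (theta τ) u ≠ 0) ∧ g u = 0 := by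
    intro u hu
    refine periodLattice_induction (τ := τ)
      (p := fun u => (theta τ u = 0 ∧ deriv (theta τ) u ≠ 0) ∧ g u = 0) ?_ ?_ ?_ hu
    · refine ⟨⟨theta_zero hτ, ?_⟩, h0⟩
      rw [(isOddTheta_theta hτ).deriv_zero]
      exact one_ne_zero
    · intro u
      rw [hθ.add_one, hθ.deriv_add_one, hg.add_one]
      simp
    · intro u
      rw [hθ.add_tau, hθ.deriv_add_tau, hg.add_tau, mul_eq_zero, mul_eq_zero, mul_ne_zero_iff]
      simp only [multiplier_ne_zero, false_or, ne_eq, not_false_eq_true, true_and]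
      refine and_congr_left fun _ => and_congr_right fun h => ?_
      rw [h, mul_zero, sub_zero]
  obtain ⟨k, hk, hgk⟩ := exists_entire_quotient hθ.holomorphic hg.holomorphic fun u hu => by
    by_cases h : u ∈ periodLattice τ
    · exact ⟨(hzero u h).1.2, (hzero u h).2⟩
    · exact absurd hu (theta_ne_zero hτ h)
  obtain ⟨a, ha⟩ : ∃ a, theta τ a ≠ 0 := by
    by_contra! h
    have := (isOddTheta_theta hτ).deriv_zero
    rw [show theta τ = fun _ => 0 from funext h, deriv_const] at this
    exact zero_ne_one this
  refine ⟨k, ⟨hk, fun u => ?_, fun u => ?_⟩, hgk⟩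
  -- The transformation laws of the quotient hold after multiplication by θ, and θ can be cancelled
  -- as it is not identically zero.
  · refine congrFun (entire_mul_right_cancel (f := fun u => k (u + 1))
      (g := fun u => (-1) ^ N * k u) (by fun_prop) (by fun_prop) hθ.holomorphic ha fun u => ?_) u
    have h1 := hg.add_one u
    rw [hgk, hgk, hθ.add_one] at h1
    linear_combination -h1
  · have hm : Differentiable ℂ (multiplier τ mu N) := fun u =>
      (hasDerivAt_multiplier τ mu N u).differentiableAt
    refine congrFun (entire_mul_right_cancel (f := fun u => k (u + τ))
      (g := fun u => multiplier τ mu N u * k u) (by fun_prop) (by fun_prop) hθ.holomorphic ha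
      fun u => ?_) u
    have h1 := hg.add_tau u
    rw [hgk, hgk, hθ.add_tau, ← add_zero mu, ← multiplier_mul] at h1
    refine mul_left_cancel₀ (multiplier_ne_zero τ 0 1 u) ?_
    linear_combination h1

end

end EllipticCurrent

namespace EllipticCurrent

open TestAlgebra

/-! ## Polar parts -/

/-- A test algebra of Laurent series in the coordinate `u`: `regular` is the subalgebra of regular
elements, and `reflect` is `s(u) ↦ s(-u)`. -/
class LaurentAlgebra (K : Type) [CommRing K] [Algebra ℂ K] [TestAlgebra K] where
  coord : K
  der_coord : der coord = 1
  regular : Subalgebra ℂ K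
  coord_mem_regular : coord ∈ regular
  der_mem_regular : ∀ {s}, s ∈ regular → der s ∈ regular
  int_eq_zero_of_mem_regular : ∀ {s}, s ∈ regular → int s = 0
  mem_regular_of_int_eq_zero : ∀ {s}, (∀ n : ℕ, int ((-coord) ^ n * s) = 0) → s ∈ regular
  exists_pow_mul_mem_regular : ∀ s, ∃ N, ∀ n ≥ N, (-coord) ^ n * s ∈ regular
  reflect : K →ₐ[ℂ] K
  reflect_reflect : ∀ s, reflect (reflect s) = s
  int_reflect : ∀ s, int (reflect s) = -int s
  der_reflect : ∀ s, der (reflect s) = -reflect (der s)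

namespace LaurentAlgebra

section

variable {K : Type} [CommRing K] [Algebra ℂ K] [TestAlgebra K]

/-- `s⁽ⁿ⁾ / n!`. -/
noncomputable def dividedDer (n : ℕ) : K →ₗ[ℂ] K :=
  (n.factorial : ℂ)⁻¹ • (der (K := K) : K →ₗ[ℂ] K) ^ n

theorem dividedDer_apply (n : ℕ) (s : K) :
    dividedDer n s = (n.factorial : ℂ)⁻¹ • (der (K := K))^[n] s := by
  rw [dividedDer, LinearMap.smul_apply, Module.End.pow_apply]
  rfl

theorem dividedDer_zero (s : K) : dividedDer 0 s = s := by simp [dividedDer]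

theorem int_iterate_der_mul (n : ℕ) (s t : K) :
    int ((der (K := K))^[n] s * t) = (-1) ^ n * int (s * (der (K := K))^[n] t) := by
  induction n generalizing s with
  | zero => simp
  | succ n ih =>
    rw [Function.iterate_succ_apply, ih, int_der_mul, ← Function.iterate_succ_apply' der n t,
      pow_succ]
    ring

end

variable {K : Type} [CommRing K] [Algebra ℂ K] [TestAlgebra K] [LaurentAlgebra K]

theorem der_neg_coord_pow (n : ℕ) :
    der ((-coord : K) ^ n) = -((n : ℂ) • (-coord) ^ (n - 1)) := by
  rw [Derivation.leibniz_pow, map_neg, der_coord, smul_eq_mul, mul_neg, mul_one, smul_neg,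
    Nat.cast_smul_eq_nsmul]

theorem iterate_der_mem_regular (n : ℕ) {s : K} (hs : s ∈ regular) :
    (der (K := K))^[n] s ∈ regular := by
  induction n with
  | zero => exact hs
  | succ n ih =>
    rw [Function.iterate_succ_apply']
    exact der_mem_regular ih

theorem dividedDer_mem_regular (n : ℕ) {s : K} (hs : s ∈ regular) :
    dividedDer n s ∈ regular := by
  rw [dividedDer_apply]
  exact regular.smul_mem (iterate_der_mem_regular n hs) _

theorem int_mul_eq_zero {s t : K} (hs : s ∈ regular) (ht : t ∈ regular) : int (s * t) = 0 :=
  int_eq_zero_of_mem_regular (regular.mul_mem hs ht)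

theorem finite_pow_mul_notMem_regular (s : K) : {n : ℕ | (-coord) ^ n * s ∉ regular}.Finite := by
  obtain ⟨N, hN⟩ := exists_pow_mul_mem_regular s
  refine (Set.finite_lt_nat N).subset fun n hn => ?_
  by_contra h
  exact hn (hN n (not_lt.1 h))

theorem finite_int_pow_mul_ne_zero (s : K) :
    (Function.support fun n : ℕ => int ((-coord) ^ n * s)).Finite :=
  (finite_pow_mul_notMem_regular s).subset fun _ hn h => hn (int_eq_zero_of_mem_regular h)

/-- The coefficients `⟨(-u)ⁿ s⟩` of the principal part of `s`. -/
noncomputable def principal : K →ₗ[ℂ] ℕ →₀ ℂ where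
  toFun s := Finsupp.ofSupportFinite (fun n => int ((-coord) ^ n * s))
    (finite_int_pow_mul_ne_zero s)
  map_add' s t := by
    ext n
    simp [Finsupp.ofSupportFinite_coe, mul_add]
  map_smul' c s := by
    ext n
    simp [Finsupp.ofSupportFinite_coe]

theorem principal_apply (s : K) (n : ℕ) : principal s n = int ((-coord) ^ n * s) := rfl

theorem principal_zero_apply (s : K) : principal s 0 = int s := by
  rw [principal_apply, pow_zero, one_mul]

theorem principal_eq_zero_iff {s : K} : principal s = 0 ↔ s ∈ regular := by
  refine ⟨fun h => mem_regular_of_int_eq_zero fun n => ?_, fun h => Finsupp.ext fun n => ?_⟩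
  · rw [← principal_apply, h, Finsupp.zero_apply]
  · exact int_mul_eq_zero (regular.pow_mem (regular.neg_mem coord_mem_regular) n) h

/-- Integration by parts: each step's sign is absorbed by (−u)' = −1. For k < n the truncated k − n
is harmless, because the falling factorial vanishes. -/
theorem int_pow_mul_iterate_der (k n : ℕ) (a : K) :
    int ((-coord) ^ k * (der (K := K))^[n] a) =
      k.descFactorial n * int ((-coord) ^ (k - n) * a) := by
  induction n generalizing k with
  | zero => simp
  | succ n ih =>
    rw [Function.iterate_succ_apply', ← neg_eq_iff_eq_neg.2 (int_der_mul _ _),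
      der_neg_coord_pow, neg_mul, map_neg, neg_neg, smul_mul_assoc, map_smul, ih, smul_eq_mul]
    cases k with
    | zero => simp
    | succ k =>
      rw [Nat.succ_descFactorial_succ, Nat.add_sub_cancel, Nat.add_sub_add_right]
      push_cast
      ring

/-- The divided derivatives of an element with principal part 1/u are dual to the powers (−u)ⁿ; this
is the duality of the elliptic bases. -/
theorem principal_dividedDer {a : K} {c : ℂ} (ha : principal a = Finsupp.single 0 c) (n : ℕ) :
    principal (dividedDer n a) = Finsupp.single n c := by
  ext k
  rw [principal_apply, dividedDer_apply, mul_smul_comm, map_smul, int_pow_mul_iterate_der,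
    ← principal_apply, ha, smul_eq_mul]
  rcases lt_trichotomy k n with h | rfl | h
  · rw [Nat.descFactorial_eq_zero_iff_lt.2 h, Finsupp.single_eq_of_ne h.ne]
    simp
  · rw [Nat.descFactorial_self, Nat.sub_self, Finsupp.single_eq_same, Finsupp.single_eq_same]
    have : (k.factorial : ℂ) ≠ 0 := by exact_mod_cast k.factorial_ne_zero
    field_simp
  · rw [Finsupp.single_eq_of_ne (by omega), Finsupp.single_eq_of_ne h.ne']
    simp

/-- The operator `s ↦ ∑ ⟨(-u)ⁿ s⟩ a⁽ⁿ⁾ / n!`. -/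
noncomputable def polarOp (a : K) : K →ₗ[ℂ] K :=
  Finsupp.linearCombination ℂ (fun n => dividedDer n a) ∘ₗ principal

theorem polarOp_apply (a s : K) :
    polarOp a s = (principal s).sum fun n c => c • dividedDer n a := rfl

theorem polarOp_eq_zero (a : K) {s : K} (hs : s ∈ regular) : polarOp a s = 0 := by
  rw [polarOp, LinearMap.comp_apply, principal_eq_zero_iff.2 hs, map_zero]

theorem int_mul_polarOp (t a s : K) :
    int (t * polarOp a s) = (principal s).sum fun n c => c * int (t * dividedDer n a) := by
  rw [polarOp_apply, Finsupp.sum, Finsupp.sum, Finset.mul_sum, map_sum]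
  simp only [mul_smul_comm, map_smul, smul_eq_mul]

theorem int_polarOp_mul (t a s : K) :
    int (polarOp a s * t) = (principal s).sum fun n c => c * int (dividedDer n a * t) := by
  simp only [mul_comm _ t, int_mul_polarOp]

theorem hasSum_polarOp (a s t : K) :
    HasSum (fun n => int (dividedDer n a * t) * int ((-coord) ^ n * s))
      (int (t * polarOp a s)) := by
  have h : HasSum (fun n => principal s n * int (t * dividedDer n a)) _ :=
    hasSum_sum_of_ne_finset_zero (s := (principal s).support) fun n hn => by
      rw [Finsupp.notMem_support_iff.1 hn, zero_mul]
  rw [int_mul_polarOp, Finsupp.sum]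
  refine h.congr_fun fun n => ?_
  rw [mul_comm t, mul_comm, principal_apply]

theorem polarOp_eq_of_principal {a s t : K} (h : principal s = principal t) :
    polarOp a s = polarOp a t := by
  rw [polarOp, LinearMap.comp_apply, h]
  rfl

section

variable {a : K} (ha : principal a = Finsupp.single 0 1)

include ha

/-- Thus `polarOp a` is a projection whose kernel is the regular subalgebra; the choice of a only
affects its image. -/
theorem principal_polarOp (s : K) : principal (polarOp a s) = principal s := by
  rw [polarOp_apply, Finsupp.sum, map_sum]
  simp only [map_smul, principal_dividedDer ha, Finsupp.smul_single, smul_eq_mul, mul_one]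
  exact Finsupp.sum_single _

theorem sub_polarOp_mem_regular (s : K) : s - polarOp a s ∈ regular := by
  rw [← principal_eq_zero_iff, map_sub, principal_polarOp ha, sub_self]

theorem polarOp_polarOp (b s : K) : polarOp b (polarOp a s) = polarOp b s :=
  polarOp_eq_of_principal (principal_polarOp ha s)

/-- Every element is obtained from regular ones and from `a` by linear combinations and
differentiation. -/
theorem induction {p : K → Prop} (hreg : ∀ s ∈ regular, p s) (hinv : p a)
    (hder : ∀ s, p s → p (der s)) (hadd : ∀ s t, p s → p t → p (s + t))
    (hsmul : ∀ (c : ℂ) s, p s → p (c • s)) (s : K) : p s := by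
  have h1 := hreg _ (sub_polarOp_mem_regular ha s)
  have h2 : ∀ n, p ((der (K := K))^[n] a) := fun n => by
    induction n with
    | zero => exact hinv
    | succ n ih =>
      rw [Function.iterate_succ_apply']
      exact hder _ ih
  rw [← sub_add_cancel s (polarOp a s)]
  refine hadd _ _ h1 ?_
  rw [polarOp_apply]
  refine Finset.sum_induction _ p hadd (hreg _ regular.zero_mem) fun n _ => hsmul _ _ ?_
  rw [dividedDer_apply]
  exact hsmul _ _ (h2 n)

end

theorem iterate_der_reflect (n : ℕ) (s : K) :
    (der (K := K))^[n] (reflect s) = (-1 : ℂ) ^ n • reflect ((der (K := K))^[n] s) := by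
  induction n with
  | zero => simp
  | succ n ih =>
    rw [Function.iterate_succ_apply', ih, Function.iterate_succ_apply', Derivation.map_smul,
      der_reflect,
      pow_succ, mul_smul, neg_one_smul]

/-- Reflection changes the sign of the residue. It also moves the n derivatives to the other factor
with the sign (−1)ⁿ, which integration by parts undoes. So the residue equals its own negative. -/
theorem int_reflect_mul_iterate_der (a : K) (n : ℕ) :
    int (reflect a * (der (K := K))^[n] a) = 0 := by
  have h1 := int_reflect (reflect a * (der (K := K))^[n] a)
  have h3 : reflect ((der (K := K))^[n] a) = (-1 : ℂ) ^ n • (der (K := K))^[n] (reflect a) := by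
    rw [iterate_der_reflect, smul_smul, ← mul_pow]
    simp
  rw [map_mul, reflect_reflect, h3, mul_smul_comm, map_smul, mul_comm a, int_iterate_der_mul,
    smul_eq_mul, ← mul_assoc, ← mul_pow] at h1
  simp only [mul_neg, mul_one, neg_neg, one_pow, one_mul] at h1
  exact self_eq_neg.1 h1

theorem int_dividedDer_reflect_mul (a : K) (m n : ℕ) :
    int (dividedDer m (reflect a) * dividedDer n a) = 0 := by
  rw [dividedDer_apply, dividedDer_apply, smul_mul_smul_comm, map_smul, int_iterate_der_mul,
    ← Function.iterate_add_apply, int_reflect_mul_iterate_der, mul_zero, smul_zero]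

/-- The polar operators with the kernels `a(u)` and `-a(-u)` have orthogonal images. -/
theorem int_polarOp_mul_polarOp {a b : K} (h : reflect a = -b) (s t : K) :
    int (polarOp b s * polarOp a t) = 0 := by
  have hb : b = -reflect a := by rw [h, neg_neg]
  rw [int_mul_polarOp, Finsupp.sum]
  refine Finset.sum_eq_zero fun n _ => ?_
  rw [int_polarOp_mul, Finsupp.sum, Finset.sum_eq_zero, mul_zero]
  intro m _
  rw [hb, map_neg, neg_mul, map_neg, int_dividedDer_reflect_mul, neg_zero, mul_zero]

/-- The complementary parts of s and t are regular and hence orthogonal, the polar parts are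
orthogonal by reflection, and expanding the former product gives the claim. -/
theorem polarOp_unitary {a b : K} (ha : principal a = Finsupp.single 0 1)
    (hb : principal b = Finsupp.single 0 1) (h : reflect a = -b) (s t : K) :
    int (s * polarOp a t) + int (polarOp b s * t) = int (s * t) := by
  have h1 := int_mul_eq_zero (sub_polarOp_mem_regular hb s) (sub_polarOp_mem_regular ha t)
  have h2 := int_polarOp_mul_polarOp h s t
  simp only [sub_mul, mul_sub, map_sub] at h1
  linear_combination -h1 + h2

/-- The dependence of `polarOp` on its kernel. -/
theorem exists_int_mul_polarOp (s t : K) : ∃ w, ∀ a, int (t * polarOp a s) = int (a * w) := by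
  refine ⟨(principal s).sum fun n c => c • (-1 : ℂ) ^ n • dividedDer n t, fun a => ?_⟩
  rw [int_mul_polarOp, Finsupp.sum, Finsupp.sum, Finset.mul_sum, map_sum]
  refine Finset.sum_congr rfl fun n _ => ?_
  rw [mul_smul_comm, mul_smul_comm, map_smul, map_smul, smul_eq_mul, smul_eq_mul, mul_comm a,
    dividedDer_apply, dividedDer_apply, smul_mul_assoc, mul_smul_comm, map_smul, map_smul,
    int_iterate_der_mul, smul_eq_mul, smul_eq_mul, mul_left_comm ((-1 : ℂ) ^ n),
    ← mul_assoc ((-1 : ℂ) ^ n), ← mul_pow]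
  simp

/-- If the products `r⁽ᵐ⁾ a⁽ⁿ⁾ / m! n! - δ_{m0} a'⁽ⁿ⁾ / n!` are reproduced by the polar operator
of `a`, then `r`, `a` and `b(u) = -a(-u)` satisfy a trilinear addition theorem. -/
theorem int_polarOp_mul_mul {r a a' b : K} (hb : principal b = Finsupp.single 0 1)
    (h : reflect a = -b) (ha' : a' ∈ regular)
    (hra : ∀ m n, polarOp a (dividedDer m r * dividedDer n a -
        (if m = 0 then 1 else 0 : ℂ) • dividedDer n a') =
      dividedDer m r * dividedDer n a - (if m = 0 then 1 else 0 : ℂ) • dividedDer n a')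
    (w s t : K) :
    int (polarOp r w * polarOp b s * polarOp a t) = int w * int (s * polarOp a' t) := by
  -- The reproduced element lies in the image of `polarOp a`, so it is orthogonal to that of
  -- `polarOp b`. In the subtracted term, `polarOp b s` may be replaced by s, as their difference is
  -- regular and so is a'.
  have key : ∀ m n, int (dividedDer m r * polarOp b s * dividedDer n a) =
      (if m = 0 then 1 else 0) * int (s * dividedDer n a') := fun m n => by
    have h1 := int_polarOp_mul_polarOp h s
      (dividedDer m r * dividedDer n a - (if m = 0 then 1 else 0 : ℂ) • dividedDer n a')
    have h2 := int_mul_eq_zero (sub_polarOp_mem_regular hb s) (dividedDer_mem_regular n ha')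
    rw [hra, mul_sub, map_sub, mul_smul_comm, map_smul, smul_eq_mul] at h1
    rw [sub_mul, map_sub] at h2
    rw [mul_right_comm, mul_comm]
    linear_combination h1 - (if m = 0 then 1 else 0 : ℂ) * h2
  have key2 : ∀ m, int (dividedDer m r * polarOp b s * polarOp a t) =
      (if m = 0 then 1 else 0) * int (s * polarOp a' t) := fun m => by
    rw [int_mul_polarOp, int_mul_polarOp, Finsupp.mul_sum]
    refine Finsupp.sum_congr fun n _ => ?_
    rw [key]
    ring
  rw [mul_assoc, int_polarOp_mul]
  simp only [← mul_assoc, key2]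
  -- Only the simple-pole coefficient of w survives, and it is the residue of w.
  rw [← principal_zero_apply w, Finsupp.sum]
  simp only [mul_ite, mul_one, mul_zero, ite_mul, zero_mul]
  rw [Finset.sum_ite_eq']
  split_ifs with h0
  · rfl
  · rw [Finsupp.notMem_support_iff.1 h0, zero_mul]

end LaurentAlgebra

end EllipticCurrent

namespace EllipticCurrent

open TestAlgebra LaurentAlgebra

/-! ## Elliptic kernels -/

/-- The expression is the numerator of (g'/g)'. For g of order 1, g'/g changes by a constant under u
↦ u + τ, so its derivative is elliptic. -/
theorem IsThetaFunction.log_deriv_deriv {τ mu : ℂ} {g : ℂ → ℂ} (hg : IsThetaFunction τ mu 1 g) :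
    IsThetaFunction τ (mu + mu) 2
      (fun u => deriv (deriv g) u * g u - deriv g u * deriv g u) where
  holomorphic := by
    have h1 := differentiable_deriv hg.holomorphic
    exact ((differentiable_deriv h1).mul hg.holomorphic).sub (h1.mul h1)
  add_one u := by
    have h1 : ∀ u, deriv (deriv g) (u + 1) = (-1) ^ 1 * deriv (deriv g) u := fun u => by
      rw [← deriv_comp_add_const, funext hg.deriv_add_one,
        deriv_const_mul _ (differentiable_deriv hg.holomorphic u)]
    rw [h1, hg.deriv_add_one, hg.add_one]
    ring
  add_tau u := by
    have h1 := differentiable_deriv hg.holomorphic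
    have h2 : deriv (deriv g) (u + τ) = multiplier τ mu 1 u * (deriv (deriv g) u -
        2 * (2 * Real.pi * Complex.I) * deriv g u + (2 * Real.pi * Complex.I) ^ 2 * g u) := by
      rw [← deriv_comp_add_const, funext hg.deriv_add_tau,
        ((hasDerivAt_multiplier τ mu 1 u).fun_mul ((h1 u).hasDerivAt.fun_sub
          ((hg.holomorphic u).hasDerivAt.const_mul _))).deriv]
      push_cast
      ring
    rw [h2, hg.deriv_add_tau, hg.add_tau, show multiplier τ (mu + mu) 2 u = _ from
      (multiplier_mul τ mu mu 1 1 u).symm]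
    push_cast
    ring

/-- The properties of the Taylor expansion `E g a` of an entire function `g` at `a`, as an element
of an algebra of Laurent series. -/
structure IsExpansion {K : Type} [Field K] [Algebra ℂ K] [TestAlgebra K] [LaurentAlgebra K]
    (E : (ℂ → ℂ) → ℂ → K) : Prop where
  add : ∀ {f g}, Differentiable ℂ f → Differentiable ℂ g →
    ∀ a, E (fun u => f u + g u) a = E f a + E g a
  const_mul : ∀ {f}, Differentiable ℂ f → ∀ c a, E (fun u => c * f u) a = c • E f a
  mul : ∀ {f g}, Differentiable ℂ f → Differentiable ℂ g →
    ∀ a, E (fun u => f u * g u) a = E f a * E g a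
  one : ∀ a, E (fun _ => 1) a = 1
  map_deriv : ∀ {f}, Differentiable ℂ f → ∀ a, E (deriv f) a = der (E f a)
  shift : ∀ {f}, Differentiable ℂ f → ∀ a, E (fun u => f (u + a)) 0 = E f a
  reflect_eq : ∀ {f}, Differentiable ℂ f → ∀ a, reflect (E f a) = E (fun u => f (-u)) (-a)
  mem_regular : ∀ {f}, Differentiable ℂ f → ∀ a, E f a ∈ regular
  eq_zero : ∀ {f}, Differentiable ℂ f → E f 0 = 0 → f = 0
  principal_div : ∀ {f g}, Differentiable ℂ f → Differentiable ℂ g → g 0 = 0 → deriv g 0 = 1 →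
    ∀ a, principal (E f a / E g 0) = Finsupp.single 0 (f a)

namespace IsExpansion

variable {K : Type} [Field K] [Algebra ℂ K] [TestAlgebra K] [LaurentAlgebra K]
  {E : (ℂ → ℂ) → ℂ → K} (hE : IsExpansion E)

/-- The expansion of `θ(u + λ) / (θ(u) θ(λ))`. -/
noncomputable def rootKernel (E : (ℂ → ℂ) → ℂ → K) (τ lam : ℂ) : K :=
  (theta τ lam)⁻¹ • (E (theta τ) lam / E (theta τ) 0)

/-- The expansion of `θ'(u) / θ(u)`. -/
noncomputable def cartanKernel (E : (ℂ → ℂ) → ℂ → K) (τ : ℂ) : K :=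
  E (deriv (theta τ)) 0 / E (theta τ) 0

/-- The derivative of `rootKernel` in `lam`. -/
noncomputable def rootKernelDeriv (E : (ℂ → ℂ) → ℂ → K) (τ lam : ℂ) : K :=
  (theta τ lam)⁻¹ • (E (deriv (theta τ)) lam / E (theta τ) 0) -
    (deriv (theta τ) lam / theta τ lam) • rootKernel E τ lam

variable {τ lam mu nu : ℂ} (hτ : 0 < τ.im) (hlam : lam ∉ periodLattice τ)

include hE

theorem sub {f g : ℂ → ℂ} (hf : Differentiable ℂ f) (hg : Differentiable ℂ g) (a : ℂ) :
    E (fun u => f u - g u) a = E f a - E g a := by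
  rw [eq_sub_iff_add_eq, ← hE.add (hf.fun_sub hg) hg]
  simp

theorem neg {f : ℂ → ℂ} (hf : Differentiable ℂ f) (a : ℂ) : E (fun u => -f u) a = -E f a := by
  rw [← neg_one_smul ℂ, ← hE.const_mul hf]
  simp

section

include hτ

theorem theta_expansion_ne_zero : E (theta τ) 0 ≠ 0 := fun h => by
  have hθ := isOddTheta_theta hτ
  have h1 := hθ.deriv_zero
  rw [hE.eq_zero hθ.holomorphic h] at h1
  simp at h1

theorem principal_div_theta {f : ℂ → ℂ} (hf : Differentiable ℂ f) (a : ℂ) :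
    principal (E f a / E (theta τ) 0) = Finsupp.single 0 (f a) :=
  hE.principal_div hf (isOddTheta_theta hτ).holomorphic (theta_zero hτ)
    (isOddTheta_theta hτ).deriv_zero a

theorem principal_rootKernel (h : theta τ lam ≠ 0) :
    principal (rootKernel E τ lam) = Finsupp.single 0 1 := by
  rw [rootKernel, map_smul, hE.principal_div_theta hτ (isOddTheta_theta hτ).holomorphic,
    Finsupp.smul_single, smul_eq_mul, inv_mul_cancel₀ h]

theorem principal_cartanKernel : principal (cartanKernel E τ) = Finsupp.single 0 1 := by
  rw [cartanKernel,
    hE.principal_div_theta hτ (differentiable_deriv (isOddTheta_theta hτ).holomorphic),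
    (isOddTheta_theta hτ).deriv_zero]

/-- The kernel has residue 1 wherever θ(λ) ≠ 0, so its derivative in λ has no pole. -/
theorem rootKernelDeriv_mem_regular (h : theta τ lam ≠ 0) :
    rootKernelDeriv E τ lam ∈ regular := by
  rw [← principal_eq_zero_iff, rootKernelDeriv, map_sub, map_smul, map_smul,
    hE.principal_rootKernel hτ h,
    hE.principal_div_theta hτ (differentiable_deriv (isOddTheta_theta hτ).holomorphic),
    Finsupp.smul_single, Finsupp.smul_single, smul_eq_mul, smul_eq_mul, mul_one, mul_comm,
    ← div_eq_mul_inv, sub_self]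

theorem reflect_theta (a : ℂ) : reflect (E (theta τ) a) = -E (theta τ) (-a) := by
  have hθ := isOddTheta_theta hτ
  rw [hE.reflect_eq hθ.holomorphic, funext hθ.odd, hE.neg hθ.holomorphic]

theorem reflect_rootKernel : reflect (rootKernel E τ lam) = -rootKernel E τ (-lam) := by
  rw [rootKernel, rootKernel, map_smul, map_div₀, hE.reflect_theta hτ, hE.reflect_theta hτ,
    neg_zero, neg_div_neg_eq, (isOddTheta_theta hτ).odd, inv_neg, neg_smul, neg_neg]

theorem reflect_cartanKernel : reflect (cartanKernel E τ) = -cartanKernel E τ := by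
  have hθ := isOddTheta_theta hτ
  have h : ∀ u, deriv (theta τ) (-u) = deriv (theta τ) u := fun u => by
    have := deriv_comp_neg (theta τ) u
    rw [funext hθ.odd, deriv.fun_neg] at this
    exact (neg_injective this).symm
  rw [cartanKernel, map_div₀, hE.reflect_theta hτ,
    hE.reflect_eq (differentiable_deriv hθ.holomorphic), funext h, neg_zero, div_neg]

/-- The relation between the three kernels. -/
theorem cartanKernel_mul_rootKernel :
    cartanKernel E τ * rootKernel E τ lam = rootKernelDeriv E τ lam - der (rootKernel E τ lam) +
      (deriv (theta τ) lam / theta τ lam) • rootKernel E τ lam := by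
  have hθ := (isOddTheta_theta hτ).holomorphic
  have hT := hE.theta_expansion_ne_zero hτ
  -- The term θ'(u + λ)/(θ(u)θ(λ)) occurs in both the u-derivative and the λ-derivative of the
  -- kernel; eliminating it yields the relation.
  have h : der (rootKernel E τ lam) = (theta τ lam)⁻¹ •
      (E (deriv (theta τ)) lam / E (theta τ) 0) - cartanKernel E τ * rootKernel E τ lam := by
    rw [rootKernel, cartanKernel, Derivation.map_smul, Derivation.leibniz_div, ← hE.map_deriv hθ,
      ← hE.map_deriv hθ, mul_smul_comm, ← smul_sub, smul_eq_mul, smul_eq_mul, smul_eq_mul]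
    congr 1
    field_simp
  rw [h, rootKernelDeriv]
  ring

/-- Differentiability is checked on generators of the Laurent series: regular w give 0, w = 1/θ
gives g(l) itself, and a derivative of w is moved onto g. The induction therefore has to run over
all g. -/
theorem hasDerivAt_int_mul {g : ℂ → ℂ} (hg : Differentiable ℂ g) (w : K) (a : ℂ) :
    HasDerivAt (fun l => int (E g l * w)) (int (E (deriv g) a * w)) a := by
  have h1 : principal (E (fun _ => 1) 0 / E (theta τ) 0) = Finsupp.single 0 1 :=
    hE.principal_div_theta hτ (differentiable_const 1) 0
  induction w using LaurentAlgebra.induction h1 generalizing g with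
  | hreg s hs =>
    simp only [int_mul_eq_zero (hE.mem_regular hg _) hs,
      int_mul_eq_zero (hE.mem_regular (differentiable_deriv hg) _) hs]
    exact hasDerivAt_const a 0
  | hinv =>
    have h2 : ∀ {g : ℂ → ℂ} (hg : Differentiable ℂ g) (l : ℂ),
        int (E g l * (E (fun _ => 1) 0 / E (theta τ) 0)) = g l := fun hg l => by
      rw [hE.one, ← mul_div_assoc, mul_one, ← principal_zero_apply, hE.principal_div_theta hτ hg,
        Finsupp.single_eq_same]
    simp only [h2 hg, h2 (differentiable_deriv hg)]
    exact (hg a).hasDerivAt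
  | hder s ih =>
    have h2 : ∀ {g : ℂ → ℂ} (hg : Differentiable ℂ g) (l : ℂ),
        int (E g l * der s) = -int (E (deriv g) l * s) := fun hg l => by
      rw [hE.map_deriv hg, int_der_mul, neg_neg]
    simp only [h2 hg, h2 (differentiable_deriv hg)]
    exact (ih (differentiable_deriv hg)).neg
  | hadd s t hs ht =>
    simp only [mul_add, map_add]
    exact (hs hg).add (ht hg)
  | hsmul c s hs =>
    simp only [mul_smul_comm, map_smul]
    exact (hs hg).const_smul c

theorem hasDerivAt_int_rootKernel_mul (h : theta τ lam ≠ 0) (w : K) :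
    HasDerivAt (fun l => int (rootKernel E τ l * w)) (int (rootKernelDeriv E τ lam * w)) lam := by
  have hθ := (isOddTheta_theta hτ).holomorphic
  have h1 := ((hθ lam).hasDerivAt.fun_inv h).fun_mul
    (hE.hasDerivAt_int_mul hτ hθ (w / E (theta τ) 0) lam)
  refine (h1.congr_deriv ?_).congr_of_eventuallyEq (Filter.Eventually.of_forall fun l => ?_)
  · rw [rootKernelDeriv, rootKernel, sub_mul, map_sub]
    simp only [smul_mul_assoc, map_smul, smul_eq_mul, div_mul_eq_mul_div, mul_div_assoc]
    field_simp
    ring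
  · simp only [rootKernel, smul_mul_assoc, map_smul, smul_eq_mul, div_mul_eq_mul_div,
      mul_div_assoc]

end

/-- The expansions of quotients `g / θ ^ N` of theta functions with character `mu`. -/
noncomputable def quotients (τ mu : ℂ) (hτ : 0 < τ.im) : Submodule ℂ K where
  carrier := {s | ∃ N g, IsThetaFunction τ mu N g ∧ s * E (theta τ) 0 ^ N = E g 0}
  zero_mem' := ⟨0, fun _ => 0, by
    refine ⟨differentiable_const 0, by simp, by simp⟩, by
    have := hE.const_mul (differentiable_const 1) 0 0
    simp only [zero_mul, zero_smul] at this
    rw [this, zero_mul]⟩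
  add_mem' := by
    have hθ := isThetaFunction_theta hτ
    -- Multiplying by θ, whose character is 0, raises the order of the denominator, so two quotients
    -- can be brought to a common one.
    have key : ∀ {N g} (k : ℕ) {s : K}, IsThetaFunction τ mu N g → s * E (theta τ) 0 ^ N = E g 0 →
        ∃ g', IsThetaFunction τ mu (N + k) g' ∧ s * E (theta τ) 0 ^ (N + k) = E g' 0 := by
      intro N g k s hg h
      induction k with
      | zero => exact ⟨g, hg, h⟩
      | succ k ih =>
        obtain ⟨g', hg', h'⟩ := ih
        refine ⟨fun u => g' u * theta τ u, by simpa [← add_assoc] using hg'.mul hθ, ?_⟩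
        rw [hE.mul hg'.holomorphic hθ.holomorphic, ← h']
        ring
    rintro s t ⟨M, f, hf, hs⟩ ⟨N, g, hg, ht⟩
    obtain ⟨f', hf', hs'⟩ := key N hf hs
    obtain ⟨g', hg', ht'⟩ := key M hg ht
    rw [add_comm N M] at hg' ht'
    refine ⟨M + N, _, hf'.add hg', ?_⟩
    rw [add_mul, hs', ht', hE.add hf'.holomorphic hg'.holomorphic]
  smul_mem' := by
    rintro c s ⟨N, g, hg, hs⟩
    refine ⟨N, _, hg.const_mul c, ?_⟩
    rw [smul_mul_assoc, hs, hE.const_mul hg.holomorphic]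

variable {hE} {hτ}

theorem mul_mem_quotients {s t : K} (hs : s ∈ hE.quotients τ mu hτ)
    (ht : t ∈ hE.quotients τ nu hτ) :
    s * t ∈ hE.quotients τ (mu + nu) hτ := by
  obtain ⟨M, f, hf, hs⟩ := hs
  obtain ⟨N, g, hg, ht⟩ := ht
  refine ⟨M + N, _, hf.mul hg, ?_⟩
  rw [hE.mul hf.holomorphic hg.holomorphic, ← hs, ← ht]
  ring

theorem der_mem_quotients {s : K} (hs : s ∈ hE.quotients τ mu hτ) :
    der s ∈ hE.quotients τ mu hτ := by
  obtain ⟨N, g, hg, hs⟩ := hs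
  have hθ := isThetaFunction_theta hτ
  refine ⟨N + 1, _, by simpa using hg.wronskian hθ, ?_⟩
  have h1 := congrArg der hs
  rw [Derivation.leibniz, Derivation.leibniz_pow, ← hE.map_deriv hg.holomorphic,
    ← hE.map_deriv hθ.holomorphic] at h1
  have h2 : E (fun u => N * g u * deriv (theta τ) u) 0 = N * E g 0 * E (deriv (theta τ)) 0 := by
    rw [hE.mul (hg.holomorphic.const_mul _) (differentiable_deriv hθ.holomorphic),
      hE.const_mul hg.holomorphic, Algebra.smul_def, map_natCast]
  rw [hE.sub ((differentiable_deriv hg.holomorphic).fun_mul hθ.holomorphic)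
    ((hg.holomorphic.const_mul _).fun_mul (differentiable_deriv hθ.holomorphic)),
    hE.mul (differentiable_deriv hg.holomorphic) hθ.holomorphic, h2, ← h1, ← hs]
  simp only [smul_eq_mul, nsmul_eq_mul]
  -- The rule for the derivative of θ ^ N contains the truncated exponent N − 1, so N = 0 is treated
  -- apart.
  cases N with
  | zero => simp
  | succ N =>
    rw [Nat.add_sub_cancel]
    ring

theorem iterate_der_mem_quotients (n : ℕ) {s : K} (hs : s ∈ hE.quotients τ mu hτ) :
    (der (K := K))^[n] s ∈ hE.quotients τ mu hτ := by
  induction n with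
  | zero => exact hs
  | succ n ih =>
    rw [Function.iterate_succ_apply']
    exact der_mem_quotients ih

theorem dividedDer_mem_quotients (n : ℕ) {s : K} (hs : s ∈ hE.quotients τ mu hτ) :
    dividedDer n s ∈ hE.quotients τ mu hτ := by
  rw [dividedDer_apply]
  exact Submodule.smul_mem _ _ (iterate_der_mem_quotients n hs)

theorem rootKernel_mem_quotients : rootKernel E τ lam ∈ hE.quotients τ lam hτ := by
  have hθ := isThetaFunction_theta_shift hτ lam
  refine Submodule.smul_mem _ _ ⟨1, _, hθ, ?_⟩
  rw [pow_one, div_mul_cancel₀ _ (hE.theta_expansion_ne_zero hτ),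
    hE.shift (isOddTheta_theta hτ).holomorphic]

theorem der_cartanKernel_mem_quotients : der (cartanKernel E τ) ∈ hE.quotients τ 0 hτ := by
  have hθ := isThetaFunction_theta hτ
  have h1 := differentiable_deriv hθ.holomorphic
  have hT := hE.theta_expansion_ne_zero hτ
  refine ⟨2, _, by simpa using hθ.log_deriv_deriv, ?_⟩
  rw [hE.sub ((differentiable_deriv h1).fun_mul hθ.holomorphic) (h1.fun_mul h1), hE.mul h1 h1,
    hE.mul (differentiable_deriv h1) hθ.holomorphic, cartanKernel, Derivation.leibniz_div,
    ← hE.map_deriv h1, ← hE.map_deriv hθ.holomorphic, smul_eq_mul, smul_eq_mul, smul_eq_mul]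
  field_simp

/-- If s θ^{N+1} = g with s regular, then g/θ has no pole at 0, so g(0) = 0 and g is divisible by θ.
Descending to N = 0 leaves an entire function with constant, nontrivial multipliers, which is zero.
-/
theorem eq_zero_of_mem_quotients (hmu : mu ∉ periodLattice τ) {s : K}
    (hs : s ∈ hE.quotients τ mu hτ) (hreg : s ∈ regular) : s = 0 := by
  obtain ⟨N, g, hg, h⟩ := hs
  have hT := hE.theta_expansion_ne_zero hτ
  have hθ := (isOddTheta_theta hτ).holomorphic
  induction N generalizing g with
  | zero =>
    rw [pow_zero, mul_one, hg.eq_zero_of_order_zero hτ hmu] at h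
    rw [h]
    have := hE.const_mul (differentiable_const 1) 0 0
    simp only [zero_mul, zero_smul] at this
    exact this
  | succ N ih =>
    have h1 := hE.principal_div_theta hτ hg.holomorphic 0
    rw [← h, pow_succ, ← mul_assoc, mul_div_cancel_right₀ _ hT, principal_eq_zero_iff.2
      (regular.mul_mem hreg (regular.pow_mem (hE.mem_regular hθ 0) N)), eq_comm,
      Finsupp.single_eq_zero] at h1
    obtain ⟨k, hk, hgk⟩ := hg.exists_quotient hτ h1
    refine ih k hk (mul_right_cancel₀ hT ?_)
    rw [← hE.mul hk.holomorphic hθ, ← funext hgk, ← h, pow_succ, mul_assoc]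

/-- The difference with the polar part is regular and has the same multipliers, so it vanishes: such
a function is determined by its principal part. -/
theorem polarOp_rootKernel_of_mem_quotients (hlam : lam ∉ periodLattice τ) {s : K}
    (hs : s ∈ hE.quotients τ lam hτ) : polarOp (rootKernel E τ lam) s = s := by
  refine (sub_eq_zero.1 (eq_zero_of_mem_quotients hlam (Submodule.sub_mem _ hs ?_)
    (sub_polarOp_mem_regular (hE.principal_rootKernel hτ (theta_ne_zero hτ hlam)) s))).symm
  rw [polarOp_apply]
  exact Submodule.sum_mem _ fun n _ => Submodule.smul_mem _ _
    (dividedDer_mem_quotients n rootKernel_mem_quotients)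

/-- θ'/θ is not elliptic, but its additive constant under u ↦ u + τ is compensated by ∂/∂λ of the
root kernel. The case n = 0 is `cartanKernel_mul_rootKernel`; differentiation adds only products of
(θ'/θ)' with derivatives of the root kernel. -/
theorem cartanKernel_mul_sub_mem_quotients (n : ℕ) :
    cartanKernel E τ * (der (K := K))^[n] (rootKernel E τ lam) -
      (der (K := K))^[n] (rootKernelDeriv E τ lam) ∈ hE.quotients τ lam hτ := by
  have hr : rootKernel E τ lam ∈ hE.quotients τ lam hτ := rootKernel_mem_quotients
  induction n with
  | zero =>
    have h : cartanKernel E τ * rootKernel E τ lam - rootKernelDeriv E τ lam =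
        (deriv (theta τ) lam / theta τ lam) • rootKernel E τ lam - der (rootKernel E τ lam) := by
      rw [hE.cartanKernel_mul_rootKernel hτ]
      ring
    rw [Function.iterate_zero_apply, Function.iterate_zero_apply, h]
    exact Submodule.sub_mem _ (Submodule.smul_mem _ _ hr) (der_mem_quotients hr)
  | succ n ih =>
    have h1 := der_mem_quotients ih
    have h2 := mul_mem_quotients (der_cartanKernel_mem_quotients (hE := hE) (hτ := hτ))
      (iterate_der_mem_quotients n hr)
    rw [zero_add] at h2
    rw [Function.iterate_succ_apply', Function.iterate_succ_apply']
    have h3 := Submodule.sub_mem _ h1 h2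
    rw [map_sub, Derivation.leibniz, smul_eq_mul, smul_eq_mul] at h3
    convert h3 using 1
    ring

theorem dividedDer_mul_sub_mem_quotients (m n : ℕ) :
    dividedDer m (cartanKernel E τ) * dividedDer n (rootKernel E τ lam) -
      (if m = 0 then 1 else 0 : ℂ) • dividedDer n (rootKernelDeriv E τ lam) ∈
        hE.quotients τ lam hτ := by
  cases m with
  | zero =>
    rw [dividedDer_zero, if_pos rfl, one_smul, dividedDer_apply, dividedDer_apply, mul_smul_comm,
      ← smul_sub]
    exact Submodule.smul_mem _ _ (cartanKernel_mul_sub_mem_quotients n)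
  | succ m =>
    rw [if_neg (Nat.succ_ne_zero m), zero_smul, sub_zero, ← zero_add lam]
    refine mul_mem_quotients ?_ (dividedDer_mem_quotients n (by
      rw [zero_add]
      exact rootKernel_mem_quotients))
    -- Once at least one derivative falls on θ'/θ, that factor is elliptic and no correction is
    -- needed.
    rw [dividedDer_apply, Function.iterate_succ_apply]
    exact Submodule.smul_mem _ _ (iterate_der_mem_quotients m der_cartanKernel_mem_quotients)

end IsExpansion

end EllipticCurrent

namespace EllipticCurrent

open TestAlgebra LaurentAlgebra

/-! ## Laurent series -/

namespace K0

theorem coeff_der (s : K0) (k : ℤ) : (der s).coeff k = (k + 1) * s.coeff (k + 1) := by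
  change (LaurentSeries.derivative ℂ s).coeff k = _
  simp [LaurentSeries.derivative]

theorem coeff_smul' (c : ℂ) (s : K0) (k : ℤ) : (c • s).coeff k = c * s.coeff k :=
  HahnSeries.coeff_smul

theorem coeff_neg_uCoord_pow_mul (n : ℕ) (s : K0) (k : ℤ) :
    ((-uCoord) ^ n * s).coeff k = (-1) ^ n * s.coeff (k - n) := by
  have h : (-uCoord) ^ n = HahnSeries.single (n : ℤ) ((-1 : ℂ) ^ n) := by
    rw [uCoord, ← HahnSeries.single_neg, HahnSeries.single_pow, nsmul_one]
  rw [h, HahnSeries.coeff_single_mul]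

theorem der_uCoord : der uCoord = 1 := by
  ext k
  rw [coeff_der, uCoord, HahnSeries.coeff_single, HahnSeries.coeff_one]
  split_ifs with h1 h2 h2
  · simp [h2]
  · omega
  · omega
  · simp

theorem exists_ofPowerSeries_eq_iff {s : K0} :
    (∃ p, HahnSeries.ofPowerSeries ℤ ℂ p = s) ↔ ∀ k < 0, s.coeff k = 0 := by
  constructor
  · rintro ⟨p, rfl⟩ k hk
    rw [PowerSeries.coeff_coe, if_pos hk]
  · intro h
    refine ⟨PowerSeries.mk fun n => s.coeff n, ?_⟩
    ext k
    rw [PowerSeries.coeff_coe]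
    split_ifs with hk
    · exact (h k hk).symm
    · rw [PowerSeries.coeff_mk, Int.natAbs_of_nonneg (not_lt.1 hk)]

/-- The subalgebra `ℂ[[u]]` of `K₀`. -/
noncomputable def powerSeries : Subalgebra ℂ K0 where
  carrier := {s | ∃ p, HahnSeries.ofPowerSeries ℤ ℂ p = s}
  mul_mem' := by
    rintro _ _ ⟨p, rfl⟩ ⟨q, rfl⟩
    exact ⟨p * q, map_mul _ _ _⟩
  add_mem' := by
    rintro _ _ ⟨p, rfl⟩ ⟨q, rfl⟩
    exact ⟨p + q, map_add _ _ _⟩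
  algebraMap_mem' c := by
    refine exists_ofPowerSeries_eq_iff.2 fun k hk => ?_
    rw [Algebra.algebraMap_eq_smul_one]
    refine (coeff_smul' _ _ _).trans ?_
    rw [HahnSeries.coeff_one, if_neg hk.ne, mul_zero]

theorem mem_powerSeries_iff {s : K0} : s ∈ powerSeries ↔ ∀ k < 0, s.coeff k = 0 :=
  exists_ofPowerSeries_eq_iff

/-- The series `s(-u)`. -/
noncomputable def compNeg (s : K0) : K0 :=
  ⟨fun k => (-1) ^ k * s.coeff k, s.isPWO_support.mono fun k hk h => hk (by simp [h])⟩

theorem coeff_compNeg (s : K0) (k : ℤ) : (compNeg s).coeff k = (-1) ^ k * s.coeff k := rfl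

theorem support_compNeg_subset (s : K0) : (compNeg s).support ⊆ s.support :=
  fun k hk h => hk (by simp [coeff_compNeg, h])

theorem compNeg_mul (s t : K0) : compNeg (s * t) = compNeg s * compNeg t := by
  ext k
  have h : t.support ⊆ (compNeg t).support := fun k hk =>
    mul_ne_zero (zpow_ne_zero k (by norm_num)) hk
  rw [coeff_compNeg, HahnSeries.coeff_mul_left' s.isPWO_support (support_compNeg_subset s),
    HahnSeries.coeff_mul_right' (compNeg t).isPWO_support h, Finset.mul_sum]
  refine Finset.sum_congr rfl fun p hp => ?_
  rw [coeff_compNeg, coeff_compNeg, ← (Finset.mem_antidiagonal.mp hp).2.2,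
    zpow_add₀ (by norm_num : (-1 : ℂ) ≠ 0)]
  ring

noncomputable instance : LaurentAlgebra K0 where
  coord := uCoord
  der_coord := der_uCoord
  regular := powerSeries
  coord_mem_regular := ⟨_, HahnSeries.ofPowerSeries_X⟩
  der_mem_regular {s} hs := by
    rw [mem_powerSeries_iff] at *
    intro k hk
    rw [coeff_der]
    rcases (Int.lt_iff_add_one_le.1 hk).lt_or_eq with h | h
    · rw [hs _ h, mul_zero]
    · have : (k : ℂ) + 1 = 0 := by exact_mod_cast h
      rw [this, zero_mul]
  int_eq_zero_of_mem_regular hs := mem_powerSeries_iff.1 hs _ (by norm_num)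
  mem_regular_of_int_eq_zero {s} h := by
    refine mem_powerSeries_iff.2 fun k hk => ?_
    -- Up to sign, the coefficient of u^k with k < 0 is the residue of (−u)^{−1−k} s.
    have h1 := h (-1 - k).toNat
    change ((-uCoord) ^ _ * s).coeff (-1) = 0 at h1
    rw [coeff_neg_uCoord_pow_mul, Int.toNat_of_nonneg (by omega), sub_sub_cancel] at h1
    exact (mul_eq_zero.1 h1).resolve_left (pow_ne_zero _ (by norm_num))
  exists_pow_mul_mem_regular s := by
    refine ⟨(-s.order).toNat, fun n hn => mem_powerSeries_iff.2 fun k hk => ?_⟩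
    rw [coeff_neg_uCoord_pow_mul, HahnSeries.coeff_eq_zero_of_lt_order (by omega), mul_zero]
  reflect :=
    { toFun := compNeg
      map_one' := by
        ext k
        rw [coeff_compNeg, HahnSeries.coeff_one]
        split_ifs with h <;> simp [h]
      map_mul' := compNeg_mul
      map_zero' := by
        ext k
        simp [coeff_compNeg]
      map_add' := fun s t => by
        ext k
        simp [coeff_compNeg, mul_add]
      commutes' := fun c => by
        ext k
        rw [coeff_compNeg, Algebra.algebraMap_eq_smul_one, mul_comm]
        refine (congrArg (· * _) (coeff_smul' _ _ _)).trans (Eq.trans ?_ (coeff_smul' _ _ _).symm)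
        rw [HahnSeries.coeff_one]
        split_ifs with h <;> simp [h] }
  reflect_reflect s := by
    ext k
    change (-1) ^ k * ((-1) ^ k * s.coeff k) = _
    rw [← mul_assoc, ← mul_zpow]
    simp
  int_reflect s := by
    change (-1) ^ (-1 : ℤ) * s.coeff (-1) = -s.coeff (-1)
    norm_num
  der_reflect s := by
    ext k
    rw [coeff_der, HahnSeries.coeff_neg]
    change _ * ((-1) ^ (k + 1) * s.coeff (k + 1)) = -((-1) ^ k * (der s).coeff k)
    rw [coeff_der, zpow_add₀ (by norm_num : (-1 : ℂ) ≠ 0)]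
    ring

/-! ### Taylor expansions -/

/-- The Taylor expansion as a power series. -/
noncomputable def taylorPowerSeries (g : ℂ → ℂ) (a : ℂ) : PowerSeries ℂ :=
  PowerSeries.mk fun n => iteratedDeriv n g a / n.factorial

theorem taylor_def (g : ℂ → ℂ) (a : ℂ) :
    taylor g a = HahnSeries.ofPowerSeries ℤ ℂ (taylorPowerSeries g a) := rfl

theorem coeff_taylor_natCast (g : ℂ → ℂ) (a : ℂ) (n : ℕ) :
    (taylor g a).coeff n = iteratedDeriv n g a / n.factorial := by
  rw [taylor, LaurentSeries.coeff_coe_powerSeries, PowerSeries.coeff_mk]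

theorem coeff_taylor_of_neg (f : ℂ → ℂ) (a : ℂ) {k : ℤ} (hk : k < 0) :
    (taylor f a).coeff k = 0 :=
  mem_powerSeries_iff.1 ⟨taylorPowerSeries f a, rfl⟩ k hk

theorem taylor_congr {f : ℂ → ℂ} {s : K0} {a : ℂ} (hs : ∀ k < 0, s.coeff k = 0)
    (h : ∀ n : ℕ, iteratedDeriv n f a / n.factorial = s.coeff n) : taylor f a = s := by
  ext k
  rcases lt_or_ge k 0 with hk | hk
  · rw [hs k hk, coeff_taylor_of_neg f a hk]
  · lift k to ℕ using hk
    rw [coeff_taylor_natCast, h]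

theorem coeff_uCoord_inv_mul (s : K0) : (uCoord⁻¹ * s).coeff (-1) = s.coeff 0 := by
  have h : uCoord⁻¹ = HahnSeries.single (-1 : ℤ) (1 : ℂ) := by
    refine inv_eq_of_mul_eq_one_right ?_
    rw [uCoord, HahnSeries.single_mul_single]
    simp
  rw [h, HahnSeries.coeff_single_mul, one_mul]
  simp

theorem principal_uCoord_inv_mul (p : PowerSeries ℂ) :
    principal (uCoord⁻¹ * HahnSeries.ofPowerSeries ℤ ℂ p : K0) =
      Finsupp.single 0 (PowerSeries.constantCoeff p) := by
  have hu : uCoord ≠ 0 := HahnSeries.single_ne_zero one_ne_zero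
  ext n
  rw [principal_apply]
  change int ((-uCoord) ^ n * (uCoord⁻¹ * _)) = _
  cases n with
  | zero =>
    rw [pow_zero, one_mul, Finsupp.single_eq_same]
    refine (coeff_uCoord_inv_mul _).trans ?_
    rw [← PowerSeries.coeff_zero_eq_constantCoeff_apply]
    exact LaurentSeries.coeff_coe_powerSeries p 0
  | succ n =>
    rw [Finsupp.single_eq_of_ne (Nat.succ_ne_zero n)]
    have h : (-uCoord) ^ (n + 1) * (uCoord⁻¹ * HahnSeries.ofPowerSeries ℤ ℂ p) =
        -((-uCoord) ^ n * HahnSeries.ofPowerSeries ℤ ℂ p) := by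
      rw [pow_succ]
      field_simp
    rw [h]
    exact int_eq_zero_of_mem_regular (neg_mem (mul_mem (pow_mem (neg_mem
      (coord_mem_regular : uCoord ∈ powerSeries)) n) (⟨p, rfl⟩ : _ ∈ powerSeries)))

/-- The denominator is u q with q(0) = 1, so the quotient is u⁻¹ times a power series with constant
term f(a). -/
theorem principal_taylor_div {f g : ℂ → ℂ} (h0 : g 0 = 0) (h1 : deriv g 0 = 1) (a : ℂ) :
    principal (taylor f a / taylor g 0) = Finsupp.single 0 (f a) := by
  obtain ⟨q, hq⟩ : ∃ q, taylorPowerSeries g 0 = PowerSeries.X * q := by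
    refine PowerSeries.X_dvd_iff.2 ?_
    simp [taylorPowerSeries, h0]
  have hq1 : PowerSeries.constantCoeff q = 1 := by
    have := congrArg (PowerSeries.coeff 1) hq
    simpa [taylorPowerSeries, h1, PowerSeries.coeff_succ_X_mul, eq_comm] using this
  have hq2 : q * q⁻¹ = 1 := PowerSeries.mul_inv_cancel q (by simp [hq1])
  have h2 : taylor f a / taylor g 0 =
      uCoord⁻¹ * HahnSeries.ofPowerSeries ℤ ℂ (taylorPowerSeries f a * q⁻¹) := by
    have h3 : HahnSeries.ofPowerSeries ℤ ℂ q * HahnSeries.ofPowerSeries ℤ ℂ q⁻¹ = 1 := by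
      rw [← map_mul, hq2, map_one]
    have h4 : HahnSeries.ofPowerSeries ℤ ℂ q ≠ 0 := left_ne_zero_of_mul (h3 ▸ one_ne_zero)
    have hu : uCoord ≠ 0 := HahnSeries.single_ne_zero one_ne_zero
    rw [taylor_def, taylor_def, hq, map_mul, map_mul, HahnSeries.ofPowerSeries_X, ← uCoord,
      div_eq_iff (mul_ne_zero hu h4)]
    field_simp
    rw [mul_assoc, mul_comm (HahnSeries.ofPowerSeries ℤ ℂ q⁻¹), h3, mul_one]
  rw [h2, principal_uCoord_inv_mul]
  simp [hq1, taylorPowerSeries]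

theorem taylor_mul {f g : ℂ → ℂ} (hf : Differentiable ℂ f) (hg : Differentiable ℂ g) (a : ℂ) :
    taylor (fun u => f u * g u) a = taylor f a * taylor g a := by
  rw [taylor_def, taylor_def, taylor_def, ← map_mul]
  congr 1
  ext n
  rw [PowerSeries.coeff_mul, taylorPowerSeries, PowerSeries.coeff_mk,
    iteratedDeriv_fun_mul hf.contDiff.contDiffAt hg.contDiff.contDiffAt,
    Finset.Nat.sum_antidiagonal_eq_sum_range_succ_mk, Finset.sum_div]
  refine Finset.sum_congr rfl fun k hk => ?_
  have hk' : k ≤ n := Nat.lt_succ_iff.1 (Finset.mem_range.1 hk)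
  have h1 : (n.choose k * k.factorial * (n - k).factorial : ℂ) = n.factorial := by
    exact_mod_cast Nat.choose_mul_factorial_mul_factorial hk'
  have h2 : (n.choose k : ℂ) ≠ 0 := by exact_mod_cast (Nat.choose_pos hk').ne'
  have h3 : (k.factorial : ℂ) ≠ 0 := by exact_mod_cast k.factorial_ne_zero
  have h4 : ((n - k).factorial : ℂ) ≠ 0 := by exact_mod_cast (n - k).factorial_ne_zero
  simp only [taylorPowerSeries, PowerSeries.coeff_mk]
  rw [← h1]
  field_simp

theorem isExpansion_taylor : IsExpansion taylor where
  add {f g} hf hg a := by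
    refine taylor_congr (fun k hk => ?_) fun n => ?_
    · rw [HahnSeries.coeff_add, coeff_taylor_of_neg _ _ hk, coeff_taylor_of_neg _ _ hk, add_zero]
    · rw [HahnSeries.coeff_add, coeff_taylor_natCast, coeff_taylor_natCast,
        iteratedDeriv_fun_add hf.contDiff.contDiffAt hg.contDiff.contDiffAt, add_div]
  const_mul {f} hf c a := by
    refine taylor_congr (fun k hk => ?_) fun n => ?_
    · refine (coeff_smul' _ _ _).trans ?_
      rw [coeff_taylor_of_neg _ _ hk, mul_zero]
    · refine Eq.trans ?_ (coeff_smul' _ _ _).symm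
      rw [coeff_taylor_natCast, iteratedDeriv_const_mul_field, mul_div_assoc]
  mul := taylor_mul
  one a := by
    refine taylor_congr (fun k hk => ?_) fun n => ?_
    · rw [HahnSeries.coeff_one, if_neg hk.ne]
    · rw [HahnSeries.coeff_one, iteratedDeriv_const]
      rcases eq_or_ne n 0 with rfl | hn <;> simp [*]
  map_deriv {f} hf a := by
    refine taylor_congr (fun k hk => ?_) fun n => ?_
    · rw [coeff_der]
      rcases (Int.lt_iff_add_one_le.1 hk).lt_or_eq with h | h
      · rw [coeff_taylor_of_neg _ _ h, mul_zero]
      · have : (k : ℂ) + 1 = 0 := by exact_mod_cast h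
        rw [this, zero_mul]
    · rw [coeff_der]
      have h := coeff_taylor_natCast f a (n + 1)
      push_cast at h
      rw [h, ← iteratedDeriv_succ', Nat.factorial_succ]
      have h3 : (n.factorial : ℂ) ≠ 0 := by exact_mod_cast n.factorial_ne_zero
      have h4 : (n : ℂ) + 1 ≠ 0 := Nat.cast_add_one_ne_zero n
      push_cast
      field_simp
  shift {f} hf a := by
    refine taylor_congr (fun k hk => coeff_taylor_of_neg _ _ hk) fun n => ?_
    rw [coeff_taylor_natCast, iteratedDeriv_comp_add_const]
    simp
  reflect_eq {f} hf a := by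
    refine (taylor_congr (s := compNeg (taylor f a)) (fun k hk => ?_) fun n => ?_).symm
    · rw [coeff_compNeg, coeff_taylor_of_neg _ _ hk, mul_zero]
    · rw [coeff_compNeg, coeff_taylor_natCast, iteratedDeriv_comp_neg, neg_neg, smul_eq_mul,
        mul_div_assoc, zpow_natCast]
  mem_regular _ _ := ⟨_, rfl⟩
  eq_zero {f} hf h := by
    funext u
    rw [← Complex.taylorSeries_eq_of_entire' 0 u hf, Pi.zero_apply]
    have h1 : ∀ n : ℕ, (n.factorial : ℂ)⁻¹ * iteratedDeriv n f 0 = 0 := fun n => by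
      rw [mul_comm, ← div_eq_mul_inv, ← coeff_taylor_natCast, h, HahnSeries.coeff_zero]
    simp [h1]
  principal_div _ _ h0 h1 a := principal_taylor_div h0 h1 a

theorem int_separating (s : K0) (h : ∀ t, int (s * t) = 0) : s = 0 := by
  by_contra hs
  -- Laurent series form a field, and the test element u⁻¹/s makes the residue equal to 1.
  have h1 := h (s⁻¹ * (uCoord⁻¹ * 1))
  rw [mul_inv_cancel_left₀ hs] at h1
  have h2 := (coeff_uCoord_inv_mul 1).symm.trans h1
  simp at h2

end K0

end EllipticCurrent

namespace EllipticCurrent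

open TestAlgebra LaurentAlgebra

/-! ## The universal r-matrix of `e_τ(sl₂^)` -/

theorem hasSum_EIndex {f : EIndex → ℂ} {a b c : ℂ} (ha : HasSum (fun n => f (.hh n)) a)
    (hb : HasSum (fun n => f (.fe n)) b) (hc : HasSum (fun n => f (.ef n)) c) :
    HasSum f (a + b + c + f .cd) := by
  have e1 : Function.Injective EIndex.hh := fun _ _ h => EIndex.hh.inj h
  have e2 : Function.Injective EIndex.fe := fun _ _ h => EIndex.fe.inj h
  have e3 : Function.Injective EIndex.ef := fun _ _ h => EIndex.ef.inj h
  have h1 : HasSum (fun i : EIndex => match i with | .hh n => f (.hh n) | _ => 0) a :=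
    (e1.hasSum_iff fun i hi => by cases i <;> simp_all).1 ha
  have h2 : HasSum (fun i : EIndex => match i with | .fe n => f (.fe n) | _ => 0) b :=
    (e2.hasSum_iff fun i hi => by cases i <;> simp_all).1 hb
  have h3 : HasSum (fun i : EIndex => match i with | .ef n => f (.ef n) | _ => 0) c :=
    (e3.hasSum_iff fun i hi => by cases i <;> simp_all).1 hc
  have h4 : HasSum (fun i : EIndex => match i with | .cd => f .cd | _ => 0) (f .cd) :=
    hasSum_single EIndex.cd fun i hi => by cases i <;> simp_all
  refine (((h1.add h2).add h3).add h4).congr_fun fun i => ?_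
  cases i <;> simp

theorem finite_EIndex {s : Set EIndex} (h1 : {n | EIndex.hh n ∈ s}.Finite)
    (h2 : {n | EIndex.fe n ∈ s}.Finite) (h3 : {n | EIndex.ef n ∈ s}.Finite) : s.Finite := by
  refine ((((h1.image EIndex.hh).union (h2.image EIndex.fe)).union (h3.image EIndex.ef)).union
    (Set.finite_singleton EIndex.cd)).subset ?_
  rintro (n | n | n | _) hn
  · exact Or.inl (Or.inl (Or.inl ⟨n, hn, rfl⟩))
  · exact Or.inl (Or.inl (Or.inr ⟨n, hn, rfl⟩))
  · exact Or.inl (Or.inr ⟨n, hn, rfl⟩)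
  · exact Or.inr rfl

theorem LaurentAlgebra.neg_coord_pow {K : Type} [CommRing K] [Algebra ℂ K] [TestAlgebra K]
    [LaurentAlgebra K] (n : ℕ) : (-coord : K) ^ n = (-1) ^ n * coord ^ n := by
  rw [← neg_one_mul, mul_pow]

namespace IsExpansion

variable {K : Type} [Field K] [Algebra ℂ K] [TestAlgebra K] [LaurentAlgebra K]

/-- The series `rE` over an arbitrary algebra of Laurent series. -/
noncomputable def rMatrix (E : (ℂ → ℂ) → ℂ → K) (τ lam : ℂ) :
    EIndex → CurrentAlgebra K × CurrentAlgebra K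
  | .hh n => ((1 / 2 : ℂ) • hHat (dividedDer n (cartanKernel E τ)), hHat ((-coord) ^ n))
  | .fe n => (fHat (dividedDer n (rootKernel E τ lam)), eHat ((-coord) ^ n))
  | .ef n => (eHat ((-1) ^ n * dividedDer n (rootKernel E τ (-lam))), fHat (coord ^ n))
  | .cd => (cEl, dEl)

/-- The operator defined by the element `rMatrix`. -/
noncomputable def rOp (E : (ℂ → ℂ) → ℂ → K) (τ lam : ℂ) :
    CurrentAlgebra K →ₗ[ℂ] CurrentAlgebra K :=
  compOp (polarOp (rootKernel E τ (-lam))) (polarOp (rootKernel E τ lam))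
    (polarOp (cartanKernel E τ))

variable {E : (ℂ → ℂ) → ℂ → K} (hE : IsExpansion E) {τ lam : ℂ} (hτ : 0 < τ.im)
  (hlam : lam ∉ periodLattice τ)

theorem hasSum_rMatrix (E : (ℂ → ℂ) → ℂ → K) (τ lam : ℂ) (x y : CurrentAlgebra K) :
    HasSum (fun i => form K (rMatrix E τ lam i).1 x * form K (rMatrix E τ lam i).2 y)
      (form K x (rOp E τ lam y)) := by
  have h : form K x (rOp E τ lam y) = 2 * int (x.h * polarOp (cartanKernel E τ) y.h) +
      int (x.e * polarOp (rootKernel E τ lam) y.f) +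
      int (x.f * polarOp (rootKernel E τ (-lam)) y.e) +
      form K (rMatrix E τ lam .cd).1 x * form K (rMatrix E τ lam .cd).2 y := by
    rw [form_apply', rMatrix, form_cEl, form_dEl]
    simp only [rOp, compOp_e, compOp_f, compOp_h, compOp_c, compOp_d]
    ring
  rw [h]
  refine hasSum_EIndex ?_ ?_ ?_
  · refine ((hasSum_polarOp (cartanKernel E τ) y.h x.h).mul_left 2).congr_fun fun n => ?_
    simp only [rMatrix, map_smul, LinearMap.smul_apply, form_hHat, smul_eq_mul]
    ring
  · refine (hasSum_polarOp (rootKernel E τ lam) y.f x.e).congr_fun fun n => ?_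
    simp only [rMatrix, form_fHat, form_eHat]
  -- The sign (−1)ⁿ in the lower basis elements of negative index combines with uⁿ into (−u)ⁿ.
  · refine (hasSum_polarOp (rootKernel E τ (-lam)) y.e x.f).congr_fun fun n => ?_
    simp only [rMatrix, form_fHat, form_eHat, neg_coord_pow]
    have h1 : ∀ s : K, int ((-1) ^ n * s) = (-1) ^ n * int s := fun s => by
      have : (-1 : K) ^ n * s = (-1 : ℂ) ^ n • s := by simp [Algebra.smul_def]
      rw [this, map_smul, smul_eq_mul]
    rw [mul_assoc, mul_assoc, h1, h1]
    ring

theorem tensorSum_rMatrix (E : (ℂ → ℂ) → ℂ → K) (τ lam : ℂ) (x y : CurrentAlgebra K) :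
    tensorSum (form K) (rMatrix E τ lam) x y = form K x (rOp E τ lam y) := by
  have : HasSum (fun i => tensor₂ (form K) (rMatrix E τ lam i).1 (rMatrix E τ lam i).2)
      (fun x y => form K x (rOp E τ lam y)) :=
    Pi.hasSum.2 fun x => Pi.hasSum.2 fun y => hasSum_rMatrix E τ lam x y
  rw [tensorSum, this.tsum_eq]

theorem coord_pow_mul_mem_regular_iff (n : ℕ) (s : K) :
    coord ^ n * s ∈ regular ↔ (-coord) ^ n * s ∈ regular := by
  rw [neg_coord_pow, mul_assoc]
  rcases neg_one_pow_eq_or K n with h | h <;> simp [h]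

theorem finite_coord_pow_mul_notMem_regular (s : K) :
    {n : ℕ | coord ^ n * s ∉ regular}.Finite := by
  simp only [coord_pow_mul_mem_regular_iff]
  exact finite_pow_mul_notMem_regular s

theorem coord_pow_mem_regular (n : ℕ) : (coord : K) ^ n ∈ regular :=
  regular.pow_mem coord_mem_regular n

theorem neg_coord_pow_mem_regular (n : ℕ) : (-coord : K) ^ n ∈ regular :=
  regular.pow_mem (regular.neg_mem coord_mem_regular) n

theorem finite_rMatrix_snd (E : (ℂ → ℂ) → ℂ → K) (τ lam : ℂ) (y : CurrentAlgebra K) :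
    (Function.support fun i => form K (rMatrix E τ lam i).2 y).Finite := by
  refine finite_EIndex ((finite_pow_mul_notMem_regular y.h).subset fun n hn h0 => hn ?_)
    ((finite_pow_mul_notMem_regular y.f).subset fun n hn h0 => hn ?_)
    ((finite_coord_pow_mul_notMem_regular y.e).subset fun n hn h0 => hn ?_)
  all_goals simp only [rMatrix, form_eHat, form_fHat, form_hHat, int_eq_zero_of_mem_regular h0,
    mul_zero]

/-- The d component is unrestricted, since the operator discards it. -/
theorem rOp_eq_zero {x : CurrentAlgebra K} (he : x.e ∈ regular) (hf : x.f ∈ regular)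
    (hh : x.h ∈ regular) (hc : x.c = 0) : rOp E τ lam x = 0 := by
  ext
  · exact polarOp_eq_zero _ he
  · exact polarOp_eq_zero _ hf
  · exact polarOp_eq_zero _ hh
  · exact hc
  · rfl

theorem rOp_rMatrix_snd (i : EIndex) : rOp E τ lam (rMatrix E τ lam i).2 = 0 := by
  cases i with
  | hh n => exact rOp_eq_zero regular.zero_mem regular.zero_mem (neg_coord_pow_mem_regular n) rfl
  | fe n => exact rOp_eq_zero (neg_coord_pow_mem_regular n) regular.zero_mem regular.zero_mem rfl
  | ef n => exact rOp_eq_zero regular.zero_mem (coord_pow_mem_regular n) regular.zero_mem rfl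
  | cd => exact rOp_eq_zero regular.zero_mem regular.zero_mem regular.zero_mem rfl

theorem mul_pow_mem_regular_of_eventually (s : K) {p : K} (hp : p = coord ∨ p = -coord) :
    ∃ N, ∀ n ≥ N, p ^ n * s ∈ regular ∧ int (der (p ^ n) * s) = 0 := by
  obtain ⟨N, hN⟩ := exists_pow_mul_mem_regular s
  obtain ⟨N', hN'⟩ := exists_pow_mul_mem_regular (der s)
  have key : ∀ n t, (-coord) ^ n * t ∈ regular → p ^ n * t ∈ regular := fun n t h => by
    rcases hp with rfl | rfl
    · exact (coord_pow_mul_mem_regular_iff n t).2 h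
    · exact h
  refine ⟨max N N', fun n hn => ⟨key n s (hN n (le_of_max_le_left hn)), ?_⟩⟩
  rw [int_der_mul, int_eq_zero_of_mem_regular (key n _ (hN' n (le_of_max_le_right hn))), neg_zero]

/-- For large n the products of uⁿ with the components of z are regular and the central term of the
bracket is zero after an integration by parts. The bracket then lies in the kernel of the operator.
-/
theorem finite_rOp_lie_ne_zero (E : (ℂ → ℂ) → ℂ → K) (τ lam : ℂ) (z : CurrentAlgebra K) :
    {i | rOp E τ lam ⁅(rMatrix E τ lam i).2, z⁆ ≠ 0}.Finite := by
  have hfin : ∀ P : ℕ → Prop, (∃ N, ∀ n ≥ N, P n) → {n | ¬ P n}.Finite := fun P ⟨N, hN⟩ =>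
    (Set.finite_lt_nat N).subset fun n hn => by
      by_contra h
      exact hn (hN n (not_lt.1 h))
  have hz : ∀ p : K, p = coord ∨ p = -coord → ∃ N, ∀ n ≥ N, p ^ n ∈ regular ∧
      der (p ^ n) ∈ regular ∧ p ^ n * z.e ∈ regular ∧ p ^ n * z.f ∈ regular ∧
      p ^ n * z.h ∈ regular ∧ int (der (p ^ n) * z.e) = 0 ∧ int (der (p ^ n) * z.f) = 0 ∧
      int (der (p ^ n) * z.h) = 0 := fun p hp => by
    obtain ⟨N₁, h₁⟩ := mul_pow_mem_regular_of_eventually z.e hp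
    obtain ⟨N₂, h₂⟩ := mul_pow_mem_regular_of_eventually z.f hp
    obtain ⟨N₃, h₃⟩ := mul_pow_mem_regular_of_eventually z.h hp
    refine ⟨max N₁ (max N₂ N₃), fun n hn => ?_⟩
    have hn' := le_of_max_le_right hn
    obtain ⟨a₁, b₁⟩ := h₁ n (le_of_max_le_left hn)
    obtain ⟨a₂, b₂⟩ := h₂ n (le_of_max_le_left hn')
    obtain ⟨a₃, b₃⟩ := h₃ n (le_of_max_le_right hn')
    have hreg : p ^ n ∈ regular := by
      rcases hp with rfl | rfl
      · exact coord_pow_mem_regular n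
      · exact neg_coord_pow_mem_regular n
    exact ⟨hreg, der_mem_regular hreg, a₁, a₂, a₃, b₁, b₂, b₃⟩
  have h2 : ∀ s : K, 2 * s = (2 : ℂ) • s := fun s => by rw [Algebra.smul_def, map_ofNat]
  have h2' : ∀ s : K, -2 * s = (-2 : ℂ) • s := fun s => by
    rw [Algebra.smul_def, map_neg, map_ofNat]
  refine finite_EIndex ((hfin _ (hz (-coord) (Or.inr rfl))).subset fun n hn h0 => hn ?_)
    ((hfin _ (hz (-coord) (Or.inr rfl))).subset fun n hn h0 => hn ?_)
    ((hfin _ (hz coord (Or.inl rfl))).subset fun n hn h0 => hn ?_)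
  all_goals
    obtain ⟨hreg, hder, he, hf, hh, he', hf', hh'⟩ := h0
    apply rOp_eq_zero
    all_goals
      simp only [rMatrix, bracket_e, bracket_f, bracket_h, bracket_c, hHat, eHat, fHat, zero_mul,
        sub_zero, zero_sub, add_zero, zero_add, zero_smul, smul_zero, map_zero, h2, h2',
        map_smul, he', hf', hh', smul_neg]
      try simp (maxDischargeDepth := 4) only [sub_eq_add_neg, regular.add_mem, regular.neg_mem,
        regular.smul_mem, regular.zero_mem, hder, he, hf, hh]

include hE hτ hlam

/-- A fixed Laurent series may pair nontrivially with infinitely many derivatives of a kernel, so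
finiteness in the first factor is not available. The projection criterion is used, the second
factors being regular or equal to d. -/
theorem isRMatrix_rMatrix (hsep : ∀ s : K, (∀ t, int (s * t) = 0) → s = 0) :
    IsRMatrix (form K) (rMatrix E τ lam) (rOp E τ lam) := by
  have hθ := theta_ne_zero hτ hlam
  have hθ' := theta_ne_zero hτ (neg_notMem_periodLattice hlam)
  have h1 := hE.principal_rootKernel hτ hθ
  have h2 := hE.principal_rootKernel hτ hθ'
  have h3 := hE.principal_cartanKernel hτ
  refine IsRMatrix.of_projection form_symm form_invariant (form_separating hsep)
    (finite_rMatrix_snd E τ lam) (hasSum_rMatrix E τ lam)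
    (compOp_unitary (polarOp_unitary h1 h2 (hE.reflect_rootKernel hτ))
      (polarOp_unitary h3 h3 (hE.reflect_cartanKernel hτ)))
    (fun x => ?_) rOp_rMatrix_snd (finite_rOp_lie_ne_zero E τ lam)
  ext
  · exact polarOp_polarOp h2 _ _
  · exact polarOp_polarOp h1 _ _
  · exact polarOp_polarOp h3 _ _
  · rfl
  · rfl

/-- The addition theorem behind the dynamical Yang-Baxter equation. -/
theorem int_cartanKernel_mul (w a b : K) :
    int (polarOp (cartanKernel E τ) w * polarOp (rootKernel E τ (-lam)) a *
        polarOp (rootKernel E τ lam) b) +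
      int ((w - polarOp (cartanKernel E τ) w) * (a - polarOp (rootKernel E τ (-lam)) a) *
        (b - polarOp (rootKernel E τ lam) b)) =
      int w * int (a * polarOp (rootKernelDeriv E τ lam) b) := by
  have hθ := theta_ne_zero hτ hlam
  have h1 := hE.principal_rootKernel hτ hθ
  have h2 := hE.principal_rootKernel hτ (theta_ne_zero hτ (neg_notMem_periodLattice hlam))
  rw [int_mul_eq_zero (regular.mul_mem (sub_polarOp_mem_regular (hE.principal_cartanKernel hτ) w)
    (sub_polarOp_mem_regular h2 a)) (sub_polarOp_mem_regular h1 b), add_zero]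
  exact int_polarOp_mul_mul h2 (hE.reflect_rootKernel hτ) (hE.rootKernelDeriv_mem_regular hτ hθ)
    (fun m n => polarOp_rootKernel_of_mem_quotients (hE := hE) (hτ := hτ) hlam
      (dividedDer_mul_sub_mem_quotients m n)) w a b

theorem hasDerivAt_int_mul_polarOp (s t : K) :
    HasDerivAt (fun l => int (t * polarOp (rootKernel E τ l) s))
      (int (t * polarOp (rootKernelDeriv E τ lam) s)) lam := by
  obtain ⟨w, hw⟩ := exists_int_mul_polarOp s t
  simp only [hw]
  exact hE.hasDerivAt_int_rootKernel_mul hτ (theta_ne_zero hτ hlam) w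

theorem hasDerivAt_tensorSum_rMatrix (x y : CurrentAlgebra K) :
    HasDerivAt (fun l => tensorSum (form K) (rMatrix E τ l) x y)
      (int (x.e * polarOp (rootKernelDeriv E τ lam) y.f) -
        int (y.e * polarOp (rootKernelDeriv E τ lam) x.f)) lam := by
  have hθ := isOddTheta_theta hτ
  have h1 := (hE.hasDerivAt_int_mul_polarOp hτ hlam y.f x.e).sub
    (hE.hasDerivAt_int_mul_polarOp hτ hlam x.f y.e)
  refine (h1.add_const (int (x.f * y.e) + 2 * int (x.h * polarOp (cartanKernel E τ) y.h) +
    x.d * y.c)).congr_of_eventuallyEq ?_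
  -- Unitarity trades the operator with parameter −l for the one with parameter l and a term
  -- independent of l. It needs θ(l) ≠ 0, which holds near λ.
  filter_upwards [hθ.holomorphic.continuous.continuousAt.eventually_ne
    (theta_ne_zero hτ hlam)] with l hl
  have hl' : theta τ (-l) ≠ 0 := by
    rw [hθ.odd]
    exact neg_ne_zero.2 hl
  have h2 := polarOp_unitary (hE.principal_rootKernel hτ hl) (hE.principal_rootKernel hτ hl')
    (hE.reflect_rootKernel hτ) y.e x.f
  rw [mul_comm y.e x.f, mul_comm _ x.f] at h2
  simp only [tensorSum_rMatrix, form_apply', rOp, compOp_e, compOp_f, compOp_h, compOp_c, compOp_d,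
    Pi.sub_apply]
  linear_combination h2

theorem yangBaxter_rMatrix (hsep : ∀ s : K, (∀ t, int (s * t) = 0) → s = 0) :
    yangBaxter (form K) (rMatrix E τ lam) = insertCyc (form K) (hHat 1)
      (fun x y => deriv (fun l => tensorSum (form K) (rMatrix E τ l) x y) lam) := by
  simp only [(hE.hasDerivAt_tensorSum_rMatrix hτ hlam _ _).deriv]
  rw [yangBaxter_compOp (hE.isRMatrix_rMatrix hτ hlam hsep) _ (hE.int_cartanKernel_mul hτ hlam)]
  -- The minus parts and their derivatives are regular, so their products have no residue; this is
  -- why no τ-derivative appears in the elliptic case.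
  have h0 : ∀ x y, derForm (x - rOp E τ lam x) (y - rOp E τ lam y) = 0 := fun x y => by
    have h1 := hE.principal_rootKernel hτ (theta_ne_zero hτ hlam)
    have h2 := hE.principal_rootKernel hτ (theta_ne_zero hτ (neg_notMem_periodLattice hlam))
    have h3 := hE.principal_cartanKernel hτ
    simp only [derForm, rOp, sub_e, sub_f, sub_h, compOp_e, compOp_f, compOp_h]
    have he := sub_polarOp_mem_regular h2
    have hf := sub_polarOp_mem_regular h1
    have hh := sub_polarOp_mem_regular h3
    rw [int_mul_eq_zero (der_mem_regular (he x.e)) (hf y.f),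
      int_mul_eq_zero (der_mem_regular (hf x.f)) (he y.e),
      int_mul_eq_zero (der_mem_regular (hh x.h)) (hh y.h)]
    simp
  funext x y z
  simp only [Pi.add_apply, insertCyc]
  change _ + (_ * derForm (y - rOp E τ lam y) (z - rOp E τ lam z) -
    _ * derForm (x - rOp E τ lam x) (z - rOp E τ lam z) +
    _ * derForm (x - rOp E τ lam x) (y - rOp E τ lam y)) = _
  rw [h0, h0, h0]
  ring

end IsExpansion

theorem rE_eq_rMatrix (τ : ℂ) : rE τ = IsExpansion.rMatrix taylor τ := by
  funext l i
  cases i with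
  | hh n =>
    simp only [rE, IsExpansion.rMatrix, LaurentAlgebra.dividedDer_apply]
    rfl
  | fe n =>
    simp only [rE, IsExpansion.rMatrix, LaurentAlgebra.dividedDer_apply]
    rfl
  | ef n =>
    simp only [rE, IsExpansion.rMatrix, LaurentAlgebra.dividedDer_apply]
    rfl
  | cd => rfl

theorem hHat_epsDown0_zero (τ : ℂ) : hHat (epsDown0 τ 0) = hHat 1 := by
  change hHat ((-uCoord) ^ 0) = hHat 1
  rw [pow_zero]

end EllipticCurrent

theorem mainTheorem11 (τ lam : ℂ) (hτ : 0 < τ.im) (hlam : lam ∉ periodLattice τ) :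
    -- the theta function entering the bases of `K₀`
    IsOddTheta τ (theta τ) ∧
    -- the algebra `e_τ(sl₂^)`
    (Converges (form K0) (rE τ lam) ∧
      (∀ x y, DifferentiableAt ℂ (fun l => tensorSum (form K0) (rE τ l) x y) lam) ∧
      yangBaxter (form K0) (rE τ lam) =
        insertCyc (form K0) (hHat (epsDown0 τ 0))
          (fun x y => deriv (fun l => tensorSum (form K0) (rE τ l) x y) lam) ∧
      IsQuasiLieBialgebra (form K0) (cobracket (form K0) (rE τ lam))
        (-yangBaxter (form K0) (rE τ lam))) ∧
    -- the algebra `u_τ(sl₂^)`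
    (Converges (form KCyl) (rU τ lam) ∧
      (∀ x y, DifferentiableAt ℂ (fun l => tensorSum (form KCyl) (rU τ l) x y) lam) ∧
      (∀ x y, DifferentiableAt ℂ (fun t => tensorSum (form KCyl) (rU t lam) x y) τ) ∧
      yangBaxter (form KCyl) (rU τ lam) =
        insertCyc (form KCyl) (hHat (jDown 0))
          (fun x y => deriv (fun l => tensorSum (form KCyl) (rU τ l) x y) lam) -
        insertCyc (form KCyl) cEl
          (fun x y => deriv (fun t => tensorSum (form KCyl) (rU t lam) x y) τ) ∧
      IsQuasiLieBialgebra (form KCyl) (cobracket (form KCyl) (rU τ lam))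
        (-yangBaxter (form KCyl) (rU τ lam))) := by
  have hE := K0.isExpansion_taylor.isRMatrix_rMatrix hτ hlam K0.int_separating
  have hU := isRMatrix_rU hτ hlam
  refine ⟨isOddTheta_theta hτ, ⟨?_, fun x y => ?_, ?_, ?_⟩, hU.converges,
    fun x y => (hasDerivAt_tensorSum_rU hlam x y).differentiableAt,
    fun x y => (hasDerivAt_tensorSum_rU_tau hτ hlam x y).differentiableAt,
    yangBaxter_rU hτ hlam, hU.isQuasiLieBialgebra⟩
  · rw [rE_eq_rMatrix]
    exact hE.converges
  · rw [rE_eq_rMatrix]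
    exact (K0.isExpansion_taylor.hasDerivAt_tensorSum_rMatrix hτ hlam x y).differentiableAt
  · rw [hHat_epsDown0_zero, rE_eq_rMatrix]
    exact K0.isExpansion_taylor.yangBaxter_rMatrix hτ hlam K0.int_separating
  · rw [rE_eq_rMatrix]
    exact hE.isQuasiLieBialgebra
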